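/- Let $\mathbb{K}$ be $\mathbb{R}$ or $\mathbb{C}$, let $\alpha,\beta\in\mathbb{K}$ be not both zero, and consider Fordy's evolution equation $$u_t=F:=u_5+(4\alpha-6\beta)u_1u_2+(8\alpha-2\beta)u_0u_3-20\alpha\beta u_0^2u_1,\qquad u_k=\frac{\partial^k u}{\partial x^k},\quad u_0=u.$$ Its infinite prolongation $\mathcal{E}$ is the space with coordinates $x,t,u_0,u_1,u_2,\dots$ with values in $\mathbb{K}$, with total derivatives $$D_x=\frac{\partial}{\partial x}+\sum_{k\ge0}u_{k+1}\frac{\partial}{\partial u_k},\qquad D_t=\frac{\partial}{\partial t}+\sum_{k\ge0}D_x^k(F)\frac{\partial}{\partial u_k}.$$ Let $a=(x_a,t_a,a_0,a_1,\dots)\in\mathcal{E}$. For $p\ge0$ let $\mathbb{F}^p(\mathcal{E},a)$ be the Lie algebra over $\mathbb{K}$ given by generators $A^{l_1,l_2}_{i_0\dots i_p}$ and $B^{l_1,l_2}_{j_0\dots j_{p+4}}$ (all indices nonnegative integers) and the following relations. First, with the formal power series $$A=\sum (x-x_a)^{l_1}(t-t_a)^{l_2}(u_0-a_0)^{i_0}\cdots(u_p-a_p)^{i_p}A^{l_1,l_2}_{i_0\dots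 i_p},$$ $$B=\sum (x-x_a)^{l_1}(t-t_a)^{l_2}(u_0-a_0)^{j_0}\cdots(u_{p+4}-a_{p+4})^{j_{p+4}}B^{l_1,l_2}_{j_0\dots j_{p+4}},$$ all coefficients of the power series $D_x(B)-D_t(A)+[A,B]$ (expanded at $a$) are zero. Second, $A^{l_1,l_2}_{0\dots0}=0$ and $B^{0,l_2}_{0\dots0}=0$ for all $l_1,l_2$, and $A^{l_1,l_2}_{i_0\dots i_p}=0$ for all $l_1,l_2$ whenever there is $r\in\{1,\dots,p\}$ with $i_r=1$ and $i_q=0$ for all $q>r$. Let $\varphi_1\colon\mathbb{F}^1(\mathcal{E},a)\to\mathbb{F}^0(\mathcal{E},a)$ be the Lie algebra homomorphism given by $A^{l_1,l_2}_{i_0i_1}\mapsto\delta_{0,i_1}A^{l_1,l_2}_{i_0}$ and $B^{l_1,l_2}_{j_0\dots j_5}\mapsto\delta_{0,j_5}B^{l_1,l_2}_{j_0\dots j_4}$. Then: 1. The homomorphism $\varphi_1$ is surjective, and its kernel is contained in the center of $\mathbb{F}^1(\mathcal{E},a)$: $[v_1,v_2]=0$ for all $v_1\in\ker\varphi_1$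 and $v_2\in\mathbb{F}^1(\mathcal{E},a)$. In particular, $\mathbb{F}^1(\mathcal{E},a)$ is obtained from $\mathbb{F}^0(\mathcal{E},a)$ by central extension, that is, $\mathbb{F}^1(\mathcal{E},a)/I\cong\mathbb{F}^0(\mathcal{E},a)$ for some ideal $I$ contained in the center of $\mathbb{F}^1(\mathcal{E},a)$. 2. If $\alpha+\beta\ne0$, $6\alpha+\beta\ne0$, $16\alpha+\beta\ne0$ and $\alpha\ne0$, then $\mathbb{F}^0(\mathcal{E},a)$ is isomorphic to the direct sum of the $3$-dimensional simple Lie algebra $\mathfrak{sl}_2(\mathbb{K})$ and an abelian Lie algebra of dimension at most $3$. 3. If $\alpha=0$ and $\beta\ne0$, then the Lie algebra $\mathbb{F}^0(\mathcal{E},a)$ is nilpotent and has dimension at most $6$. -/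

import Mathlib

namespace EvolutionZCR

/-- The coordinates `x`, `t`, `u_k` (`k = 0, 1, 2, …`) on the infinite prolongation of a scalar
evolution equation. -/
inductive Coord : Type
  | x : Coord
  | t : Coord
  | u : ℕ → Coord
  deriving DecidableEq

/-- `x`, `t`, and the `u_k` with `k < n`. -/
def coordsBelow (n : ℕ) : Set Coord := {c | ∀ k, c = Coord.u k → k < n}

section Equations

variable (K : Type*) [CommRing K]

/-- A scalar evolution equation `u_t = F(x, t, u_0, …, u_d)` of order at most `d ≥ 1` with
polynomial right-hand side `F`. -/
structure EvolutionEq where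
  order : ℕ
  order_pos : 1 ≤ order
  rhs : MvPolynomial Coord K
  rhs_mem : rhs ∈ MvPolynomial.supported K (coordsBelow (order + 1))

variable {K}

/-- The (set underlying the) infinite prolongation. As `F` is a polynomial, it is defined
everywhere, and the infinite prolongation is the whole space with coordinates `x`, `t`, `u_k`.
A point is given by the values of its coordinates. -/
abbrev EvolutionEq.Prolongation (_E : EvolutionEq K) : Type _ := Coord → K

/-- The total derivative `D_x = ∂_x + ∑_k u_{k+1} ∂_{u_k}` on polynomial functions. -/
noncomputable def polyDx : Derivation K (MvPolynomial Coord K) (MvPolynomial Coord K) :=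
  MvPolynomial.mkDerivation K fun c =>
    match c with
    | Coord.x => 1
    | Coord.t => 0
    | Coord.u k => MvPolynomial.X (Coord.u (k + 1))

/-- The expansion of a polynomial at the point `a`: the variable `c` of the result stands for the
difference of the coordinate `c` and its value `a c`. -/
noncomputable def expandAt (a : Coord → K) (f : MvPolynomial Coord K) : MvPolynomial Coord K :=
  MvPolynomial.aeval (fun c => MvPolynomial.X c + MvPolynomial.C (a c)) f

end Equations

section Series

variable {K : Type*} [CommRing K] {L : Type*} [LieRing L] [LieAlgebra K L]

/-- Exponents of monomials in `x - x_a`, `t - t_a`, `u_k - a_k`. -/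
abbrev Mon : Type := Coord →₀ ℕ

/-- The monomial involves only `x - x_a`, `t - t_a` and `u_k - a_k` for `k < n`. -/
def MonBelow (n : ℕ) (m : Mon) : Prop := ∀ k, n ≤ k → m (Coord.u k) = 0

/-- The monomial involves only `x - x_a` and `t - t_a`. -/
abbrev NoU (m : Mon) : Prop := MonBelow 0 m

/-- A formal power series in `x - x_a`, `t - t_a`, `u_k - a_k` with coefficients in `L`, given by
its coefficients. -/
abbrev FSeries (L : Type*) : Type _ := Mon → L

/-- The partial derivative with respect to the coordinate `c`. -/
noncomputable def pderiv (c : Coord) (S : FSeries L) : FSeries L :=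
  fun m => (m c + 1) • S (m + Finsupp.single c 1)

/-- The product of a polynomial and a series. -/
noncomputable def polyMul (f : MvPolynomial Coord K) (S : FSeries L) : FSeries L :=
  fun m => ∑ q ∈ Finset.HasAntidiagonal.antidiagonal m, f.coeff q.1 • S q.2

/-- The bracket of two series: the bracket of `L`, extended bilinearly over power series. -/
noncomputable def bracket (S T : FSeries L) : FSeries L :=
  fun m => ∑ q ∈ Finset.HasAntidiagonal.antidiagonal m, ⁅S q.1, T q.2⁆

/-- The total derivative `D_x = ∂_x + ∑_k u_{k+1} ∂_{u_k}` of a series expanded at `a`.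
The sum is over `k < n`: this is the whole sum for a series that involves, besides `x` and `t`,
only `u_k` with `k < n` (see `totalDx_eq_of_le`), and it is applied to such series only. -/
noncomputable def totalDx (a : Coord → K) (n : ℕ) (S : FSeries L) : FSeries L :=
  pderiv Coord.x S +
    ∑ k ∈ Finset.range n,
      polyMul (expandAt a (MvPolynomial.X (Coord.u (k + 1)))) (pderiv (Coord.u k) S)

/-- The total derivative `D_t = ∂_t + ∑_k D_x^k(F) ∂_{u_k}` of a series expanded at `a`, where
`F` is the right-hand side of the equation; as for `totalDx`, the sum is over `k < n`. -/
noncomputable def totalDt (E : EvolutionEq K) (a : E.Prolongation) (n : ℕ) (S : FSeries L) :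
    FSeries L :=
  pderiv Coord.t S +
    ∑ k ∈ Finset.range n,
      polyMul (expandAt a ((⇑(polyDx (K := K)))^[k] E.rhs)) (pderiv (Coord.u k) S)

/-- `D_x(B) - D_t(A) + [A, B]` for series `A` in `x`, `t`, `u_0, …, u_p` and `B` in
`x`, `t`, `u_0, …, u_{p+d-1}`, where `d` is the order of the equation. -/
noncomputable def zcrExpr (E : EvolutionEq K) (a : E.Prolongation) (p : ℕ) (A B : FSeries L) :
    FSeries L :=
  totalDx a (p + E.order) B - totalDt E a (p + 1) A + bracket A B

theorem pderiv_eq_zero {n k : ℕ} (h : n ≤ k) {S : FSeries L}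
    (hS : ∀ m, ¬ MonBelow n m → S m = 0) : pderiv (Coord.u k) S = 0 := by
  funext m
  have : S (m + Finsupp.single (Coord.u k) 1) = 0 := by
    apply hS
    intro hm
    have := hm k h
    simp at this
  simp [pderiv, this]

theorem polyMul_zero (f : MvPolynomial Coord K) : polyMul f (0 : FSeries L) = 0 := by
  funext m
  simp [polyMul]

theorem totalDx_eq_of_le (a : Coord → K) {n n' : ℕ} (h : n ≤ n') {S : FSeries L}
    (hS : ∀ m, ¬ MonBelow n m → S m = 0) : totalDx a n' S = totalDx a n S := by
  unfold totalDx
  congr 1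
  refine (Finset.sum_subset (Finset.range_mono h) ?_).symm
  intro k _ hk
  rw [pderiv_eq_zero (by simpa using hk) hS, polyMul_zero]

theorem totalDt_eq_of_le (E : EvolutionEq K) (a : E.Prolongation) {n n' : ℕ} (h : n ≤ n')
    {S : FSeries L} (hS : ∀ m, ¬ MonBelow n m → S m = 0) :
    totalDt E a n' S = totalDt E a n S := by
  unfold totalDt
  congr 1
  refine (Finset.sum_subset (Finset.range_mono h) ?_).symm
  intro k _ hk
  rw [pderiv_eq_zero (by simpa using hk) hS, polyMul_zero]

theorem zcrExpr_succ (E : EvolutionEq K) (a : E.Prolongation) (p : ℕ) {A B : FSeries L}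
    (hA : ∀ m, ¬ MonBelow (p + 1) m → A m = 0)
    (hB : ∀ m, ¬ MonBelow (p + E.order) m → B m = 0) :
    zcrExpr E a (p + 1) A B = zcrExpr E a p A B := by
  unfold zcrExpr
  rw [totalDx_eq_of_le a (by omega) hB, totalDt_eq_of_le E a (Nat.le_succ _) hA]

variable {L' : Type*} [LieRing L'] [LieAlgebra K L']

theorem map_zcrExpr (E : EvolutionEq K) (a : E.Prolongation) (p : ℕ) (A B : FSeries L)
    (g : L →ₗ⁅K⁆ L') (m : Mon) :
    g (zcrExpr E a p A B m) = zcrExpr E a p (fun m => g (A m)) (fun m => g (B m)) m := by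
  simp [zcrExpr, totalDx, totalDt, pderiv, polyMul, bracket, map_sum, map_nsmul]

end Series

section Algebras

variable {K : Type*} [CommRing K]

/-- The generators of `𝔽^p(E, a)`: the symbols `A^{l₁,l₂}_{i_0…i_p}` and
`B^{l₁,l₂}_{j_0…j_{p+d-1}}`, indexed by monomials, where `d` is the order of the equation. -/
inductive Gen (E : EvolutionEq K) (p : ℕ) : Type
  | A (m : Mon) (hm : MonBelow (p + 1) m) : Gen E p
  | B (m : Mon) (hm : MonBelow (p + E.order) m) : Gen E p

open Classical in
/-- The series `∑ x^{l₁} t^{l₂} u_0^{i_0} ⋯ u_p^{i_p} • A^{l₁,l₂}_{i_0…i_p}` (in coordinates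
centered at `a`) with coefficients the symbols `A`, mapped by `g` to `L`. -/
noncomputable def genA {E : EvolutionEq K} {p : ℕ} {L : Type*} [Zero L] (g : Gen E p → L) :
    FSeries L :=
  fun m => if hm : MonBelow (p + 1) m then g (Gen.A m hm) else 0

open Classical in
/-- The analogous series with coefficients the symbols `B`. -/
noncomputable def genB {E : EvolutionEq K} {p : ℕ} {L : Type*} [Zero L] (g : Gen E p → L) :
    FSeries L :=
  fun m => if hm : MonBelow (p + E.order) m then g (Gen.B m hm) else 0

/-- `(i_0, …, i_p) ∈ V_p`: there is `r ∈ {1, …, p}` with `i_r = 1` and `i_q = 0` for `q > r`. -/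
def InV (p : ℕ) (m : Mon) : Prop :=
  ∃ r, 1 ≤ r ∧ r ≤ p ∧ m (Coord.u r) = 1 ∧ ∀ q, r < q → q ≤ p → m (Coord.u q) = 0

/-- The relators of `𝔽^p(E, a)`. -/
inductive Relator (E : EvolutionEq K) (a : E.Prolongation) (p : ℕ) :
    FreeLieAlgebra K (Gen E p) → Prop
  /-- `D_x(B) - D_t(A) + [A, B] = 0`, coefficient by coefficient. -/
  | zcr (m : Mon) : Relator E a p
      (zcrExpr E a p (genA (FreeLieAlgebra.of K)) (genB (FreeLieAlgebra.of K)) m)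
  /-- `A^{l₁,l₂}_{0…0} = 0`. -/
  | normA (m : Mon) (hm : MonBelow (p + 1) m) (h : NoU m) : Relator E a p
      (FreeLieAlgebra.of K (Gen.A m hm))
  /-- `B^{0,l₂}_{0…0} = 0`. -/
  | normB (m : Mon) (hm : MonBelow (p + E.order) m) (h : NoU m) (hx : m Coord.x = 0) :
      Relator E a p (FreeLieAlgebra.of K (Gen.B m hm))
  /-- `A^{l₁,l₂}_{i_0…i_p} = 0` for `(i_0, …, i_p) ∈ V_p`. -/
  | normV (m : Mon) (hm : MonBelow (p + 1) m) (h : InV p m) : Relator E a p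
      (FreeLieAlgebra.of K (Gen.A m hm))

/-- The ideal of relations of `𝔽^p(E, a)`. -/
noncomputable def relIdeal (E : EvolutionEq K) (a : E.Prolongation) (p : ℕ) :
    LieIdeal K (FreeLieAlgebra K (Gen E p)) :=
  LieSubmodule.lieSpan K (FreeLieAlgebra K (Gen E p)) {r | Relator E a p r}

/-- The Lie algebra `𝔽^p(E, a)`, given by generators and relations. -/
abbrev Fd (E : EvolutionEq K) (a : E.Prolongation) (p : ℕ) : Type _ :=
  FreeLieAlgebra K (Gen E p) ⧸ relIdeal E a p

/-- The element of `𝔽^p(E, a)` given by a generator. -/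
noncomputable def Fd.of (E : EvolutionEq K) (a : E.Prolongation) (p : ℕ) (s : Gen E p) : Fd E a p :=
  LieSubmodule.Quotient.mk (FreeLieAlgebra.of K s)

open Classical in
/-- The images of the generators of `𝔽^{p+1}(E, a)` in `𝔽^p(E, a)`:
`A^{l₁,l₂}_{i_0…i_p i_{p+1}} ↦ δ_{0,i_{p+1}} A^{l₁,l₂}_{i_0…i_p}`, and likewise for `B`. -/
noncomputable def genImage (E : EvolutionEq K) (a : E.Prolongation) (p : ℕ) :
    Gen E (p + 1) → Fd E a p
  | Gen.A m _ => if h : MonBelow (p + 1) m then Fd.of E a p (Gen.A m h) else 0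
  | Gen.B m _ => if h : MonBelow (p + E.order) m then Fd.of E a p (Gen.B m h) else 0

/-- The homomorphism from a free Lie algebra that `genImage` determines. -/
noncomputable def freeHom (E : EvolutionEq K) (a : E.Prolongation) (p : ℕ) :
    FreeLieAlgebra K (Gen E (p + 1)) →ₗ⁅K⁆ Fd E a p :=
  FreeLieAlgebra.lift K (genImage E a p)

theorem MonBelow.mono {n n' : ℕ} (h : n ≤ n') {m : Mon} (hm : MonBelow n m) : MonBelow n' m :=
  fun k hk => hm k (h.trans hk)

/-- The quotient homomorphism from the free Lie algebra. -/
noncomputable def Fd.mkHom (E : EvolutionEq K) (a : E.Prolongation) (p : ℕ) :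
    FreeLieAlgebra K (Gen E p) →ₗ⁅K⁆ Fd E a p :=
  { (LieSubmodule.Quotient.mk' (relIdeal E a p) :
      FreeLieAlgebra K (Gen E p) →ₗ[K] Fd E a p) with
    map_lie' := fun {_ _} => rfl }

theorem Fd.mk_relator {E : EvolutionEq K} {a : E.Prolongation} {p : ℕ}
    {r : FreeLieAlgebra K (Gen E p)} (h : Relator E a p r) : Fd.mkHom E a p r = 0 :=
  LieSubmodule.Quotient.mk_eq_zero'.2 (LieSubmodule.subset_lieSpan h)

theorem Fd.zcr (E : EvolutionEq K) (a : E.Prolongation) (p : ℕ) (m : Mon) :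
    zcrExpr E a p (genA (Fd.of E a p)) (genB (Fd.of E a p)) m = 0 := by
  have h := Fd.mk_relator (Relator.zcr (E := E) (a := a) (p := p) m)
  rw [map_zcrExpr] at h
  convert h using 2
  · funext m
    simp only [genA]
    split_ifs
    · rfl
    · simp
  · funext m
    simp only [genB]
    split_ifs
    · rfl
    · simp

theorem freeHom_relator (E : EvolutionEq K) (a : E.Prolongation) (p : ℕ)
    {r : FreeLieAlgebra K (Gen E (p + 1))} (h : Relator E a (p + 1) r) :
    freeHom E a p r = 0 := by
  cases h with
  | zcr m =>
    rw [map_zcrExpr]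
    have hA : (fun m => freeHom E a p (genA (FreeLieAlgebra.of K) m)) =
        genA (Fd.of E a p) := by
      funext m
      simp only [genA]
      by_cases h : MonBelow (p + 1) m
      · have h' : MonBelow (p + 1 + 1) m := h.mono (Nat.le_succ _)
        simp [h, h', freeHom, genImage]
      · by_cases h' : MonBelow (p + 1 + 1) m <;> simp [h, h', freeHom, genImage]
    have hB : (fun m => freeHom E a p (genB (FreeLieAlgebra.of K) m)) =
        genB (Fd.of E a p) := by
      funext m
      simp only [genB]
      by_cases h : MonBelow (p + E.order) m
      · have h' : MonBelow (p + 1 + E.order) m := h.mono (by omega)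
        simp [h, h', freeHom, genImage]
      · by_cases h' : MonBelow (p + 1 + E.order) m <;> simp [h, h', freeHom, genImage]
    rw [hA, hB, zcrExpr_succ, Fd.zcr]
    · intro m hm
      simp [genA, hm]
    · intro m hm
      simp [genB, hm]
  | normA m hm h =>
    have h' : MonBelow (p + 1) m := h.mono (Nat.zero_le _)
    simp only [freeHom, FreeLieAlgebra.lift_of_apply, genImage, h', dif_pos]
    exact Fd.mk_relator (Relator.normA m h' h)
  | normB m hm h hx =>
    have h' : MonBelow (p + E.order) m := h.mono (Nat.zero_le _)
    simp only [freeHom, FreeLieAlgebra.lift_of_apply, genImage, h', dif_pos]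
    exact Fd.mk_relator (Relator.normB m h' h hx)
  | normV m hm h =>
    simp only [freeHom, FreeLieAlgebra.lift_of_apply, genImage]
    split_ifs with h'
    · refine Fd.mk_relator (Relator.normV m h' ?_)
      obtain ⟨r, h1, h2, h3, h4⟩ := h
      refine ⟨r, h1, ?_, h3, fun q hq hq' => h4 q hq (by omega)⟩
      by_contra hr
      have := h' r (by omega)
      omega
    · rfl

theorem relIdeal_le_ker (E : EvolutionEq K) (a : E.Prolongation) (p : ℕ) :
    relIdeal E a (p + 1) ≤ (freeHom E a p).ker :=
  LieSubmodule.lieSpan_le.2 fun _ h => (LieHom.mem_ker).2 (freeHom_relator E a p h)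

/-- The homomorphism `φ_{p+1} : 𝔽^{p+1}(E, a) → 𝔽^p(E, a)`, given on generators by `genImage`. -/
noncomputable def fdHom (E : EvolutionEq K) (a : E.Prolongation) (p : ℕ) :
    Fd E a (p + 1) →ₗ⁅K⁆ Fd E a p :=
  { Submodule.liftQ (relIdeal E a (p + 1)).toSubmodule
      (freeHom E a p : FreeLieAlgebra K (Gen E (p + 1)) →ₗ[K] Fd E a p)
      (fun _ hr => (LieHom.mem_ker).1 (relIdeal_le_ker E a p hr)) with
    map_lie' := by
      rintro ⟨v⟩ ⟨w⟩
      exact (freeHom E a p).map_lie v w }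

theorem fdHom_of (E : EvolutionEq K) (a : E.Prolongation) (p : ℕ) (s : Gen E (p + 1)) :
    fdHom E a p (Fd.of E a (p + 1) s) = genImage E a p s :=
  FreeLieAlgebra.lift_of_apply (genImage E a p) s

end Algebras

section LieNotions

/-- `L₁` is obtained from `L` by central extension: `L ≅ L₁ / I` for an ideal `I` contained in
the center of `L₁`. -/
def IsCentralExtensionOf (K : Type*) [CommRing K] (L₁ L : Type*) [LieRing L₁] [LieAlgebra K L₁]
    [LieRing L] [LieAlgebra K L] : Prop :=
  ∃ I : LieIdeal K L₁, I ≤ LieAlgebra.center K L₁ ∧ Nonempty ((L₁ ⧸ I) ≃ₗ⁅K⁆ L)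

/-- `L` is isomorphic to the direct sum of `𝔰𝔩₂(K)` and an abelian Lie algebra of
dimension at most `n`. -/
def IsSl2PlusAbelian.{v, w} (K : Type v) [Field K] (L : Type w) [LieRing L] [LieAlgebra K L]
    (n : ℕ) : Prop :=
  ∃ (V : Type w) (_ : LieRing V) (_ : LieAlgebra K V),
    IsLieAbelian V ∧ Module.rank K V ≤ n ∧
      Nonempty (L ≃ₗ⁅K⁆ LieAlgebra.SpecialLinear.sl (Fin 2) K × V)

end LieNotions

section Fordy

open MvPolynomial in
/-- The equation
`u_t = u_5 + (4α - 6β) u_1 u_2 + (8α - 2β) u_0 u_3 - 20αβ u_0² u_1`. -/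
noncomputable def fordy {K : Type*} [CommRing K] (α β : K) : EvolutionEq K where
  order := 5
  order_pos := by norm_num
  rhs := X (Coord.u 5) + C (4 * α - 6 * β) * X (Coord.u 1) * X (Coord.u 2)
    + C (8 * α - 2 * β) * X (Coord.u 0) * X (Coord.u 3)
    - C (20 * α * β) * X (Coord.u 0) ^ 2 * X (Coord.u 1)
  rhs_mem := by
    have hX : ∀ k, k < 6 → (X (Coord.u k) : MvPolynomial Coord K) ∈
        supported K (coordsBelow (5 + 1)) := by
      intro k hk
      refine Algebra.subset_adjoin ⟨Coord.u k, ?_, rfl⟩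
      intro j hj
      cases hj
      exact hk
    have hC : ∀ c : K, (C c : MvPolynomial Coord K) ∈ supported K (coordsBelow (5 + 1)) :=
      fun c => (supported K (coordsBelow (5 + 1))).algebraMap_mem c
    exact sub_mem (add_mem (add_mem (hX 5 (by norm_num))
      (mul_mem (mul_mem (hC _) (hX 1 (by norm_num))) (hX 2 (by norm_num))))
      (mul_mem (mul_mem (hC _) (hX 0 (by norm_num))) (hX 3 (by norm_num))))
      (mul_mem (mul_mem (hC _) (pow_mem (hX 0 (by norm_num)) 2)) (hX 1 (by norm_num)))

end Fordy

end EvolutionZCR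

/-! The algebras are studied through the tautological series `A`, `B` whose coefficients are the
generators. With ∇ = D_x + [A, ·], zero curvature reads ∇B = D_t A. Differentiating by u_6, u_5, …
expresses each ∂B/∂u_k through `A` and ∇, and equality of mixed second derivatives of `B` then
restricts `A`.

Central extension. For p = 1 the mixed derivative B_{u_2u_3} gives 5∇R = 0, where R = A_{u_1u_1}.
With the normalization, A_{u_1} = (u_1 - a_1)R, and R depends on t alone and commutes with `A`. For
every such R the series R_t + [B, R] is again covariantly constant, which forces [B, R] = 0 and lets
R_t replace R; by induction all coefficients of R are central (`IsZCR.coeff_lie_eq_zero`). As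
B_{u_5} = A_{u_1}, the generators killed by φ_1 are central, and the universal property
(`ker_fdHom_le`) puts the whole kernel into the center.

Upper bound. For p = 0 and 6α + β ≠ 0, mixed derivatives give A = (u_0 - a_0)Q with Q = Q(x, t)
(`IsZCR.isReduced`). Then `B` is explicit in Q up to a series B₀(t), and zero curvature becomes the
system `IsEvol`: commutator identities among x-derivatives of Q and an evolution equation for Q. The
series Z = [Q, Q_x] + 4αQ does not depend on x and commutes with `A`, so its coefficients are
central. Compatibility of the identities with the evolution equation forces Q_xxx = -8αa_0 Q_x
(`rigidity`); here all three inequalities α + β ≠ 0, 6α + β ≠ 0, 16α + β ≠ 0 enter. Hence the values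
of Q, Q_x, Q_xx and Z at the point span the algebra, with known brackets (`exists_relations`). For α
= 0 every commutator is a multiple of the central element, so the algebra is nilpotent, of dimension
at most 4.

Lower bound. For α ≠ 0 the brackets modulo the central element are those of sl₂. That nothing
collapses is shown by a solution in sl₂, Q = exp(t ad e) exp(x ad g) f₀, which yields a homomorphism
onto a basis (`exists_hom_of_relations`). Its kernel is spanned by the central element z, and
shifting one generator by a multiple of z splits the extension (`Relations.exists_equiv`); the
abelian summand even has dimension at most 1. -/

namespace EvolutionZCR

/-! ### Convolution sums over pairs of monomials -/

section Antidiagonal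

open Finset.HasAntidiagonal (antidiagonal)

variable {P : Type*} [AddCommMonoid P]

theorem sum_antidiagonal_swap (φ : Mon → Mon → P) (m : Mon) :
    ∑ q ∈ antidiagonal m, φ q.2 q.1 = ∑ q ∈ antidiagonal m, φ q.1 q.2 :=
  Finset.sum_equiv (Equiv.prodComm _ _)
    (fun q => by simp [Finset.HasAntidiagonal.mem_antidiagonal, add_comm]) (fun q _ => rfl)

theorem sum_antidiagonal_assoc (φ : Mon → Mon → Mon → P) (m : Mon) :
    ∑ q ∈ antidiagonal m, ∑ r ∈ antidiagonal q.1, φ r.1 r.2 q.2 =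
      ∑ q ∈ antidiagonal m, ∑ r ∈ antidiagonal q.2, φ q.1 r.1 r.2 := by
  simp only [Finset.sum_sigma']
  refine Finset.sum_nbij' (fun x => ⟨(x.2.1, x.2.2 + x.1.2), (x.2.2, x.1.2)⟩)
    (fun x => ⟨(x.1.1 + x.2.1, x.2.2), (x.1.1, x.2.1)⟩) ?_ ?_ ?_ ?_ ?_
  · rintro ⟨⟨i, j⟩, k, l⟩ h
    simp only [Finset.mem_sigma, Finset.HasAntidiagonal.mem_antidiagonal, and_true] at h ⊢
    rw [← h.1, ← h.2, add_assoc]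
  · rintro ⟨⟨i, j⟩, k, l⟩ h
    simp only [Finset.mem_sigma, Finset.HasAntidiagonal.mem_antidiagonal, and_true] at h ⊢
    rw [← h.1, ← h.2, add_assoc]
  · rintro ⟨⟨i, j⟩, k, l⟩ h
    simp only [Finset.mem_sigma, Finset.HasAntidiagonal.mem_antidiagonal] at h ⊢
    obtain ⟨-, rfl⟩ := h
    rfl
  · rintro ⟨⟨i, j⟩, k, l⟩ h
    simp only [Finset.mem_sigma, Finset.HasAntidiagonal.mem_antidiagonal] at h ⊢
    obtain ⟨-, rfl⟩ := h
    rfl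
  · rintro ⟨⟨i, j⟩, k, l⟩ h
    rfl

theorem sum_antidiagonal_swap_left (φ : Mon → Mon → Mon → P) (m : Mon) :
    ∑ q ∈ antidiagonal m, ∑ r ∈ antidiagonal q.2, φ q.1 r.1 r.2 =
      ∑ q ∈ antidiagonal m, ∑ r ∈ antidiagonal q.2, φ r.1 q.1 r.2 := by
  rw [← sum_antidiagonal_assoc, ← sum_antidiagonal_assoc (fun a b c => φ b a c)]
  exact Finset.sum_congr rfl fun q _ =>
    (sum_antidiagonal_swap (fun a b => φ a b q.2) _).symm

/-- Pairs whose first entry does not contain c carry weight zero; all others are shifts of pairs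
with sum m. -/
theorem sum_antidiagonal_add_single (φ : Mon → Mon → P) (m : Mon) (c : Coord) :
    ∑ q ∈ antidiagonal (m + Finsupp.single c 1), (q.1 : Mon) c • φ q.1 q.2 =
      ∑ q ∈ antidiagonal m, (q.1 c + 1) • φ (q.1 + Finsupp.single c 1) q.2 := by
  symm
  refine Finset.sum_of_injOn (fun q => (q.1 + Finsupp.single c 1, q.2)) ?_ ?_ ?_ ?_
  · rintro ⟨a, b⟩ _ ⟨a', b'⟩ _ h
    simpa using h
  · rintro ⟨a, b⟩ h
    simp only [Finset.mem_coe, Finset.HasAntidiagonal.mem_antidiagonal] at h ⊢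
    rw [← h, add_right_comm]
  · rintro ⟨a, b⟩ h h'
    rcases Nat.eq_zero_or_pos (a c) with h0 | h0
    · simp [h0]
    · refine absurd ?_ h'
      have ha : a - Finsupp.single c 1 + Finsupp.single c 1 = a := by
        refine tsub_add_cancel_of_le ?_
        rw [Finsupp.single_le_iff]
        exact h0
      refine ⟨(a - Finsupp.single c 1, b), ?_, by simp [ha]⟩
      simp only [Finset.mem_coe, Finset.HasAntidiagonal.mem_antidiagonal] at h ⊢
      apply add_right_cancel (b := Finsupp.single c 1)
      rw [← h, add_right_comm, ha]
  · rintro ⟨a, b⟩ h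
    simp

/-- The weight m c + 1 produced by a derivative splits as the sum of the exponents of c in the two
factors. The same identity gives the product rule for brackets and for polynomial multiples. -/
theorem leibniz_antidiagonal (φ : Mon → Mon → P) (m : Mon) (c : Coord) :
    (m c + 1) • ∑ q ∈ antidiagonal (m + Finsupp.single c 1), φ q.1 q.2 =
      ∑ q ∈ antidiagonal m, (q.1 c + 1) • φ (q.1 + Finsupp.single c 1) q.2 +
      ∑ q ∈ antidiagonal m, (q.2 c + 1) • φ q.1 (q.2 + Finsupp.single c 1) := by
  rw [← sum_antidiagonal_add_single,
    ← sum_antidiagonal_swap (fun a b => (b c + 1) • φ a (b + Finsupp.single c 1)),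
    ← sum_antidiagonal_add_single (fun a b => φ b a),
    sum_antidiagonal_swap (fun a b => b c • φ a b), ← Finset.sum_add_distrib, Finset.smul_sum]
  refine Finset.sum_congr rfl fun q hq => ?_
  rw [← add_smul]
  congr 1
  have := DFunLike.congr_fun (Finset.HasAntidiagonal.mem_antidiagonal.1 hq) c
  simpa using this.symm

end Antidiagonal

/-! ### Power series with Lie algebra coefficients, as a Lie algebra over polynomials -/

/-- Formal power series with coefficients in `L`, with the bracket extended from `L`. -/
def Ser (L : Type*) : Type _ := Mon → L

namespace Ser

open Finset.HasAntidiagonal (antidiagonal)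

@[ext] theorem ext {L : Type*} {S T : Ser L} (h : ∀ m, S m = T m) : S = T := funext h

section Basic

variable {L : Type*} [LieRing L]

instance : AddCommGroup (Ser L) := inferInstanceAs (AddCommGroup (Mon → L))

@[simp] theorem zero_apply (m : Mon) : (0 : Ser L) m = 0 := rfl
@[simp] theorem add_apply (S T : Ser L) (m : Mon) : (S + T) m = S m + T m := rfl
@[simp] theorem sub_apply (S T : Ser L) (m : Mon) : (S - T) m = S m - T m := rfl
@[simp] theorem neg_apply (S : Ser L) (m : Mon) : (-S) m = -S m := rfl

noncomputable instance : Bracket (Ser L) (Ser L) := ⟨bracket⟩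

theorem lie_apply (S T : Ser L) (m : Mon) : ⁅S, T⁆ m = ∑ q ∈ antidiagonal m, ⁅S q.1, T q.2⁆ := rfl

theorem lie_jacobi (S T U : Ser L) : ⁅S, ⁅T, U⁆⁆ = ⁅⁅S, T⁆, U⁆ + ⁅T, ⁅S, U⁆⁆ := by
  ext m
  simp only [add_apply, lie_apply, lie_sum, sum_lie]
  rw [sum_antidiagonal_assoc (fun a b c => ⁅⁅S a, T b⁆, U c⁆),
    sum_antidiagonal_swap_left (fun a b c => ⁅T a, ⁅S b, U c⁆⁆)]
  simp only [← Finset.sum_add_distrib]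
  exact Finset.sum_congr rfl fun q _ => Finset.sum_congr rfl fun r _ => leibniz_lie _ _ _

theorem lie_self' (S : Ser L) : ⁅S, S⁆ = 0 := by
  ext m
  rw [lie_apply, zero_apply]
  refine Finset.sum_involution (fun q _ => q.swap) ?_ ?_ ?_ ?_
  · rintro ⟨a, b⟩ _
    rw [Prod.swap_prod_mk, ← lie_skew (S a) (S b), neg_add_cancel]
  · rintro ⟨a, b⟩ _ h h'
    rw [Prod.swap_prod_mk, Prod.mk.injEq] at h'
    rw [h'.1] at h
    exact h (lie_self _)
  · rintro ⟨a, b⟩ h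
    simpa [Finset.HasAntidiagonal.mem_antidiagonal, add_comm] using h
  · rintro ⟨a, b⟩ h
    rfl

noncomputable instance : LieRing (Ser L) where
  add_lie S T U := by
    ext m
    simp only [add_apply, lie_apply, add_lie, Finset.sum_add_distrib]
  lie_add S T U := by
    ext m
    simp only [add_apply, lie_apply, lie_add, Finset.sum_add_distrib]
  lie_self := lie_self'
  leibniz_lie := lie_jacobi

end Basic

section Algebra

variable {K : Type*} [CommRing K] {L : Type*} [LieRing L] [LieAlgebra K L]

instance : Module K (Ser L) := inferInstanceAs (Module K (Mon → L))

@[simp] theorem smul_apply (r : K) (S : Ser L) (m : Mon) : (r • S) m = r • S m := rfl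

noncomputable instance : LieAlgebra K (Ser L) where
  lie_smul r S T := by
    ext m
    simp only [smul_apply, lie_apply, lie_smul, Finset.smul_sum]

noncomputable instance : SMul (MvPolynomial Coord K) (Ser L) := ⟨polyMul⟩

theorem polySMul_apply (f : MvPolynomial Coord K) (S : Ser L) (m : Mon) :
    (f • S) m = ∑ q ∈ antidiagonal m, f.coeff q.1 • S q.2 := rfl

theorem C_smul (r : K) (S : Ser L) : (MvPolynomial.C r : MvPolynomial Coord K) • S = r • S := by
  classical
  ext m
  rw [polySMul_apply, Finset.sum_eq_single (0, m)]
  · simp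
  · rintro ⟨a, b⟩ h h'
    rw [MvPolynomial.coeff_C, if_neg, zero_smul]
    rintro rfl
    apply h'
    simpa [Finset.HasAntidiagonal.mem_antidiagonal] using h
  · intro h
    simp [Finset.HasAntidiagonal.mem_antidiagonal] at h

noncomputable instance : Module (MvPolynomial Coord K) (Ser L) where
  one_smul S := by
    rw [← MvPolynomial.C_1, C_smul, one_smul]
  mul_smul f g S := by
    ext m
    simp only [polySMul_apply, MvPolynomial.coeff_mul, Finset.sum_smul, Finset.smul_sum]
    rw [sum_antidiagonal_assoc (fun a b c => (f.coeff a * g.coeff b) • S c)]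
    simp only [mul_smul]
  smul_zero f := by
    ext m
    simp [polySMul_apply]
  zero_smul S := by
    ext m
    simp [polySMul_apply]
  smul_add f S T := by
    ext m
    simp only [polySMul_apply, add_apply, smul_add, Finset.sum_add_distrib]
  add_smul f g S := by
    ext m
    simp only [polySMul_apply, add_apply, MvPolynomial.coeff_add, add_smul, Finset.sum_add_distrib]

instance : IsScalarTower K (MvPolynomial Coord K) (Ser L) where
  smul_assoc r f S := by
    rw [MvPolynomial.smul_eq_C_mul, mul_smul, C_smul]

/-- Bilinearity over polynomials is what makes brackets such as [fR, R] vanish, a mechanism used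
repeatedly below. -/
noncomputable instance : LieAlgebra (MvPolynomial Coord K) (Ser L) where
  lie_smul f S T := by
    ext m
    simp only [polySMul_apply, lie_apply, lie_sum, Finset.smul_sum]
    rw [sum_antidiagonal_swap_left (fun a b c => f.coeff a • ⁅S b, T c⁆)]
    simp only [lie_smul]

variable (K) in
/-- The partial derivative as a linear map. -/
noncomputable def pd (c : Coord) : Ser L →ₗ[K] Ser L where
  toFun S := pderiv c S
  map_add' S T := by
    ext m
    exact smul_add _ _ _
  map_smul' r S := by
    ext m
    exact smul_comm _ _ _

theorem pd_apply (c : Coord) (S : Ser L) (m : Mon) :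
    pd K c S m = (m c + 1) • S (m + Finsupp.single c 1) := rfl

theorem pd_comm (c d : Coord) (S : Ser L) : pd K c (pd K d S) = pd K d (pd K c S) := by
  ext m
  rcases eq_or_ne c d with rfl | h
  · rfl
  · simp [pd_apply, h, h.symm, smul_comm (m c + 1), add_right_comm]

theorem pd_lie (c : Coord) (S T : Ser L) : pd K c ⁅S, T⁆ = ⁅pd K c S, T⁆ + ⁅S, pd K c T⁆ := by
  ext m
  simp only [pd_apply, add_apply, lie_apply]
  rw [leibniz_antidiagonal (fun a b => ⁅S a, T b⁆)]
  simp only [lie_nsmul, nsmul_lie]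

theorem pd_smul (c : Coord) (f : MvPolynomial Coord K) (S : Ser L) :
    pd K c (f • S) = MvPolynomial.pderiv c f • S + f • pd K c S := by
  ext m
  simp only [pd_apply, add_apply, polySMul_apply]
  rw [leibniz_antidiagonal (fun a b => f.coeff a • S b)]
  congr 1
  · refine Finset.sum_congr rfl fun q _ => ?_
    rw [MvPolynomial.coeff_pderiv, mul_comm, mul_smul, ← Nat.cast_smul_eq_nsmul K]
    push_cast
    rfl
  · refine Finset.sum_congr rfl fun q _ => ?_
    rw [smul_comm]

end Algebra

end Ser
end EvolutionZCR

/-! ### The expanded right-hand side and the total derivative D_x -/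

namespace EvolutionZCR

open Finset.HasAntidiagonal (antidiagonal)

/-- The coordinate function `u_k`, expanded at `a`. -/
noncomputable def uc {K : Type*} [CommRing K] (a : Coord → K) (k : ℕ) : MvPolynomial Coord K :=
  MvPolynomial.X (Coord.u k) + MvPolynomial.C (a (Coord.u k))

section Poly

variable {K : Type*} [CommRing K] (a : Coord → K)

@[simp] theorem pderiv_uc (j k : ℕ) :
    MvPolynomial.pderiv (Coord.u j) (uc a k) = if j = k then 1 else 0 := by
  classical
  simp only [uc, map_add, MvPolynomial.pderiv_C, add_zero, MvPolynomial.pderiv_X, Pi.single_apply]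
  simp [eq_comm]

@[simp] theorem pderiv_x_uc (k : ℕ) : MvPolynomial.pderiv Coord.x (uc a k) = 0 := by
  simp [uc]

@[simp] theorem pderiv_t_uc (k : ℕ) : MvPolynomial.pderiv Coord.t (uc a k) = 0 := by
  simp [uc]

/-- The right-hand side of the equation, expanded at `a`. -/
noncomputable def fordyF (α β : K) (a : Coord → K) : MvPolynomial Coord K :=
  uc a 5 + MvPolynomial.C (4 * α - 6 * β) * uc a 1 * uc a 2
    + MvPolynomial.C (8 * α - 2 * β) * uc a 0 * uc a 3
    - MvPolynomial.C (20 * α * β) * uc a 0 ^ 2 * uc a 1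

/-- The total derivative of the right-hand side of the equation, expanded at `a`. -/
noncomputable def fordyF' (α β : K) (a : Coord → K) : MvPolynomial Coord K :=
  uc a 6 + MvPolynomial.C (4 * α - 6 * β) * (uc a 2 * uc a 2 + uc a 1 * uc a 3)
    + MvPolynomial.C (8 * α - 2 * β) * (uc a 1 * uc a 3 + uc a 0 * uc a 4)
    - MvPolynomial.C (20 * α * β) * (uc a 0 * uc a 1 * uc a 1 + uc a 0 * uc a 1 * uc a 1 +
      uc a 0 ^ 2 * uc a 2)

theorem expandAt_X (k : ℕ) : expandAt a (MvPolynomial.X (Coord.u k)) = uc a k := by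
  simp [expandAt, uc]

theorem expandAt_rhs (α β : K) : expandAt a (fordy α β).rhs = fordyF α β a := by
  simp only [expandAt, fordy, fordyF, uc, map_add, map_sub, map_mul, map_pow, MvPolynomial.aeval_X,
    MvPolynomial.aeval_C, MvPolynomial.algebraMap_eq]

theorem expandAt_polyDx_rhs (α β : K) :
    expandAt a (polyDx (fordy α β).rhs) = fordyF' α β a := by
  have hX : ∀ k, polyDx (K := K) (MvPolynomial.X (Coord.u k)) =
      MvPolynomial.X (Coord.u (k + 1)) := fun k => MvPolynomial.mkDerivation_X _ _ _
  have hC : ∀ r, polyDx (K := K) (MvPolynomial.C r) = 0 := fun r => MvPolynomial.derivation_C _ _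
  simp only [fordy, map_add, map_sub, Derivation.leibniz, pow_two, hX, hC, smul_eq_mul,
    mul_zero, add_zero]
  simp only [expandAt, map_add, map_sub, map_mul, MvPolynomial.aeval_X,
    MvPolynomial.aeval_C, MvPolynomial.algebraMap_eq, fordyF', uc]
  ring

end Poly

namespace Ser

section Deriv

variable {K : Type*} [CommRing K] {L : Type*} [LieRing L] [LieAlgebra K L] (a : Coord → K)

/-- The total derivative `D_x` of series that involve only `u_k` with `k < 6`. -/
noncomputable def Dx : Ser L →ₗ[K] Ser L where
  toFun S := pd K Coord.x S + ∑ k ∈ Finset.range 6, uc a (k + 1) • pd K (Coord.u k) S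
  map_add' S T := by
    simp only [map_add, smul_add, Finset.sum_add_distrib]
    abel
  map_smul' r S := by
    simp only [map_smul, smul_add, Finset.smul_sum, RingHom.id_apply, smul_comm r]

theorem Dx_apply (S : Ser L) :
    Dx a S = pd K Coord.x S + ∑ k ∈ Finset.range 6, uc a (k + 1) • pd K (Coord.u k) S := rfl

theorem Dx_lie (S T : Ser L) : Dx a ⁅S, T⁆ = ⁅Dx a S, T⁆ + ⁅S, Dx a T⁆ := by
  simp only [Dx_apply, pd_lie, add_lie, lie_add, sum_lie, lie_sum, smul_lie, lie_smul, smul_add,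
    Finset.sum_add_distrib]
  abel

theorem Dx_uc_smul {k : ℕ} (hk : k < 6) (S : Ser L) :
    Dx a (uc a k • S) = uc a (k + 1) • S + uc a k • Dx a S := by
  simp only [Dx_apply, pd_smul, pderiv_uc, pderiv_x_uc, zero_smul, zero_add, smul_add, ite_smul,
    one_smul, smul_ite, smul_zero, Finset.sum_add_distrib, Finset.sum_ite_eq', Finset.mem_range, hk,
    if_true, Finset.smul_sum, smul_comm (uc a k)]
  abel

theorem pd_C_smul (c : Coord) (r : K) (S : Ser L) :
    pd K c ((MvPolynomial.C r : MvPolynomial Coord K) • S) =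
      (MvPolynomial.C r : MvPolynomial Coord K) • pd K c S := by
  rw [C_smul, C_smul, map_smul]

theorem pd_zero_Dx (S : Ser L) : pd K (Coord.u 0) (Dx a S) = Dx a (pd K (Coord.u 0) S) := by
  simp only [Dx_apply, map_add, map_sum, pd_smul, pderiv_uc, pd_comm (Coord.u 0)]
  simp

/-- The commutator of ∂/∂u_{k+1} with D_x is ∂/∂u_k. Each differentiation of the zero-curvature
equation thus reaches one index lower. The bound on k comes from the truncated sum in `Dx`. -/
theorem pd_succ_Dx {k : ℕ} (hk : k < 6) (S : Ser L) :
    pd K (Coord.u (k + 1)) (Dx a S) = Dx a (pd K (Coord.u (k + 1)) S) + pd K (Coord.u k) S := by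
  simp only [Dx_apply, map_add, map_sum, pd_smul, pderiv_uc, pd_comm (Coord.u (k + 1)),
    add_left_inj, ite_smul, one_smul, zero_smul, Finset.sum_add_distrib, Finset.sum_ite_eq,
    Finset.mem_range, hk, if_true]
  abel

theorem pd_t_Dx (S : Ser L) : pd K Coord.t (Dx a S) = Dx a (pd K Coord.t S) := by
  simp only [Dx_apply, map_add, map_sum, pd_smul, pderiv_t_uc, pd_comm Coord.t, zero_smul, zero_add]

theorem Dx_eq_pd_x {S : Ser L} (h : ∀ k, pd K (Coord.u k) S = 0) : Dx a S = pd K Coord.x S := by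
  simp [Dx_apply, h]

end Deriv

/-! ### Vanishing criteria and restriction to u = a -/

section Vanishing

theorem nsmul_eq_zero_imp (K : Type*) [Field K] [CharZero K] {L : Type*} [AddCommGroup L]
    [Module K L] {n : ℕ} {v : L} (h : (n + 1) • v = 0) : v = 0 := by
  rw [← Nat.cast_smul_eq_nsmul K, smul_eq_zero] at h
  exact h.resolve_left (Nat.cast_ne_zero.2 n.succ_ne_zero)

variable {K : Type*} [Field K] [CharZero K] {L : Type*} [LieRing L] [LieAlgebra K L]

theorem coeff_eq_zero_of_pd {c : Coord} {S : Ser L} (h : pd K c S = 0) {m : Mon} (hm : m c ≠ 0) :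
    S m = 0 := by
  have ha : m - Finsupp.single c 1 + Finsupp.single c 1 = m := by
    refine tsub_add_cancel_of_le ?_
    rw [Finsupp.single_le_iff]
    exact Nat.one_le_iff_ne_zero.2 hm
  have := congrFun h (m - Finsupp.single c 1)
  rw [pd_apply, ha] at this
  exact nsmul_eq_zero_imp K this

theorem eq_zero_of_pd (s : Set Coord) {S : Ser L} (h : ∀ c ∈ s, pd K c S = 0)
    (h0 : ∀ m : Mon, (∀ c ∈ s, m c = 0) → S m = 0) : S = 0 := by
  ext m
  by_cases hm : ∀ c ∈ s, m c = 0
  · exact h0 m hm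
  · push Not at hm
    obtain ⟨c, hc, hm⟩ := hm
    exact coeff_eq_zero_of_pd (h c hc) hm

theorem eq_zero_of_pd_u {S : Ser L} (h : ∀ k, pd K (Coord.u k) S = 0)
    (h0 : ∀ m, NoU m → S m = 0) : S = 0 := by
  refine eq_zero_of_pd (K := K) (Set.range Coord.u) ?_ ?_
  · rintro _ ⟨k, rfl⟩
    exact h k
  · intro m hm
    exact h0 m fun k _ => hm _ ⟨k, rfl⟩

end Vanishing

section Coeff

variable {K : Type*} [CommRing K] {L : Type*} [LieRing L] [LieAlgebra K L]

theorem noU_of_mem_antidiagonal {m : Mon} (hm : NoU m) {q : Mon × Mon} (hq : q ∈ antidiagonal m) :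
    NoU q.1 ∧ NoU q.2 := by
  have h : ∀ k, q.1 (Coord.u k) + q.2 (Coord.u k) = 0 := fun k => by
    rw [← hm k (Nat.zero_le _), ← Finset.HasAntidiagonal.mem_antidiagonal.1 hq]
    rfl
  exact ⟨fun k _ => (Nat.add_eq_zero_iff.1 (h k)).1, fun k _ => (Nat.add_eq_zero_iff.1 (h k)).2⟩

/-- Restriction to u = a respects brackets. For S independent of u, this separates the two terms of
S_x + [A, S] = 0: the bracket vanishes at u = a, hence S_x = 0. -/
theorem lie_apply_of_noU {A : Ser L} (hA : ∀ m, NoU m → A m = 0) (S : Ser L) {m : Mon}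
    (hm : NoU m) : ⁅A, S⁆ m = 0 := by
  rw [lie_apply]
  refine Finset.sum_eq_zero fun q hq => ?_
  rw [hA _ (noU_of_mem_antidiagonal hm hq).1, zero_lie]

theorem X_smul_apply_of_eq_zero {c : Coord} {m : Mon} (hm : m c = 0) (S : Ser L) :
    ((MvPolynomial.X c : MvPolynomial Coord K) • S) m = 0 := by
  classical
  rw [polySMul_apply]
  refine Finset.sum_eq_zero fun q hq => ?_
  rw [MvPolynomial.coeff_X, if_neg, zero_smul]
  intro h
  have h' : q.1 c + q.2 c = m c := by
    rw [← Finset.HasAntidiagonal.mem_antidiagonal.1 hq]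
    rfl
  rw [hm, ← h] at h'
  simp at h'

theorem uc_smul_apply_of_noU (a : Coord → K) (k : ℕ) {m : Mon} (hm : NoU m) (S : Ser L) :
    (uc a k • S) m = a (Coord.u k) • S m := by
  rw [uc, add_smul, add_apply, X_smul_apply_of_eq_zero (hm k (Nat.zero_le _)), C_smul, zero_add,
    smul_apply]

end Coeff

end Ser
end EvolutionZCR

/-! ### Zero-curvature representations and series commuting with them -/

namespace EvolutionZCR

open Finset.HasAntidiagonal (antidiagonal)

open Ser

/-- Normalized zero-curvature representations of the equation with `A` depending on
`x, t, u_0, u_1` at most. -/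
structure IsZCR {K : Type*} [CommRing K] {L : Type*} [LieRing L] [LieAlgebra K L] (α β : K)
    (a : Coord → K) (A B : Ser L) : Prop where
  pdA : ∀ k, 2 ≤ k → pd K (Coord.u k) A = 0
  pdB : ∀ k, 6 ≤ k → pd K (Coord.u k) B = 0
  zcr : Dx a B + ⁅A, B⁆ = pd K Coord.t A + fordyF α β a • pd K (Coord.u 0) A +
    fordyF' α β a • pd K (Coord.u 1) A
  normA : ∀ m, NoU m → A m = 0
  normB : ∀ m, NoU m → m Coord.x = 0 → B m = 0
  normV : ∀ m, m (Coord.u 1) = 1 → A m = 0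

section

variable {K : Type*} [CommRing K] {L : Type*} [LieRing L] [LieAlgebra K L] {α β : K}
  {a : Coord → K} {A B : Ser L}

theorem Ser.pd_eq_zero {n k : ℕ} (h : n ≤ k) {S : Ser L} (hS : ∀ m, ¬ MonBelow n m → S m = 0) :
    pd K (Coord.u k) S = 0 := pderiv_eq_zero h hS

theorem zcrExpr_one_eq (A B : Ser L) :
    (zcrExpr (fordy α β) a 1 A B : Ser L) = Dx a B - (pd K Coord.t A +
      fordyF α β a • pd K (Coord.u 0) A + fordyF' α β a • pd K (Coord.u 1) A) + ⁅A, B⁆ := by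
  have h1 : (totalDx a 6 B : Ser L) = Dx a B := by
    rw [Dx_apply]
    simp only [← expandAt_X]
    rfl
  have h2 : (totalDt (fordy α β) a 2 A : Ser L) = pd K Coord.t A +
      fordyF α β a • pd K (Coord.u 0) A + fordyF' α β a • pd K (Coord.u 1) A := by
    rw [← expandAt_rhs, ← expandAt_polyDx_rhs, add_assoc]
    refine congrArg (fun T : Ser L => pd K Coord.t A + T) ?_
    rw [Finset.sum_range_succ, Finset.sum_range_one]
    rfl
  rw [← h1, ← h2]
  rfl

theorem IsZCR.of_zcrExpr (hA : ∀ m, ¬ MonBelow 2 m → A m = 0) (hB : ∀ m, ¬ MonBelow 6 m → B m = 0)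
    (h : ∀ m, zcrExpr (fordy α β) a 1 A B m = 0)
    (normA : ∀ m, NoU m → A m = 0) (normB : ∀ m, NoU m → m Coord.x = 0 → B m = 0)
    (normV : ∀ m, m (Coord.u 1) = 1 → A m = 0) : IsZCR α β a A B where
  pdA _ hk := pd_eq_zero hk hA
  pdB _ hk := pd_eq_zero hk hB
  zcr := by
    have h' : (zcrExpr (fordy α β) a 1 A B : Ser L) = 0 := funext h
    rw [zcrExpr_one_eq] at h'
    rw [← sub_eq_zero]
    refine Eq.trans ?_ h'
    abel
  normA := normA
  normB := normB
  normV := normV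

/-- Double induction on monomials. For m' = 0, the coefficient of [A, R] at m has only one term not
covered by induction, [A m, R 0]. For m' ≠ 0, the coefficient of R is up to a nonzero integer one of
a derivative of R at a smaller monomial, and the class P is closed under derivatives. -/
theorem Ser.coeff_lie_eq_zero {K : Type*} [Field K] [CharZero K] {L : Type*} [LieRing L]
    [LieAlgebra K L] (A : Ser L) {P : Ser L → Prop}
    (hP : ∀ R, P R → ∀ c, P (pd K c R)) (hA : ∀ R, P R → ⁅A, R⁆ = 0) (m m' : Mon) :
    ∀ R, P R → ⁅A m, R m'⁆ = 0 := by
  induction m using WellFoundedLT.induction generalizing m' with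
  | ind m ih =>
    induction m' using WellFoundedLT.induction with
    | ind m' ih' =>
      intro R hR
      by_cases hm' : m' = 0
      · subst hm'
        have h := congrFun (hA R hR) m
        rw [lie_apply, Finset.sum_eq_single (m, 0)] at h
        · exact h
        · rintro ⟨b, d⟩ hq hne
          rw [Finset.HasAntidiagonal.mem_antidiagonal] at hq
          refine ih b ?_ d R hR
          rw [← show b + d = m from hq]
          refine lt_of_le_of_ne le_self_add ?_
          intro hb
          have hd : d = 0 := by
            rw [left_eq_add] at hb
            exact hb
          subst hd
          apply hne
          rw [← show b + 0 = m from hq, add_zero]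
        · intro h0
          simp [Finset.HasAntidiagonal.mem_antidiagonal] at h0
      · obtain ⟨c, hc⟩ := Finsupp.ne_iff.1 hm'
        have ha : m' - Finsupp.single c 1 + Finsupp.single c 1 = m' := by
          refine tsub_add_cancel_of_le ?_
          rw [Finsupp.single_le_iff]
          exact Nat.one_le_iff_ne_zero.2 hc
        have hlt : m' - Finsupp.single c 1 < m' := by
          conv_rhs => rw [← ha]
          exact lt_add_of_pos_right _ (by
            rw [pos_iff_ne_zero]
            simp)
        have h := ih' _ hlt _ (hP R hR c)
        rw [pd_apply, ha, lie_nsmul] at h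
        exact nsmul_eq_zero_imp K h

end

section Central

variable {K : Type*} [Field K] [CharZero K] {L : Type*} [LieRing L] [LieAlgebra K L] {α β : K}
  {a : Coord → K} {A B R : Ser L}

/-- Series in `t` alone that commute with `A`. -/
structure IsConstant (K : Type*) [CommRing K] {L : Type*} [LieRing L] [LieAlgebra K L]
    (A R : Ser L) : Prop where
  pd_u : ∀ k, pd K (Coord.u k) R = 0
  pd_x : pd K Coord.x R = 0
  lie : ⁅A, R⁆ = 0

theorem IsConstant.zero {K : Type*} [CommRing K] {L : Type*} [LieRing L] [LieAlgebra K L]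
    (A : Ser L) : IsConstant K A 0 :=
  ⟨fun _ => map_zero _, map_zero _, lie_zero _⟩

/-- This is the inductive step that passes from R to R_t: a series in t commuting with `A` also
commutes with `B`, and its t-derivative again commutes with `A`. -/
theorem IsZCR.isConstant_step (h : IsZCR α β a A B)
    (h1 : pd K (Coord.u 1) A =
      (MvPolynomial.X (Coord.u 1) : MvPolynomial Coord K) • pd K (Coord.u 1) (pd K (Coord.u 1) A))
    (hR : IsConstant K A R) : ⁅B, R⁆ = 0 ∧ IsConstant K A (pd K Coord.t R) := by
  have hDR : Dx a R = 0 := by rw [Dx_eq_pd_x a hR.pd_u, hR.pd_x]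
  have hAR : ∀ c, ⁅pd K c A, R⁆ + ⁅A, pd K c R⁆ = 0 := fun c => by rw [← pd_lie, hR.lie, map_zero]
  have hA0 := hAR (Coord.u 0)
  have hA1 := hAR (Coord.u 1)
  rw [hR.pd_u, lie_zero, add_zero] at hA0 hA1
  -- S is the covariant t-derivative of R. It satisfies ∇S = 0 by zero curvature, because [A_{u_0},
  -- R] and [A_{u_1}, R] vanish.
  obtain ⟨S, hS⟩ : ∃ S, S = pd K Coord.t R + ⁅B, R⁆ := ⟨_, rfl⟩
  have hS0 : Dx a S + ⁅A, S⁆ = 0 := by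
    have h2 : ⁅Dx a B + ⁅A, B⁆, R⁆ = ⁅pd K Coord.t A, R⁆ := by
      rw [h.zcr, add_lie, add_lie, smul_lie, smul_lie, hA0, hA1, smul_zero, smul_zero, add_zero,
        add_zero]
    rw [hS, map_add, ← pd_t_Dx, Dx_lie, hDR, map_zero, lie_zero, lie_add, leibniz_lie A B R, hR.lie,
      lie_zero, add_zero, add_zero, zero_add, ← hAR Coord.t, ← h2, add_lie]
    abel
  have hk6 : ∀ k, 6 ≤ k → pd K (Coord.u k) S = 0 := fun k hk => by
    rw [hS, map_add, pd_comm, hR.pd_u, pd_lie, hR.pd_u, h.pdB k hk]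
    simp
  have hstep : ∀ k, k < 6 → pd K (Coord.u (k + 1)) S = 0 →
      pd K (Coord.u k) S + ⁅pd K (Coord.u (k + 1)) A, S⁆ = 0 := fun k hk hk' => by
    have := congrArg (pd K (Coord.u (k + 1))) hS0
    rw [map_add, pd_succ_Dx a hk, pd_lie, hk'] at this
    simpa using this
  have hstep' : ∀ k, k + 1 < 6 → pd K (Coord.u (k + 2)) S = 0 → pd K (Coord.u (k + 1)) S = 0 :=
    fun k hk hk' => by simpa [h.pdA (k + 2) (by omega)] using hstep (k + 1) hk hk'
  have hk1 := hstep' 0 (by omega) <| hstep' 1 (by omega) <| hstep' 2 (by omega) <|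
    hstep' 3 (by omega) <| hstep' 4 (by omega) <| hk6 6 le_rfl
  have h0 := hstep 0 (by omega) hk1
  -- By `h1`, the bracket [A_{u_1}, S] is a polynomial multiple of this one, so its vanishing gives
  -- S_{u_0} = 0.
  have h11 : ⁅pd K (Coord.u 1) (pd K (Coord.u 1) A), S⁆ = 0 := by
    have := congrArg (pd K (Coord.u 1)) h0
    rw [map_add, pd_comm, hk1, pd_lie, hk1] at this
    simpa using this
  rw [zero_add, h1, smul_lie, h11, smul_zero, add_zero] at h0
  have hk : ∀ k, pd K (Coord.u k) S = 0 := fun k => by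
    by_cases hk : 6 ≤ k
    · exact hk6 k hk
    · interval_cases k
      · exact h0
      · exact hk1
      · exact hstep' 1 (by omega) <| hstep' 2 (by omega) <|
          hstep' 3 (by omega) <| hstep' 4 (by omega) <| hk6 6 le_rfl
      · exact hstep' 2 (by omega) <|
          hstep' 3 (by omega) <| hstep' 4 (by omega) <| hk6 6 le_rfl
      · exact hstep' 3 (by omega) <| hstep' 4 (by omega) <| hk6 6 le_rfl
      · exact hstep' 4 (by omega) <| hk6 6 le_rfl
  rw [Dx_eq_pd_x a hk] at hS0
  have hSx : pd K Coord.x S = 0 := by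
    refine eq_zero_of_pd_u (K := K) (fun k => by rw [pd_comm, hk, map_zero]) fun m hm => ?_
    have := congrFun hS0 m
    rwa [Ser.add_apply, lie_apply_of_noU h.normA S hm, add_zero] at this
  rw [hSx, zero_add] at hS0
  -- [B, R] = S - R_t depends on t alone, and it vanishes at x = x_a, u = a because `B` is
  -- normalized to vanish there.
  have hBR : ⁅B, R⁆ = 0 := by
    have e : ⁅B, R⁆ = S - pd K Coord.t R := by
      rw [hS]
      abel
    refine eq_zero_of_pd (K := K) {c | c ≠ Coord.t} ?_ ?_
    · rintro (_ | _ | k) hc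
      · rw [e, map_sub, hSx, pd_comm, hR.pd_x, map_zero, sub_zero]
      · exact absurd rfl hc
      · rw [e, map_sub, hk, pd_comm, hR.pd_u, map_zero, sub_zero]
    · intro m hm
      have hm' : NoU m := fun k _ => hm _ (by simp)
      rw [lie_apply]
      refine Finset.sum_eq_zero fun q hq => ?_
      rw [h.normB q.1 (noU_of_mem_antidiagonal hm' hq).1, zero_lie]
      have hx : q.1 Coord.x + q.2 Coord.x = m Coord.x := by
        rw [← Finset.HasAntidiagonal.mem_antidiagonal.1 hq]
        rfl
      rw [hm Coord.x (by simp)] at hx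
      omega
  rw [hBR, add_zero] at hS
  refine ⟨hBR, ?_, ?_, ?_⟩
  · intro k
    rw [pd_comm, hR.pd_u, map_zero]
  · rw [pd_comm, hR.pd_x, map_zero]
  · rwa [← hS]

/-- The coefficients of a series in `t` that commutes with `A` commute with those of `A` and `B`. -/
theorem IsZCR.coeff_lie_eq_zero (h : IsZCR α β a A B)
    (h1 : pd K (Coord.u 1) A =
      (MvPolynomial.X (Coord.u 1) : MvPolynomial Coord K) • pd K (Coord.u 1) (pd K (Coord.u 1) A))
    (hR : IsConstant K A R) (m m' : Mon) : ⁅A m, R m'⁆ = 0 ∧ ⁅B m, R m'⁆ = 0 := by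
  have hP : ∀ R, IsConstant K A R → ∀ c, IsConstant K A (pd K c R) := by
    rintro R hR (_ | _ | k)
    · rw [hR.pd_x]
      exact .zero A
    · exact (h.isConstant_step h1 hR).2
    · rw [hR.pd_u]
      exact .zero A
  exact ⟨Ser.coeff_lie_eq_zero A hP (fun R hR => hR.lie) m m' R hR,
    Ser.coeff_lie_eq_zero B hP (fun R hR => (h.isConstant_step h1 hR).1) m m' R hR⟩

end Central

end EvolutionZCR

/-! ### The covariant derivative and the dependence of A on u_1 -/

namespace EvolutionZCR

open Ser

section Covariant

variable {K : Type*} [CommRing K] {L : Type*} [LieRing L] [LieAlgebra K L] (a : Coord → K)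

/-- The covariant total derivative `D_x + [A, ·]`. -/
noncomputable def nab (A : Ser L) : Ser L →ₗ[K] Ser L where
  toFun S := Dx a S + ⁅A, S⁆
  map_add' S T := by
    rw [map_add, lie_add]
    abel
  map_smul' r S := by
    rw [map_smul, lie_smul, smul_add, RingHom.id_apply]

variable {a} {A : Ser L}

theorem nab_apply (S : Ser L) : nab a A S = Dx a S + ⁅A, S⁆ := rfl

theorem nab_lie (S T : Ser L) : nab a A ⁅S, T⁆ = ⁅nab a A S, T⁆ + ⁅S, nab a A T⁆ := by
  simp only [nab_apply, Dx_lie, add_lie, lie_add, leibniz_lie A S T]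
  abel

theorem nab_uc_smul {k : ℕ} (hk : k < 6) (S : Ser L) :
    nab a A (uc a k • S) = uc a (k + 1) • S + uc a k • nab a A S := by
  rw [nab_apply, nab_apply, Dx_uc_smul a hk, lie_smul, smul_add, add_assoc]

theorem nab_C_smul (r : K) (S : Ser L) :
    nab a A ((MvPolynomial.C r : MvPolynomial Coord K) • S) =
      (MvPolynomial.C r : MvPolynomial Coord K) • nab a A S := by
  rw [C_smul, C_smul, map_smul]

theorem pd_zero_nab (S : Ser L) : pd K (Coord.u 0) (nab a A S) =
    nab a A (pd K (Coord.u 0) S) + ⁅pd K (Coord.u 0) A, S⁆ := by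
  rw [nab_apply, nab_apply, map_add, pd_zero_Dx, pd_lie]
  abel

theorem pd_succ_nab {k : ℕ} (hk : k < 6) (S : Ser L) : pd K (Coord.u (k + 1)) (nab a A S) =
    nab a A (pd K (Coord.u (k + 1)) S) + pd K (Coord.u k) S + ⁅pd K (Coord.u (k + 1)) A, S⁆ := by
  rw [nab_apply, nab_apply, map_add, pd_succ_Dx a hk, pd_lie]
  abel

end Covariant

section PderivF

variable {K : Type*} [CommRing K] (α β : K) (a : Coord → K)

theorem pderiv_fordyF (k : ℕ) : MvPolynomial.pderiv (Coord.u k) (fordyF α β a) =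
    if k = 5 then 1 else
    if k = 3 then MvPolynomial.C (8 * α - 2 * β) * uc a 0 else
    if k = 2 then MvPolynomial.C (4 * α - 6 * β) * uc a 1 else
    if k = 1 then MvPolynomial.C (4 * α - 6 * β) * uc a 2 -
      MvPolynomial.C (20 * α * β) * uc a 0 ^ 2 else
    if k = 0 then MvPolynomial.C (8 * α - 2 * β) * uc a 3 -
      2 * MvPolynomial.C (20 * α * β) * uc a 0 * uc a 1 else 0 := by
  simp only [fordyF, map_add, map_sub, Derivation.leibniz, pow_two, pderiv_uc, smul_eq_mul,
    MvPolynomial.pderiv_C, mul_zero, add_zero]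
  split_ifs <;> first | omega | ring

theorem pderiv_fordyF' {k : ℕ} (hk : 3 ≤ k) :
    MvPolynomial.pderiv (Coord.u k) (fordyF' α β a) =
    if k = 6 then 1 else
    if k = 4 then MvPolynomial.C (8 * α - 2 * β) * uc a 0 else
    if k = 3 then MvPolynomial.C (12 * α - 8 * β) * uc a 1 else 0 := by
  simp only [fordyF', map_add, map_sub, Derivation.leibniz, pow_two, pderiv_uc, smul_eq_mul,
    MvPolynomial.pderiv_C, mul_zero, add_zero]
  split_ifs <;> first | omega | (simp only [map_mul, map_ofNat]; ring)

end PderivF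

section Analysis

variable {K : Type*} [CommRing K] {L : Type*} [LieRing L] [LieAlgebra K L] {α β : K}
  {a : Coord → K} {A B : Ser L}

theorem IsZCR.nab_eq (h : IsZCR α β a A B) : nab a A B = pd K Coord.t A +
    fordyF α β a • pd K (Coord.u 0) A + fordyF' α β a • pd K (Coord.u 1) A := h.zcr

/-- The derivative of the zero-curvature equation with respect to `u_{k+1}` for `k ≥ 2`. -/
theorem IsZCR.nab_pd (h : IsZCR α β a A B) {k : ℕ} (hk : 2 ≤ k) (hk' : k < 6) :
    nab a A (pd K (Coord.u (k + 1)) B) + pd K (Coord.u k) B =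
      MvPolynomial.pderiv (Coord.u (k + 1)) (fordyF α β a) • pd K (Coord.u 0) A +
      MvPolynomial.pderiv (Coord.u (k + 1)) (fordyF' α β a) • pd K (Coord.u 1) A := by
  have h1 := h.pdA (k + 1) (by omega)
  have := congrArg (pd K (Coord.u (k + 1))) h.nab_eq
  rw [pd_succ_nab hk', h1, zero_lie, add_zero, map_add, map_add, pd_smul, pd_smul,
    pd_comm (Coord.u (k + 1)), h1, pd_comm (Coord.u (k + 1)), h1, pd_comm (Coord.u (k + 1)), h1,
    map_zero, map_zero, map_zero, smul_zero, smul_zero, add_zero, add_zero, zero_add] at this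
  exact this

theorem IsZCR.pd_five (h : IsZCR α β a A B) : pd K (Coord.u 5) B = pd K (Coord.u 1) A := by
  simpa [h.pdB 6 le_rfl, pderiv_fordyF, pderiv_fordyF'] using h.nab_pd (k := 5)

theorem IsZCR.pd_four (h : IsZCR α β a A B) :
    pd K (Coord.u 4) B = pd K (Coord.u 0) A - nab a A (pd K (Coord.u 1) A) := by
  have := h.nab_pd (k := 4) (by omega) (by omega)
  simp only [Nat.reduceAdd, h.pd_five, pderiv_fordyF, pderiv_fordyF' α β a (show 3 ≤ 5 by omega)]
    at this
  rw [eq_sub_iff_add_eq']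
  simpa using this

theorem IsZCR.pd_three (h : IsZCR α β a A B) :
    pd K (Coord.u 3) B = (8 * α - 2 * β) • uc a 0 • pd K (Coord.u 1) A -
      nab a A (pd K (Coord.u 4) B) := by
  have := h.nab_pd (k := 3) (by omega) (by omega)
  simp only [Nat.reduceAdd, pderiv_fordyF, pderiv_fordyF' α β a (show 3 ≤ 4 by omega),
    Nat.reduceEqDiff, reduceIte, mul_smul, C_smul, zero_smul, zero_add] at this
  rw [eq_sub_iff_add_eq']
  exact this

theorem IsZCR.pd_two (h : IsZCR α β a A B) :
    pd K (Coord.u 2) B = (8 * α - 2 * β) • uc a 0 • pd K (Coord.u 0) A +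
      (12 * α - 8 * β) • uc a 1 • pd K (Coord.u 1) A -
      nab a A (pd K (Coord.u 3) B) := by
  have := h.nab_pd (k := 2) (by omega) (by omega)
  simp only [Nat.reduceAdd, pderiv_fordyF, pderiv_fordyF' α β a (show 3 ≤ 3 by omega),
    Nat.reduceEqDiff, reduceIte, mul_smul, C_smul] at this
  rw [eq_sub_iff_add_eq']
  exact this

theorem IsZCR.pd_succ_nab (h : IsZCR α β a A B) {k : ℕ} (hk : 1 ≤ k) (hk' : k < 6) (S : Ser L) :
    pd K (Coord.u (k + 1)) (nab a A S) = nab a A (pd K (Coord.u (k + 1)) S) + pd K (Coord.u k) S := by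
  rw [EvolutionZCR.pd_succ_nab hk', h.pdA (k + 1) (by omega), zero_lie, add_zero]

end Analysis

section CharZero

variable {K : Type*} [Field K] [CharZero K] {L : Type*} [LieRing L] [LieAlgebra K L] {α β : K}
  {a : Coord → K} {A B : Ser L}

/-- Computing the mixed derivative B_{u_2u_3} from the formula for B_{u_3} gives 2∇A_{u_1u_1}, and
from the formula for B_{u_2} gives -3∇A_{u_1u_1}. The lower-order terms of the equation do not
contribute. -/
theorem IsZCR.nab_pd_one_one (h : IsZCR α β a A B) :
    nab a A (pd K (Coord.u 1) (pd K (Coord.u 1) A)) = 0 := by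
  have n2 : ∀ S, pd K (Coord.u 2) (nab a A S) = _ := fun S =>
    h.pd_succ_nab (k := 1) (by omega) (by omega) S
  have n3 : ∀ S, pd K (Coord.u 3) (nab a A S) = _ := fun S =>
    h.pd_succ_nab (k := 2) (by omega) (by omega) S
  have n1 : ∀ S, pd K (Coord.u 1) (nab a A S) = _ := fun S =>
    EvolutionZCR.pd_succ_nab (k := 0) (by omega) S
  simp only [Nat.reduceAdd] at n1 n2 n3
  have h2 : ∀ c, pd K (Coord.u 2) (pd K c A) = 0 := fun c => by
    rw [pd_comm, h.pdA 2 le_rfl, map_zero]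
  have h3 : ∀ c, pd K (Coord.u 3) (pd K c A) = 0 := fun c => by
    rw [pd_comm, h.pdA 3 (by omega), map_zero]
  have e2 : pd K (Coord.u 2) (pd K (Coord.u 4) B) = -pd K (Coord.u 1) (pd K (Coord.u 1) A) := by
    rw [h.pd_four, map_sub, n2, h2, h2, map_zero, zero_add, zero_sub]
  have e3 : pd K (Coord.u 3) (pd K (Coord.u 4) B) = 0 := by
    rw [h.pd_four, map_sub, n3, h3, h3, h2, map_zero, zero_add, sub_zero]
  have e1 : pd K (Coord.u 1) (pd K (Coord.u 4) B) =
      -nab a A (pd K (Coord.u 1) (pd K (Coord.u 1) A)) := by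
    rw [h.pd_four, map_sub, n1, lie_self, pd_comm (Coord.u 1) (Coord.u 0)]
    abel
  have f2 : pd K (Coord.u 2) (pd K (Coord.u 3) B) =
      nab a A (pd K (Coord.u 1) (pd K (Coord.u 1) A)) +
      nab a A (pd K (Coord.u 1) (pd K (Coord.u 1) A)) := by
    rw [h.pd_three, map_sub, n2, e2, e1, map_smul, pd_smul, h2, pderiv_uc]
    simp
  have f3 : pd K (Coord.u 3) (pd K (Coord.u 3) B) = pd K (Coord.u 1) (pd K (Coord.u 1) A) := by
    rw [h.pd_three, map_sub, n3, e3, e2, map_smul, pd_smul, h3, pderiv_uc]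
    simp
  have g3 : pd K (Coord.u 3) (pd K (Coord.u 2) B) =
      - nab a A (pd K (Coord.u 1) (pd K (Coord.u 1) A)) - pd K (Coord.u 2) (pd K (Coord.u 3) B) := by
    rw [h.pd_two, map_sub, n3, f3, map_add, map_smul, pd_smul, h3, map_smul, pd_smul, h3,
      pderiv_uc, pderiv_uc]
    simp
    abel
  rw [pd_comm, f2] at g3
  refine nsmul_eq_zero_imp K (n := 4) ?_
  rw [← sub_eq_zero] at g3
  refine Eq.trans ?_ g3
  abel

/-- Applying ∂/∂u_2 to ∇A_{u_1u_1} = 0 shows that `A` is quadratic in u_1. The normalization removes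
the part linear in u_1 - a_1. -/
theorem IsZCR.pd_one (h : IsZCR α β a A B) : pd K (Coord.u 1) A =
    (MvPolynomial.X (Coord.u 1) : MvPolynomial Coord K) • pd K (Coord.u 1) (pd K (Coord.u 1) A) := by
  have hn := h.nab_pd_one_one
  have h111 : pd K (Coord.u 1) (pd K (Coord.u 1) (pd K (Coord.u 1) A)) = 0 := by
    have := congrArg (pd K (Coord.u 2)) hn
    rw [h.pd_succ_nab (k := 1) (by omega) (by omega), pd_comm (Coord.u 2), pd_comm (Coord.u 2),
      h.pdA 2 le_rfl] at this
    simpa using this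
  rw [← sub_eq_zero]
  refine eq_zero_of_pd (K := K) {Coord.u 1} ?_ ?_
  · rintro _ rfl
    rw [map_sub, pd_smul, h111, MvPolynomial.pderiv_X_self, one_smul, smul_zero, add_zero, sub_self]
  · intro m hm
    have hm := hm (Coord.u 1) rfl
    rw [Ser.sub_apply, X_smul_apply_of_eq_zero hm, sub_zero, pd_apply, h.normV, smul_zero]
    simp [hm]

/-- For R = A_{u_1u_1}, the u_1-derivative of ∇R = 0 is R_{u_0} + [A_{u_1}, R] = 0, and A_{u_1} is a
polynomial multiple of R. So R is independent of u, and restriction to u = a gives R_x = 0, then [A,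
R] = 0. -/
theorem IsZCR.isConstant_pd_one_one (h : IsZCR α β a A B) :
    IsConstant K A (pd K (Coord.u 1) (pd K (Coord.u 1) A)) := by
  have hn := h.nab_pd_one_one
  have h1 := h.pd_one
  obtain ⟨R, hR⟩ : ∃ R, R = pd K (Coord.u 1) (pd K (Coord.u 1) A) := ⟨_, rfl⟩
  rw [← hR] at hn h1 ⊢
  have h2 : pd K (Coord.u 2) R = 0 := by
    rw [hR, pd_comm (Coord.u 2), pd_comm (Coord.u 2), h.pdA 2 le_rfl, map_zero, map_zero]
  have hR1 : pd K (Coord.u 1) R = 0 := by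
    simpa [h.pd_succ_nab (k := 1), h2] using congrArg (pd K (Coord.u 2)) hn
  have hR0 : pd K (Coord.u 0) R = 0 := by
    have := congrArg (pd K (Coord.u 1)) hn
    rw [EvolutionZCR.pd_succ_nab (k := 0) (by omega), zero_add, hR1, h1, smul_lie, lie_self] at this
    simpa using this
  have hu : ∀ k, pd K (Coord.u k) R = 0 := by
    rintro (_ | _ | k)
    · exact hR0
    · exact hR1
    · rw [hR, pd_comm (Coord.u (k + 2)), pd_comm (Coord.u (k + 2)), h.pdA _ (by omega), map_zero,
        map_zero]
  rw [nab_apply, Dx_eq_pd_x a hu] at hn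
  have hx : pd K Coord.x R = 0 := by
    refine eq_zero_of_pd_u (K := K) (fun k => by rw [pd_comm, hu, map_zero]) fun m hm => ?_
    have := congrFun hn m
    rwa [Ser.add_apply, lie_apply_of_noU h.normA _ hm, add_zero] at this
  rw [hx, zero_add] at hn
  exact ⟨hu, hx, hn⟩

end CharZero

end EvolutionZCR

/-! ### Universal property of the presentations and the kernel of φ_1 -/

namespace EvolutionZCR

open Ser

section Presentation

variable {K : Type*} [CommRing K] {E : EvolutionEq K} {a : E.Prolongation} {p : ℕ}
  {L : Type*} [LieRing L] [LieAlgebra K L]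

theorem genA_of_not {L : Type*} [Zero L] (g : Gen E p → L) {m : Mon} (h : ¬ MonBelow (p + 1) m) :
    genA g m = 0 := dif_neg h

theorem genB_of_not {L : Type*} [Zero L] (g : Gen E p → L) {m : Mon}
    (h : ¬ MonBelow (p + E.order) m) : genB g m = 0 := dif_neg h

theorem genA_of {L : Type*} [Zero L] (g : Gen E p → L) {m : Mon} (h : MonBelow (p + 1) m) :
    genA g m = g (Gen.A m h) := dif_pos h

theorem genB_of {L : Type*} [Zero L] (g : Gen E p → L) {m : Mon} (h : MonBelow (p + E.order) m) :
    genB g m = g (Gen.B m h) := dif_pos h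

theorem map_genA {L L' : Type*} [AddCommGroup L] [AddCommGroup L'] (f : L →+ L') (g : Gen E p → L) :
    (fun m => f (genA g m)) = genA fun s => f (g s) := by
  funext m
  by_cases h : MonBelow (p + 1) m
  · rw [genA_of _ h, genA_of _ h]
  · rw [genA_of_not _ h, genA_of_not _ h, map_zero]

theorem map_genB {L L' : Type*} [AddCommGroup L] [AddCommGroup L'] (f : L →+ L') (g : Gen E p → L) :
    (fun m => f (genB g m)) = genB fun s => f (g s) := by
  funext m
  by_cases h : MonBelow (p + E.order) m
  · rw [genB_of _ h, genB_of _ h]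
  · rw [genB_of_not _ h, genB_of_not _ h, map_zero]

theorem Fd.mkHom_surjective : Function.Surjective (Fd.mkHom E a p) := by
  rintro ⟨v⟩
  exact ⟨v, rfl⟩

/-- A Lie subalgebra that contains the generators is everything. -/
theorem Fd.mem_of_gen (S : LieSubalgebra K (Fd E a p)) (h : ∀ s, Fd.of E a p s ∈ S)
    (v : Fd E a p) : v ∈ S := by
  obtain ⟨f, rfl⟩ := Fd.mkHom_surjective v
  have : Fd.mkHom E a p = S.incl.comp (FreeLieAlgebra.lift K fun s => (⟨Fd.of E a p s, h s⟩ : S)) := by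
    apply FreeLieAlgebra.hom_ext
    intro s
    rw [LieHom.comp_apply, FreeLieAlgebra.lift_of_apply]
    rfl
  rw [this]
  exact Subtype.mem _

/-- An element that commutes with the generators is central. -/
theorem Fd.lie_eq_zero_of_gen {z : Fd E a p} (h : ∀ s, ⁅z, Fd.of E a p s⁆ = 0) (v : Fd E a p) :
    ⁅z, v⁆ = 0 := by
  let S : LieSubalgebra K (Fd E a p) :=
    { LinearMap.ker (LieModule.toEnd K (Fd E a p) (Fd E a p) z) with
      lie_mem' := by
        intro v w hv hw
        have hv : ⁅z, v⁆ = 0 := hv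
        have hw : ⁅z, w⁆ = 0 := hw
        change ⁅z, ⁅v, w⁆⁆ = 0
        rw [leibniz_lie, hv, hw, zero_lie, lie_zero, add_zero] }
  exact Fd.mem_of_gen S h v

theorem Fd.hom_ext {f g : Fd E a p →ₗ⁅K⁆ L} (h : ∀ s, f (Fd.of E a p s) = g (Fd.of E a p s)) :
    f = g := by
  have : f.comp (Fd.mkHom E a p) = g.comp (Fd.mkHom E a p) := FreeLieAlgebra.hom_ext h
  ext v
  obtain ⟨v, rfl⟩ := Fd.mkHom_surjective v
  exact LieHom.congr_fun this v

/-- The homomorphism from `𝔽^p(E, a)` that a normalized zero-curvature representation defines. -/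
theorem Fd.exists_lift (g : Gen E p → L)
    (hz : ∀ m, zcrExpr E a p (genA g) (genB g) m = 0)
    (hA : ∀ m hm, NoU m → g (Gen.A m hm) = 0)
    (hB : ∀ m hm, NoU m → m Coord.x = 0 → g (Gen.B m hm) = 0)
    (hV : ∀ m hm, InV p m → g (Gen.A m hm) = 0) :
    ∃ f : Fd E a p →ₗ⁅K⁆ L, ∀ s, f (Fd.of E a p s) = g s := by
  have hrel : ∀ r, Relator E a p r → FreeLieAlgebra.lift K g r = 0 := by
    intro r hr
    cases hr with
    | zcr m =>
      rw [map_zcrExpr]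
      have h1 := map_genA (E := E) (p := p)
        (FreeLieAlgebra.lift K g : FreeLieAlgebra K (Gen E p) →ₗ[K] L).toAddMonoidHom
        (FreeLieAlgebra.of K)
      have h2 := map_genB (E := E) (p := p)
        (FreeLieAlgebra.lift K g : FreeLieAlgebra K (Gen E p) →ₗ[K] L).toAddMonoidHom
        (FreeLieAlgebra.of K)
      have h3 : (fun s => (FreeLieAlgebra.lift K g :
          FreeLieAlgebra K (Gen E p) →ₗ[K] L).toAddMonoidHom (FreeLieAlgebra.of K s)) = g :=
        funext fun s => FreeLieAlgebra.lift_of_apply g s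
      rw [h3] at h1 h2
      refine Eq.trans ?_ (hz m)
      rw [← h1, ← h2]
      rfl
    | normA m hm h =>
      rw [FreeLieAlgebra.lift_of_apply]
      exact hA m hm h
    | normB m hm h hx =>
      rw [FreeLieAlgebra.lift_of_apply]
      exact hB m hm h hx
    | normV m hm h =>
      rw [FreeLieAlgebra.lift_of_apply]
      exact hV m hm h
  have hle : relIdeal E a p ≤ (FreeLieAlgebra.lift K g).ker :=
    LieSubmodule.lieSpan_le.2 fun r hr => LieHom.mem_ker.2 (hrel r hr)
  refine ⟨{ Submodule.liftQ (relIdeal E a p).toSubmodule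
      (FreeLieAlgebra.lift K g : FreeLieAlgebra K (Gen E p) →ₗ[K] L)
      (fun r hr => LieHom.mem_ker.1 (hle hr)) with
    map_lie' := ?_ }, fun s => FreeLieAlgebra.lift_of_apply g s⟩
  rintro ⟨v⟩ ⟨w⟩
  exact (FreeLieAlgebra.lift K g).map_lie v w

theorem Fd.normA {m : Mon} (hm : MonBelow (p + 1) m) (h : NoU m) : Fd.of E a p (Gen.A m hm) = 0 :=
  Fd.mk_relator (Relator.normA m hm h)

theorem Fd.normB {m : Mon} (hm : MonBelow (p + E.order) m) (h : NoU m) (hx : m Coord.x = 0) :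
    Fd.of E a p (Gen.B m hm) = 0 :=
  Fd.mk_relator (Relator.normB m hm h hx)

theorem Fd.normV {m : Mon} (hm : MonBelow (p + 1) m) (h : InV p m) : Fd.of E a p (Gen.A m hm) = 0 :=
  Fd.mk_relator (Relator.normV m hm h)

theorem Fd.genA_normA {m : Mon} (h : NoU m) : genA (Fd.of E a p) m = 0 := by
  rw [genA_of _ (h.mono (Nat.zero_le _)), Fd.normA _ h]

theorem Fd.genB_normB {m : Mon} (h : NoU m) (hx : m Coord.x = 0) : genB (Fd.of E a p) m = 0 := by
  rw [genB_of _ (h.mono (Nat.zero_le _)), Fd.normB _ h hx]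

theorem fdHom_surjective : Function.Surjective (fdHom E a p) := by
  intro v
  refine Fd.mem_of_gen (fdHom E a p).range ?_ v
  rintro (⟨m, hm⟩ | ⟨m, hm⟩)
  · refine ⟨Fd.of E a (p + 1) (Gen.A m (hm.mono (Nat.le_succ _))), ?_⟩
    exact (fdHom_of E a p _).trans (dif_pos hm)
  · refine ⟨Fd.of E a (p + 1) (Gen.B m (hm.mono (by omega))), ?_⟩
    exact (fdHom_of E a p _).trans (dif_pos hm)

/-- The kernel of `φ_{p+1}` lies in any ideal that contains the generators it maps to zero. -/
theorem ker_fdHom_le (hV : ∀ m, InV p m → InV (p + 1) m ∨ ¬ MonBelow (p + 1) m)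
    (I : LieIdeal K (Fd E a (p + 1)))
    (hA : ∀ m, ¬ MonBelow (p + 1) m → genA (Fd.of E a (p + 1)) m ∈ I)
    (hB : ∀ m, ¬ MonBelow (p + E.order) m → genB (Fd.of E a (p + 1)) m ∈ I) :
    (fdHom E a p).ker ≤ I := by
  let q : Fd E a (p + 1) →ₗ⁅K⁆ Fd E a (p + 1) ⧸ I :=
    { (LieSubmodule.Quotient.mk' I : Fd E a (p + 1) →ₗ[K] Fd E a (p + 1) ⧸ I) with
      map_lie' := fun {_ _} => rfl }
  have hq : ∀ v, q v = 0 ↔ v ∈ I := fun v => LieSubmodule.Quotient.mk_eq_zero'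
  let g : Gen E p → Fd E a (p + 1) ⧸ I := fun s => match s with
    | Gen.A m hm => q (Fd.of E a (p + 1) (Gen.A m (hm.mono (Nat.le_succ _))))
    | Gen.B m hm => q (Fd.of E a (p + 1) (Gen.B m (hm.mono (by omega))))
  have hgA : genA g = fun m => q (genA (Fd.of E a (p + 1)) m) := by
    funext m
    by_cases h : MonBelow (p + 1) m
    · rw [genA_of _ h, genA_of _ (h.mono (Nat.le_succ _))]
    · rw [genA_of_not _ h, eq_comm, hq]
      exact hA m h
  have hgB : genB g = fun m => q (genB (Fd.of E a (p + 1)) m) := by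
    funext m
    by_cases h : MonBelow (p + E.order) m
    · rw [genB_of _ h, genB_of _ (h.mono (by omega))]
    · rw [genB_of_not _ h, eq_comm, hq]
      exact hB m h
  -- Modulo I the series lose all terms that the smaller presentation lacks, so they satisfy its
  -- relations. The quotient map by I therefore factors through φ_{p+1}.
  obtain ⟨f, hf⟩ := Fd.exists_lift (a := a) g
    (fun m => by
      rw [← zcrExpr_succ E a p (fun m h => genA_of_not g h) (fun m h => genB_of_not g h), hgA, hgB,
        ← map_zcrExpr, Fd.zcr, map_zero])
    (fun m hm h => by
      change q _ = 0
      rw [Fd.normA _ h, map_zero])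
    (fun m hm h hx => by
      change q _ = 0
      rw [Fd.normB _ h hx, map_zero])
    (fun m hm h => by
      change q _ = 0
      rcases hV m h with h | h
      · rw [Fd.normV _ h, map_zero]
      · exact absurd hm h)
  have hfq : f.comp (fdHom E a p) = q := by
    apply Fd.hom_ext
    rintro (⟨m, hm⟩ | ⟨m, hm⟩)
    · rw [LieHom.comp_apply, fdHom_of, genImage]
      split_ifs with h
      · exact hf _
      · rw [map_zero, eq_comm, hq, ← genA_of (Fd.of E a (p + 1)) hm]
        exact hA m h
    · rw [LieHom.comp_apply, fdHom_of, genImage]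
      split_ifs with h
      · exact hf _
      · rw [map_zero, eq_comm, hq, ← genB_of (Fd.of E a (p + 1)) hm]
        exact hB m h
  intro v hv
  rw [← hq, ← hfq, LieHom.comp_apply, LieHom.mem_ker.1 hv, map_zero]

theorem isCentralExtensionOf_of_surjective {L₁ : Type*} [LieRing L₁] [LieAlgebra K L₁]
    (f : L₁ →ₗ⁅K⁆ L) (hf : Function.Surjective f) (hc : f.ker ≤ LieAlgebra.center K L₁) :
    IsCentralExtensionOf K L₁ L := by
  refine ⟨f.ker, hc, ⟨f.quotKerEquivRange.trans ?_⟩⟩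
  have : f.range = ⊤ := (LieHom.range_eq_top f).2 hf
  exact (LieEquiv.ofEq _ _ (by rw [this])).trans LieSubalgebra.topEquiv

end Presentation

section IsZCR

variable {K : Type*} [CommRing K] (α β : K) (a : (fordy α β).Prolongation)

theorem isZCR_one : IsZCR α β a (genA (Fd.of (fordy α β) a 1) : Ser _)
    (genB (Fd.of (fordy α β) a 1) : Ser _) := by
  refine IsZCR.of_zcrExpr (fun m h => genA_of_not _ h) (fun m h => genB_of_not _ h)
    (Fd.zcr _ _ _) (fun m h => Fd.genA_normA h) (fun m h hx => Fd.genB_normB h hx) ?_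
  intro m hm
  by_cases h : MonBelow 2 m
  · refine (genA_of _ h).trans (Fd.normV h ⟨1, le_rfl, le_rfl, hm, fun q h1 h2 => ?_⟩)
    omega
  · exact genA_of_not _ h

/-- A representation with p = 0 is one with p = 1 in which u_1 is absent from `A` and u_5 from `B`;
the preceding analysis thus applies to both algebras. -/
theorem isZCR_zero : IsZCR α β a (genA (Fd.of (fordy α β) a 0) : Ser _)
    (genB (Fd.of (fordy α β) a 0) : Ser _) := by
  refine IsZCR.of_zcrExpr (fun m h => genA_of_not _ fun h' => h (h'.mono (by omega)))
    (fun m h => genB_of_not _ fun h' => h (h'.mono (Nat.le_succ 5))) ?_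
    (fun m h => Fd.genA_normA h) (fun m h hx => Fd.genB_normB h hx) ?_
  · intro m
    rw [zcrExpr_succ _ _ 0 (fun m h => genA_of_not _ h) (fun m h => genB_of_not _ h), Fd.zcr]
  · intro m hm
    refine genA_of_not _ fun h => ?_
    rw [h 1 le_rfl] at hm
    omega

end IsZCR

section Fordy

variable {K : Type*} [Field K] [CharZero K] (α β : K) (a : (fordy α β).Prolongation)

theorem not_monBelow_one {m : Mon} (h : MonBelow 2 m) (h' : ¬ MonBelow 1 m) :
    m (Coord.u 1) ≠ 0 := by
  intro h0
  refine h' fun k hk => ?_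
  rcases hk.eq_or_lt with rfl | hk
  · exact h0
  · exact h k hk

theorem Ser.coeff_ne_zero_mem {K L : Type*} [Field K] [CharZero K] [LieRing L] [LieAlgebra K L]
    (I : Submodule K L) {S : Ser L} {c : Coord} (h : ∀ m, pd K c S m ∈ I) {m : Mon} (hm : m c ≠ 0) :
    S m ∈ I := by
  have ha : m - Finsupp.single c 1 + Finsupp.single c 1 = m := by
    refine tsub_add_cancel_of_le ?_
    rw [Finsupp.single_le_iff]
    exact Nat.one_le_iff_ne_zero.2 hm
  have := h (m - Finsupp.single c 1)
  rw [pd_apply, ha, ← Nat.cast_smul_eq_nsmul K] at this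
  exact (I.smul_mem_iff (Nat.cast_ne_zero.2 (Nat.succ_ne_zero _))).1 this

/-- A generator killed by φ_1 has a positive exponent of u_1 (for `A`) or of u_5 (for `B`). It is
thus a rational multiple of a coefficient of A_{u_1} = B_{u_5}, and these are combinations of the
central coefficients of A_{u_1u_1}. -/
theorem fordy_ker_le_center :
    (fdHom (fordy α β) a 0).ker ≤ LieAlgebra.center K (Fd (fordy α β) a 1) := by
  have h := isZCR_one α β a
  obtain ⟨A, hA⟩ : ∃ A : Ser (Fd (fordy α β) a 1), A = genA (Fd.of (fordy α β) a 1) := ⟨_, rfl⟩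
  obtain ⟨B, hB⟩ : ∃ B : Ser (Fd (fordy α β) a 1), B = genB (Fd.of (fordy α β) a 1) := ⟨_, rfl⟩
  rw [← hA, ← hB] at h
  have hgA : ∀ m hm, Fd.of (fordy α β) a 1 (Gen.A m hm) = A m := fun m hm => by
    rw [hA]
    exact (genA_of _ hm).symm
  have hgB : ∀ m hm, Fd.of (fordy α β) a 1 (Gen.B m hm) = B m := fun m hm => by
    rw [hB]
    exact (genB_of _ hm).symm
  have h1 : ∀ m, pd K (Coord.u 1) A m ∈ (LieAlgebra.center K (Fd (fordy α β) a 1)).toSubmodule := by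
    intro m
    rw [h.pd_one, polySMul_apply]
    refine Submodule.sum_mem _ fun q _ => Submodule.smul_mem _ _ ?_
    refine (LieModule.mem_maxTrivSubmodule K _ _ _).2 fun v => ?_
    rw [← lie_skew, neg_eq_zero]
    refine Fd.lie_eq_zero_of_gen ?_ v
    rintro (⟨m', hm'⟩ | ⟨m', hm'⟩)
    · rw [hgA, ← lie_skew, neg_eq_zero]
      exact (h.coeff_lie_eq_zero h.pd_one h.isConstant_pd_one_one m' q.2).1
    · rw [hgB, ← lie_skew, neg_eq_zero]
      exact (h.coeff_lie_eq_zero h.pd_one h.isConstant_pd_one_one m' q.2).2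
  refine ker_fdHom_le ?_ _ ?_ ?_
  · rintro m ⟨r, h1, h2, -⟩
    omega
  · intro m hm
    by_cases hm' : MonBelow 2 m
    · rw [← hA]
      exact coeff_ne_zero_mem _ h1 (not_monBelow_one hm' hm)
    · rw [genA_of_not _ hm']
      exact zero_mem _
  · intro m hm
    by_cases hm' : MonBelow 6 m
    · rw [← hB]
      refine coeff_ne_zero_mem (c := Coord.u 5) _ (by rwa [h.pd_five]) ?_
      intro h0
      refine hm fun k hk => ?_
      rcases (show 5 ≤ k from hk).eq_or_lt with rfl | hk
      · exact h0
      · exact hm' k hk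
    · rw [genB_of_not _ hm']
      exact zero_mem _

end Fordy

end EvolutionZCR

/-! ### Reduction when A depends on x, t, u_0 only -/

namespace EvolutionZCR

open Ser

section Reduction

variable {K : Type*} [Field K] {L : Type*} [LieRing L] [LieAlgebra K L] {α β : K}
  {a : Coord → K} {A B : Ser L}

/-- A constant, as a polynomial. -/
noncomputable abbrev cst (r : K) : MvPolynomial Coord K := MvPolynomial.C r

/-- The polynomial `u_0 - a_0` in centered coordinates. -/
noncomputable abbrev w0 (K : Type*) [Field K] : MvPolynomial Coord K := MvPolynomial.X (Coord.u 0)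

theorem pd_succ_nab_of_pd_one {k : ℕ} (hk : k < 6) (hA : ∀ k, 1 ≤ k → pd K (Coord.u k) A = 0)
    (S : Ser L) : pd K (Coord.u (k + 1)) (nab a A S) =
      nab a A (pd K (Coord.u (k + 1)) S) + pd K (Coord.u k) S := by
  rw [pd_succ_nab hk, hA (k + 1) (by omega), zero_lie, add_zero]

/-- The derivative of the zero-curvature equation with respect to `u_{k+1}`. -/
theorem IsZCR.nab_pd_of_pd_one (h : IsZCR α β a A B) (hA : ∀ k, 1 ≤ k → pd K (Coord.u k) A = 0)
    {k : ℕ} (hk' : k < 6) :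
    nab a A (pd K (Coord.u (k + 1)) B) + pd K (Coord.u k) B =
      MvPolynomial.pderiv (Coord.u (k + 1)) (fordyF α β a) • pd K (Coord.u 0) A := by
  have h1 := hA (k + 1) (by omega)
  have := congrArg (pd K (Coord.u (k + 1))) h.nab_eq
  rw [pd_succ_nab_of_pd_one hk' hA, hA 1 le_rfl, smul_zero, add_zero, map_add, pd_smul,
    pd_comm (Coord.u (k + 1)), h1, pd_comm (Coord.u (k + 1)), h1,
    map_zero, map_zero, smul_zero, add_zero, zero_add] at this
  exact this

/-- The consequences of the zero-curvature equation when `A` depends on `x, t, u_0` at most, in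
terms of `Q = ∂A/∂u_0`. -/
structure IsReduced (α β : K) (a : Coord → K) (A B Q : Ser L) : Prop where
  pd_u : ∀ k, pd K (Coord.u k) Q = 0
  eqA : A = w0 K • Q
  lie_x : ⁅Q, ⁅Q, pd K Coord.x Q⁆⁆ = 0
  lie_xx : ⁅Q, pd K Coord.x (pd K Coord.x Q)⁆ = cst (-4 * α) • pd K Coord.x Q
  pd_four : pd K (Coord.u 4) B = Q
  pd_three : pd K (Coord.u 3) B = -nab a A (pd K (Coord.u 4) B)
  pd_two : pd K (Coord.u 2) B = cst (8 * α - 2 * β) • uc a 0 • Q - nab a A (pd K (Coord.u 3) B)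
  pd_one : pd K (Coord.u 1) B = cst (4 * α - 6 * β) • uc a 1 • Q - nab a A (pd K (Coord.u 2) B)
  pd_zero : pd K (Coord.u 0) B = cst (4 * α - 6 * β) • uc a 2 • Q -
    cst (20 * α * β) • uc a 0 • uc a 0 • Q - nab a A (pd K (Coord.u 1) B)
  pdB : ∀ k, 5 ≤ k → pd K (Coord.u k) B = 0
  zcr : nab a A B = w0 K • pd K Coord.t Q + fordyF α β a • Q

variable [CharZero K] in
-- Two more mixed derivatives of `B`, by u_1u_2 and by u_0u_1, make `A` linear in u_0 - a_0 and
-- yield the first commutator identities for its slope.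
theorem IsZCR.isReduced (h : IsZCR α β a A B) (hA : ∀ k, 1 ≤ k → pd K (Coord.u k) A = 0)
    (hαβ : 6 * α + β ≠ 0) : IsReduced α β a A B (pd K (Coord.u 0) A) := by
  have n0 : ∀ S, pd K (Coord.u 0) (nab a A S) = _ := fun S => pd_zero_nab S
  have n1 : ∀ S, pd K (Coord.u 1) (nab a A S) = _ := fun S =>
    pd_succ_nab_of_pd_one (k := 0) (by omega) hA S
  have n2 : ∀ S, pd K (Coord.u 2) (nab a A S) = _ := fun S =>
    pd_succ_nab_of_pd_one (k := 1) (by omega) hA S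
  simp only [Nat.reduceAdd] at n0 n1 n2
  obtain ⟨E, hE⟩ : ∃ E, E = pd K (Coord.u 0) A := ⟨_, rfl⟩
  have hEk : ∀ k, 1 ≤ k → pd K (Coord.u k) E = 0 := fun k hk => by
    rw [hE, pd_comm, hA k hk, map_zero]
  have b5 : pd K (Coord.u 5) B = 0 := h.pd_five.trans (hA 1 le_rfl)
  have b4 : pd K (Coord.u 4) B = E := by
    rw [h.pd_four, hA 1 le_rfl, map_zero, sub_zero, hE]
  have b3 : pd K (Coord.u 3) B = -nab a A (pd K (Coord.u 4) B) := by
    rw [h.pd_three, hA 1 le_rfl, smul_zero, smul_zero, zero_sub]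
  have b2 : pd K (Coord.u 2) B = cst (8 * α - 2 * β) • uc a 0 • E -
      nab a A (pd K (Coord.u 3) B) := by
    rw [h.pd_two, hA 1 le_rfl, smul_zero, smul_zero, add_zero, hE, C_smul]
  have b1 : pd K (Coord.u 1) B = cst (4 * α - 6 * β) • uc a 1 • E -
      nab a A (pd K (Coord.u 2) B) := by
    have := h.nab_pd_of_pd_one hA (k := 1) (by omega)
    simp only [Nat.reduceAdd, pderiv_fordyF, Nat.reduceEqDiff, reduceIte, mul_smul] at this
    rw [eq_sub_iff_add_eq', this, hE]
  have b0 : pd K (Coord.u 0) B = cst (4 * α - 6 * β) • uc a 2 • E -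
      cst (20 * α * β) • uc a 0 • uc a 0 • E - nab a A (pd K (Coord.u 1) B) := by
    have := h.nab_pd_of_pd_one hA (k := 0) (by omega)
    simp only [zero_add, pderiv_fordyF, Nat.reduceEqDiff, reduceIte, mul_smul, sub_smul, pow_two,
      show ¬ ((1 : ℕ) = 5) by omega, show ¬ ((1 : ℕ) = 3) by omega, show ¬ ((1 : ℕ) = 2) by omega]
      at this
    rw [eq_sub_iff_add_eq', this, hE]
  obtain ⟨R, hR⟩ : ∃ R, R = pd K (Coord.u 0) E := ⟨_, rfl⟩
  have hRk : ∀ k, 1 ≤ k → pd K (Coord.u k) R = 0 := fun k hk => by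
    rw [hR, pd_comm, hEk k hk, map_zero]
  have e1 : pd K (Coord.u 1) (nab a A E) = R := by
    rw [n1, hEk 1 le_rfl, map_zero, zero_add, hR]
  have e2 : pd K (Coord.u 2) (nab a A E) = 0 := by
    rw [n2, hEk 1 le_rfl, hEk 2 (by omega), map_zero, zero_add]
  have e0 : pd K (Coord.u 0) (nab a A E) = nab a A R := by
    rw [n0, ← hE, lie_self, add_zero, hR]
  have ee1 : pd K (Coord.u 1) (nab a A (nab a A E)) = nab a A R + nab a A R := by
    rw [n1, e1, e0]
  have ee2 : pd K (Coord.u 2) (nab a A (nab a A E)) = R := by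
    rw [n2, e2, e1, map_zero, zero_add]
  -- B_{u_1u_2} equals both 2∇R and -3∇R.
  have hnR : nab a A R = 0 := by
    have h12 : pd K (Coord.u 1) (pd K (Coord.u 2) B) = nab a A R + nab a A R := by
      rw [b2, b3, b4, map_sub, map_neg, map_neg, sub_neg_eq_add, ee1, pd_C_smul, pd_smul,
        hEk 1 le_rfl, pderiv_uc]
      simp
    have h22 : pd K (Coord.u 2) (pd K (Coord.u 2) B) = R := by
      rw [b2, b3, b4, map_sub, map_neg, map_neg, sub_neg_eq_add, ee2, pd_C_smul, pd_smul,
        hEk 2 (by omega), pderiv_uc]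
      simp
    have h21 : pd K (Coord.u 2) (pd K (Coord.u 1) B) =
        -(nab a A R + (nab a A R + nab a A R)) := by
      rw [b1, map_sub, n2, h22, h12, pd_C_smul, pd_smul, hEk 2 (by omega), pderiv_uc]
      simp
    rw [pd_comm, h12] at h21
    refine nsmul_eq_zero_imp K (n := 4) ?_
    rw [← sub_eq_zero] at h21
    refine Eq.trans ?_ h21
    abel
  rw [hnR, add_zero] at ee1
  have ee0 : pd K (Coord.u 0) (nab a A (nab a A E)) = ⁅E, nab a A E⁆ := by
    rw [n0, e0, hnR, map_zero, zero_add, hE]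
  obtain ⟨F1, hF1⟩ : ∃ F1, F1 = nab a A E := ⟨_, rfl⟩
  obtain ⟨F2, hF2⟩ : ∃ F2, F2 = nab a A F1 := ⟨_, rfl⟩
  rw [← hF1] at e0 e1 e2 ee0 ee1 ee2
  rw [← hF2] at ee0 ee1 ee2
  have h3 : pd K (Coord.u 1) (nab a A F2) = ⁅E, F1⁆ := by
    rw [n1, ee1, map_zero, zero_add, ee0]
  have h4 : pd K (Coord.u 0) (nab a A F2) = ⁅E, F2⁆ + ⁅E, F2⁆ := by
    rw [n0, ee0, nab_lie, ← hF1, ← hF2, lie_self, zero_add, hE]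
  have hb1 : pd K (Coord.u 1) B = cst (4 * α - 6 * β) • uc a 1 • E -
      cst (8 * α - 2 * β) • (uc a 1 • E + uc a 0 • F1) - nab a A F2 := by
    rw [b1, b2, b3, b4, map_sub, nab_C_smul, nab_uc_smul (by omega), map_neg, map_neg, ← hF1, ← hF2]
    abel
  have h11 : pd K (Coord.u 1) (pd K (Coord.u 1) B) = cst (4 * α - 6 * β) • E -
      cst (8 * α - 2 * β) • (E + uc a 0 • R) - ⁅E, F1⁆ := by
    rw [hb1, map_sub, map_sub, h3, pd_C_smul, pd_C_smul, map_add, pd_smul, pd_smul, hEk 1 le_rfl,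
      pderiv_uc, pderiv_uc, e1]
    simp
  have h10 : pd K (Coord.u 0) (pd K (Coord.u 1) B) = cst (4 * α - 6 * β) • uc a 1 • R -
      cst (8 * α - 2 * β) • (uc a 1 • R + F1) - (⁅E, F2⁆ + ⁅E, F2⁆) := by
    rw [hb1, map_sub, map_sub, h4, pd_C_smul, pd_C_smul, map_add, pd_smul, pd_smul, ← hR,
      pderiv_uc, pderiv_uc, e0, hnR]
    simp
  have h01 : pd K (Coord.u 1) (pd K (Coord.u 0) B) =
      -(nab a A (pd K (Coord.u 1) (pd K (Coord.u 1) B)) +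
        pd K (Coord.u 0) (pd K (Coord.u 1) B)) := by
    rw [b0, map_sub, n1, map_sub, pd_C_smul, pd_C_smul, pd_smul, pd_smul, pd_smul, hEk 1 le_rfl,
      pderiv_uc, pderiv_uc]
    simp
  -- This is the compatibility of the two expressions for B_{u_0u_1}.
  have hkey : cst (-20 * α) • F1 + cst (-16 * α - 6 * β) • uc a 1 • R =
      (5 : MvPolynomial Coord K) • ⁅E, F2⁆ := by
    rw [pd_comm, h11, h10, map_sub, map_sub, nab_C_smul, nab_C_smul, map_add, nab_uc_smul (by omega),
      hnR, nab_lie, ← hF1, ← hF2, lie_self] at h01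
    rw [← sub_eq_zero] at h01 ⊢
    rw [← h01]
    simp only [map_sub, map_mul, map_neg, map_ofNat]
    module
  -- The u_1-derivative of `hkey` is -6(6α + β)R = 0.
  have hR0 : R = 0 := by
    have := congrArg (pd K (Coord.u 1)) hkey
    rw [map_add, pd_C_smul, pd_C_smul, pd_smul, hRk 1 le_rfl, pderiv_uc, e1,
      ← map_ofNat (MvPolynomial.C (σ := Coord)) 5, pd_C_smul, pd_lie, hEk 1 le_rfl, ee1] at this
    simp only [reduceIte, one_smul, smul_zero, add_zero, C_smul, zero_lie, lie_zero,
      ← add_smul] at this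
    refine (smul_eq_zero.1 this).resolve_left fun h0 => hαβ ?_
    linear_combination (-1 / 6) * h0
  have hu : ∀ k, pd K (Coord.u k) E = 0 := by
    rintro (_ | k)
    · rw [← hR, hR0]
    · exact hEk _ (by omega)
  have hA' : A = w0 K • E := by
    rw [← sub_eq_zero]
    refine eq_zero_of_pd_u (K := K) ?_ ?_
    · rintro (_ | k)
      · rw [map_sub, pd_smul, hu, ← hE, MvPolynomial.pderiv_X_self, one_smul, smul_zero, add_zero,
          sub_self]
      · rw [map_sub, pd_smul, hu, hA _ (by omega), MvPolynomial.pderiv_X_of_ne (by simp), zero_smul,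
          smul_zero, add_zero, sub_self]
    · intro m hm
      rw [Ser.sub_apply, h.normA _ hm, X_smul_apply_of_eq_zero (hm 0 le_rfl), sub_zero]
  have hx : F1 = pd K Coord.x E := by
    rw [hF1, nab_apply, Dx_eq_pd_x a hu, hA', smul_lie, lie_self, smul_zero, add_zero]
  have hxx : F2 = pd K Coord.x (pd K Coord.x E) + w0 K • ⁅E, pd K Coord.x E⁆ := by
    rw [hF2, hx, nab_apply, Dx_eq_pd_x a (fun k => by rw [pd_comm, hu, map_zero]), hA', smul_lie]
  have hux : ∀ k, pd K (Coord.u k) (pd K Coord.x E) = 0 := fun k => by rw [pd_comm, hu, map_zero]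
  have huxx : ∀ k, pd K (Coord.u k) (pd K Coord.x (pd K Coord.x E)) = 0 := fun k => by
    rw [pd_comm, hux, map_zero]
  rw [hR0, smul_zero, smul_zero, add_zero, ← map_ofNat (MvPolynomial.C (σ := Coord)) 5, hxx, hx,
    lie_add, lie_smul, C_smul, C_smul] at hkey
  -- With A = (u_0 - a_0)E, `hkey` becomes linear in u_0 - a_0; this is its slope, and the constant
  -- term is the identity for [E, E_xx].
  have hlx : ⁅E, ⁅E, pd K Coord.x E⁆⁆ = 0 := by
    have := congrArg (pd K (Coord.u 0)) hkey
    simp only [map_smul, map_add, pd_smul, pd_lie, hu, hux, huxx, MvPolynomial.pderiv_X_self,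
      zero_lie, lie_zero, smul_zero, add_zero, zero_add, one_smul] at this
    rw [eq_comm, smul_eq_zero] at this
    exact this.resolve_left (by norm_num)
  rw [hlx, smul_zero, add_zero] at hkey
  rw [← hE]
  refine ⟨hu, hA', hlx, ?_, b4, b3, b2, b1, b0, ?_, ?_⟩
  · rw [C_smul]
    have h5 : (5 : K) ≠ 0 := by norm_num
    rw [← smul_right_inj h5, ← hkey, smul_smul]
    congr 1
    ring
  · intro k hk
    rcases hk.eq_or_lt with rfl | hk
    · exact b5
    · exact h.pdB k hk
  · rw [h.nab_eq, hA 1 le_rfl, smul_zero, add_zero, ← hE, hA', pd_smul,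
      MvPolynomial.pderiv_X_of_ne (by simp), zero_smul, zero_add]

end Reduction

end EvolutionZCR

/-! ### The part of B determined by Q -/

namespace EvolutionZCR

open Ser

section Explicit

variable {K : Type*} [Field K] {L : Type*} [LieRing L] [LieAlgebra K L] {α β : K}
  {a : Coord → K} {A Q : Ser L}

theorem nab_w0_smul (S : Ser L) : nab a A (w0 K • S) = uc a 1 • S + w0 K • nab a A S := by
  have h : ∀ T : Ser L, w0 K • T = uc a 0 • T - cst (a (Coord.u 0)) • T := fun T => by
    rw [uc, add_smul, add_sub_cancel_right]
  rw [h, map_sub, nab_uc_smul (by omega), nab_C_smul, h, zero_add]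
  abel

theorem nab_of_pd_u (hA : A = w0 K • Q) {S : Ser L} (hS : ∀ k, pd K (Coord.u k) S = 0) :
    nab a A S = pd K Coord.x S + w0 K • ⁅Q, S⁆ := by
  rw [nab_apply, Dx_eq_pd_x a hS, hA, smul_lie]

variable (K) in
/-- Iterated derivatives with respect to `x`. -/
noncomputable def dx (n : ℕ) (S : Ser L) : Ser L := (pd K Coord.x)^[n] S

theorem dx_succ (n : ℕ) (S : Ser L) : dx K (n + 1) S = pd K Coord.x (dx K n S) :=
  Function.iterate_succ_apply' _ _ _

theorem dx_zero (S : Ser L) : dx K 0 S = S := rfl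

theorem pd_x_dx (n : ℕ) (S : Ser L) : pd K Coord.x (dx K n S) = dx K (n + 1) S := (dx_succ n S).symm

theorem pd_dx {c : Coord} {S : Ser L} (h : pd K c S = 0) (n : ℕ) : pd K c (dx K n S) = 0 := by
  induction n with
  | zero => exact h
  | succ n ih => rw [dx_succ, pd_comm, ih, map_zero]

/-- Coefficients of the part of `B` that is determined by `Q = ∂A/∂u_0`. -/
structure IsCoeffs (α β : K) (a₀ : K) (Q T W₁ W₂ W₃ : Ser L) : Prop where
  T_eq : T + T = cst (-4 * α - 4 * β) • Q - ⁅Q, dx K 1 Q⁆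
  W₁_eq : W₁ = cst (-20 * α * β * a₀ * a₀) • Q + dx K 4 Q + cst ((8 * α - 2 * β) * a₀) • dx K 2 Q
  W₂_eq : W₂ + W₂ = cst (-40 * α * β * a₀) • Q - cst (2 * β) • dx K 2 Q + ⁅Q, dx K 3 Q⁆ +
    cst ((8 * α - 2 * β) * a₀) • ⁅Q, dx K 1 Q⁆
  W₃_eq : W₃ + W₃ + W₃ = cst (-20 * α * β) • Q - cst (2 * β) • ⁅Q, dx K 1 Q⁆
  pd_T : ∀ k, pd K (Coord.u k) T = 0
  pd_W₁ : ∀ k, pd K (Coord.u k) W₁ = 0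
  pd_W₂ : ∀ k, pd K (Coord.u k) W₂ = 0
  pd_W₃ : ∀ k, pd K (Coord.u k) W₃ = 0

/-- The part of `B` that is determined by `Q = ∂A/∂u_0`. -/
noncomputable def explB (α β : K) (a : Coord → K) (Q T W₁ W₂ W₃ : Ser L) : Ser L :=
  uc a 4 • Q - uc a 3 • dx K 1 Q +
  uc a 2 • (dx K 2 Q + w0 K • ⁅Q, dx K 1 Q⁆ + cst (8 * α - 2 * β) • uc a 0 • Q) +
  uc a 1 • (cst (8 * α) • w0 K • dx K 1 Q - dx K 3 Q - cst (8 * α - 2 * β) • uc a 0 • dx K 1 Q) +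
  uc a 1 • uc a 1 • T + w0 K • W₁ + w0 K • w0 K • W₂ + w0 K • w0 K • w0 K • W₃

variable [CharZero K]

/-- The coefficients T, W₁, W₂, W₃ are chosen so that the terms with u_1, u_2, … add up to those of
FQ. What remains is a polynomial in u_0 - a_0 over series in x, t. Its degree is three, not four,
because [Q, W₃] = 0. -/
theorem nab_explB {T W₁ W₂ W₃ : Ser L} (hu : ∀ k, pd K (Coord.u k) Q = 0) (hA : A = w0 K • Q)
    (lie_x : ⁅Q, ⁅Q, dx K 1 Q⁆⁆ = 0) (lie_xx : ⁅Q, dx K 2 Q⁆ = cst (-4 * α) • dx K 1 Q)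
    (h : IsCoeffs α β (a (Coord.u 0)) Q T W₁ W₂ W₃) :
    nab a A (explB α β a Q T W₁ W₂ W₃) = fordyF α β a • Q + w0 K • pd K Coord.x W₁ +
      w0 K • w0 K • (pd K Coord.x W₂ + ⁅Q, W₁⁆) +
      w0 K • w0 K • w0 K • (pd K Coord.x W₃ + ⁅Q, W₂⁆) := by
  have hn : ∀ n, nab a A (dx K n Q) = dx K (n + 1) Q + w0 K • ⁅Q, dx K n Q⁆ := fun n => by
    rw [nab_of_pd_u hA fun k => pd_dx (hu k) n, pd_x_dx]
  have q0 : nab a A Q = dx K 1 Q := by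
    rw [← dx_zero (K := K) Q, hn, dx_zero, lie_self, smul_zero, add_zero]
  have q1 := hn 1
  have q2 := hn 2
  have q3 := hn 3
  rw [lie_xx] at q2
  have qN : nab a A ⁅Q, dx K 1 Q⁆ = cst (-4 * α) • dx K 1 Q := by
    rw [nab_lie, q0, q1, lie_self, zero_add, lie_add, lie_smul, lie_x, smul_zero, add_zero, lie_xx]
  have qT : nab a A T = cst (-2 * β) • dx K 1 Q := by
    have := congrArg (nab a A) h.T_eq
    rw [map_add, map_sub, nab_C_smul, q0, qN, ← sub_smul, ← map_sub, ← two_smul K, C_smul] at this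
    rw [C_smul]
    refine (smul_right_inj (two_ne_zero (α := K))).1 (this.trans ?_)
    rw [smul_smul]
    congr 1
    ring
  have qW₁ := nab_of_pd_u (a := a) hA h.pd_W₁
  have qW₂ := nab_of_pd_u (a := a) hA h.pd_W₂
  have qW₃ := nab_of_pd_u (a := a) hA h.pd_W₃
  have hW₃ : ⁅Q, W₃⁆ = 0 := by
    have := congrArg (fun S => ⁅Q, S⁆) h.W₃_eq
    simp only [lie_add, lie_sub, lie_smul, lie_self, lie_x, smul_zero, sub_zero] at this
    refine nsmul_eq_zero_imp K (n := 2) (Eq.trans ?_ this)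
    abel
  rw [hW₃, smul_zero, add_zero] at qW₃
  have hT := h.T_eq
  have hW1 := h.W₁_eq
  have hW2 := h.W₂_eq
  have hW3 := h.W₃_eq
  have hu0 : uc a 0 = w0 K + cst (a (Coord.u 0)) := rfl
  rw [explB, fordyF]
  simp only [LinearMap.map_add, LinearMap.map_sub, nab_w0_smul, nab_C_smul, nab_uc_smul (a := a) (A := A)
    (show 0 < 6 by omega), nab_uc_smul (a := a) (A := A) (show 1 < 6 by omega),
    nab_uc_smul (a := a) (A := A) (show 2 < 6 by omega),
    nab_uc_smul (a := a) (A := A) (show 3 < 6 by omega),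
    nab_uc_smul (a := a) (A := A) (show 4 < 6 by omega), q0, q1, q2, q3, qN, qT, qW₁, qW₂, qW₃,
    Nat.reduceAdd] at hT hW1 hW2 hW3 ⊢
  generalize ⁅Q, W₁⁆ = l₁ at *
  generalize ⁅Q, W₂⁆ = l₂ at *
  generalize pd K Coord.x W₁ = l₃ at *
  generalize pd K Coord.x W₂ = l₄ at *
  generalize pd K Coord.x W₃ = l₅ at *
  rw [hu0]
  simp only [map_sub, map_mul, map_neg, map_ofNat] at hT hW1 hW2 hW3 ⊢
  linear_combination (norm := module) (uc a 1 * uc a 2) • hT + uc a 1 • hW1 +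
    (uc a 1 * w0 K) • hW2 + (uc a 1 * w0 K * w0 K) • hW3

end Explicit

end EvolutionZCR

/-! ### Equivalence of zero curvature with an evolution system for Q -/

namespace EvolutionZCR

open Ser

section Equivalence

variable {K : Type*} [Field K] {L : Type*} [LieRing L] [LieAlgebra K L] {α β : K}
  {a : Coord → K} {A B Q : Ser L}

/-- The equations that normalized zero-curvature representations reduce to. -/
structure IsEvol (α β a₀ : K) (Q B₀ : Ser L) : Prop where
  pd_u : ∀ k, pd K (Coord.u k) Q = 0
  pd_u_B : ∀ k, pd K (Coord.u k) B₀ = 0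
  pd_x_B : pd K Coord.x B₀ = 0
  lie_x : ⁅Q, ⁅Q, dx K 1 Q⁆⁆ = 0
  lie_xx : ⁅Q, dx K 2 Q⁆ = (-4 * α) • dx K 1 Q
  lie_lie : ⁅Q, ⁅Q, dx K 3 Q⁆⁆ = 0
  lie_four : (2 * β) • dx K 3 Q = ⁅dx K 1 Q, dx K 3 Q⁆ + (3 : K) • ⁅Q, dx K 4 Q⁆ -
    (16 * α * (6 * α + β) * a₀) • dx K 1 Q
  pd_t : pd K Coord.t Q = (-20 * α * β * a₀ * a₀) • dx K 1 Q + dx K 5 Q +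
    ((8 * α - 2 * β) * a₀) • dx K 3 Q + ⁅Q, B₀⁆

theorem IsCoeffs.pd_x_W₁ {a₀ : K} {T W₁ W₂ W₃ : Ser L} (h : IsCoeffs α β a₀ Q T W₁ W₂ W₃) :
    pd K Coord.x W₁ = (-20 * α * β * a₀ * a₀) • dx K 1 Q + dx K 5 Q +
      ((8 * α - 2 * β) * a₀) • dx K 3 Q := by
  rw [h.W₁_eq]
  simp only [LinearMap.map_add, LinearMap.map_smul, pd_x_dx, C_smul]
  rfl

/-- The left-hand side is twice the coefficient of (u_0 - a_0)² in the zero-curvature equation; its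
vanishing is the identity `lie_four`. In the same way the cubic coefficient below gives `lie_lie`.
-/
theorem IsCoeffs.two_smul_eq {a₀ : K} {T W₁ W₂ W₃ : Ser L} (h : IsCoeffs α β a₀ Q T W₁ W₂ W₃)
    (lie_xx : ⁅Q, dx K 2 Q⁆ = (-4 * α) • dx K 1 Q) :
    (2 : K) • (pd K Coord.x W₂ + ⁅Q, W₁⁆) = ⁅dx K 1 Q, dx K 3 Q⁆ + (3 : K) • ⁅Q, dx K 4 Q⁆ -
      (16 * α * (6 * α + β) * a₀) • dx K 1 Q - (2 * β) • dx K 3 Q := by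
  have h1 := congrArg (pd K Coord.x) h.W₂_eq
  have e1 : pd K Coord.x Q = dx K 1 Q := rfl
  simp only [LinearMap.map_add, LinearMap.map_sub, LinearMap.map_smul, pd_x_dx, C_smul,
    pd_lie, e1, Nat.reduceAdd, lie_xx, lie_self] at h1
  rw [h.W₁_eq]
  simp only [lie_add, C_smul, lie_smul, lie_self, lie_xx]
  linear_combination (norm := module) h1

theorem IsCoeffs.six_smul_eq {a₀ : K} {T W₁ W₂ W₃ : Ser L} (h : IsCoeffs α β a₀ Q T W₁ W₂ W₃)
    (lie_x : ⁅Q, ⁅Q, dx K 1 Q⁆⁆ = 0) (lie_xx : ⁅Q, dx K 2 Q⁆ = (-4 * α) • dx K 1 Q) :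
    (6 : K) • (pd K Coord.x W₃ + ⁅Q, W₂⁆) = (3 : K) • ⁅Q, ⁅Q, dx K 3 Q⁆⁆ := by
  have h1 := congrArg (pd K Coord.x) h.W₃_eq
  have h2 := congrArg (fun S => ⁅Q, S⁆) h.W₂_eq
  have e1 : pd K Coord.x Q = dx K 1 Q := rfl
  simp only [LinearMap.map_add, LinearMap.map_sub, LinearMap.map_smul, pd_x_dx, C_smul,
    pd_lie, e1, Nat.reduceAdd, lie_xx, lie_self] at h1
  simp only [lie_add, lie_sub, C_smul, lie_smul, lie_self, lie_xx, lie_x] at h2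
  linear_combination (norm := module) (2 : K) • h1 + (3 : K) • h2

theorem pderiv_w0 (k : ℕ) : MvPolynomial.pderiv (Coord.u k) (w0 K) = if k = 0 then 1 else 0 := by
  have h : w0 K = uc 0 0 := by simp [uc]
  rw [h, pderiv_uc]

/-- `explB` integrates the formulas for B_{u_4}, …, B_{u_0}, so `B` differs from it by a series in x
and t. -/
theorem IsReduced.pd_sub_explB {T W₁ W₂ W₃ : Ser L} (h : IsReduced α β a A B Q)
    (hc : IsCoeffs α β (a (Coord.u 0)) Q T W₁ W₂ W₃) (k : ℕ) :
    pd K (Coord.u k) (B - explB α β a Q T W₁ W₂ W₃) = 0 := by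
  have hd : ∀ n k, pd K (Coord.u k) (dx K n Q) = 0 := fun n k => pd_dx (h.pd_u k) n
  have hn : ∀ n, nab a A (dx K n Q) = dx K (n + 1) Q + w0 K • ⁅Q, dx K n Q⁆ := fun n => by
    rw [nab_of_pd_u h.eqA fun k => hd n k, pd_x_dx]
  have lie_x : ⁅Q, ⁅Q, dx K 1 Q⁆⁆ = 0 := h.lie_x
  have lie_xx : ⁅Q, dx K 2 Q⁆ = cst (-4 * α) • dx K 1 Q := h.lie_xx
  have q0 : nab a A Q = dx K 1 Q := by
    rw [← dx_zero (K := K) Q, hn, dx_zero, lie_self, smul_zero, add_zero]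
  have q1 := hn 1
  have q2 := hn 2
  have q3 := hn 3
  rw [lie_xx] at q2
  have qN : nab a A ⁅Q, dx K 1 Q⁆ = cst (-4 * α) • dx K 1 Q := by
    rw [nab_lie, q0, q1, lie_self, zero_add, lie_add, lie_smul, lie_x, smul_zero, add_zero, lie_xx]
  have hT := hc.T_eq
  have hW1 := hc.W₁_eq
  have hW2 := hc.W₂_eq
  have hW3 := hc.W₃_eq
  have b4 := h.pd_four
  have b3 := h.pd_three
  rw [b4, q0] at b3
  have b2 := h.pd_two
  rw [b3, map_neg, q1] at b2
  have b1 := h.pd_one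
  simp only [b2, LinearMap.map_add, LinearMap.map_sub, LinearMap.map_neg, nab_C_smul,
    nab_w0_smul, nab_uc_smul (a := a) (A := A) (show 0 < 6 by omega), q0, q2, qN, Nat.reduceAdd]
    at b1
  have b0 := h.pd_zero
  simp only [b1, LinearMap.map_add, LinearMap.map_sub, LinearMap.map_neg, nab_C_smul,
    nab_w0_smul, nab_uc_smul (a := a) (A := A) (show 0 < 6 by omega),
    nab_uc_smul (a := a) (A := A) (show 1 < 6 by omega), q0, q1, q3, qN, Nat.reduceAdd]
    at b0
  have hu0 : uc a 0 = w0 K + cst (a (Coord.u 0)) := rfl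
  have hl : ∀ n, pd K (Coord.u k) ⁅Q, dx K n Q⁆ = 0 := fun n => by
    rw [pd_lie, h.pd_u, hd, zero_lie, lie_zero, add_zero]
  rw [map_sub, sub_eq_zero]
  simp only [explB, LinearMap.map_add, LinearMap.map_sub, pd_smul, MvPolynomial.pderiv_C, pderiv_uc,
    pderiv_w0, hd, hl, h.pd_u, hc.pd_T, hc.pd_W₁, hc.pd_W₂, hc.pd_W₃]
  rcases k with _ | _ | _ | _ | _ | k
  · simp only [b0, hu0, map_sub, map_mul, map_neg, map_ofNat, reduceIte, 
      zero_ne_one, OfNat.zero_ne_ofNat] at hT hW1 hW2 hW3 ⊢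
    linear_combination (norm := module) -hW1 - w0 K • hW2 - (w0 K * w0 K) • hW3
  · simp only [zero_add, b1, hu0, map_sub, map_mul, map_neg, map_ofNat, reduceIte, one_ne_zero,
      OfNat.one_ne_ofNat] at hT ⊢
    linear_combination (norm := module) -uc a 1 • hT
  · simp only [zero_add, Nat.reduceAdd, b2, hu0, reduceIte, OfNat.ofNat_ne_zero,
      OfNat.ofNat_ne_one, Nat.reduceEqDiff]
    module
  · simp only [zero_add, Nat.reduceAdd, b3, hu0, reduceIte, OfNat.ofNat_ne_zero,
      OfNat.ofNat_ne_one, Nat.reduceEqDiff]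
    module
  · simp only [zero_add, Nat.reduceAdd, b4, hu0, reduceIte, OfNat.ofNat_ne_zero,
      OfNat.ofNat_ne_one, Nat.reduceEqDiff]
    module
  · rw [h.pdB _ (by omega)]
    simp

variable [CharZero K]

theorem exists_isCoeffs (α β a₀ : K) {Q : Ser L} (hu : ∀ k, pd K (Coord.u k) Q = 0) :
    ∃ T W₁ W₂ W₃, IsCoeffs α β a₀ Q T W₁ W₂ W₃ := by
  have hd : ∀ n k, pd K (Coord.u k) (dx K n Q) = 0 := fun n k => pd_dx (hu k) n
  have hl : ∀ n k, pd K (Coord.u k) ⁅Q, dx K n Q⁆ = 0 := fun n k => by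
    rw [pd_lie, hu, hd, zero_lie, lie_zero, add_zero]
  have h2 : ∀ S : Ser L, (1 / 2 : K) • S + (1 / 2 : K) • S = S := fun S => by
    rw [← add_smul]
    norm_num
  have h3 : ∀ S : Ser L, (1 / 3 : K) • S + (1 / 3 : K) • S + (1 / 3 : K) • S = S := fun S => by
    rw [← add_smul, ← add_smul]
    norm_num
  refine ⟨(1 / 2 : K) • _, _, (1 / 2 : K) • _, (1 / 3 : K) • _, h2 _, rfl, h2 _, h3 _, ?_, ?_, ?_, ?_⟩
  all_goals
    intro k
    simp only [LinearMap.map_add, LinearMap.map_sub, LinearMap.map_smul, pd_C_smul, hu, hd, hl,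
      smul_zero, add_zero, sub_zero]

theorem eq_zero_of_cubic {Y₀ Y₁ Y₂ Y₃ : Ser L} (h₀ : ∀ k, pd K (Coord.u k) Y₀ = 0)
    (h₁ : ∀ k, pd K (Coord.u k) Y₁ = 0) (h₂ : ∀ k, pd K (Coord.u k) Y₂ = 0)
    (h₃ : ∀ k, pd K (Coord.u k) Y₃ = 0)
    (h : Y₀ + w0 K • Y₁ + w0 K • w0 K • Y₂ + w0 K • w0 K • w0 K • Y₃ = 0) :
    Y₀ = 0 ∧ Y₁ = 0 ∧ Y₂ = 0 ∧ Y₃ = 0 := by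
  have g := congrArg (pd K (Coord.u 0)) h
  simp only [LinearMap.map_add, pd_smul, pderiv_w0, if_true, h₀, h₁, h₂, h₃, smul_zero, add_zero,
    zero_add, one_smul, LinearMap.map_zero] at g
  have g' := congrArg (pd K (Coord.u 0)) g
  simp only [LinearMap.map_add, pd_smul, pderiv_w0, if_true, h₁, h₂, h₃, smul_zero, add_zero,
    zero_add, one_smul, LinearMap.map_zero, smul_add] at g'
  have g'' := congrArg (pd K (Coord.u 0)) g'
  simp only [LinearMap.map_add, pd_smul, pderiv_w0, if_true, h₂, h₃, smul_zero, add_zero,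
    zero_add, one_smul, LinearMap.map_zero] at g''
  have e3 : Y₃ = 0 := nsmul_eq_zero_imp K (n := 5) (Eq.trans (by abel) g'')
  subst e3
  simp only [smul_zero, add_zero] at h g g'
  have e2 : Y₂ = 0 := nsmul_eq_zero_imp K (n := 1) (Eq.trans (by abel) g')
  subst e2
  simp only [smul_zero, add_zero] at h g
  subst g
  simp only [smul_zero, add_zero] at h
  exact ⟨h, rfl, rfl, rfl⟩

/-- The coefficients of powers of u_0 - a_0 in zero curvature are compared: degree 0 says that B₀
does not depend on x, degree 1 is the evolution equation, degrees 2 and 3 are commutator identities.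
-/
theorem IsReduced.isEvol {T W₁ W₂ W₃ : Ser L} (h : IsReduced α β a A B Q)
    (hc : IsCoeffs α β (a (Coord.u 0)) Q T W₁ W₂ W₃) :
    IsEvol α β (a (Coord.u 0)) Q (B - explB α β a Q T W₁ W₂ W₃) := by
  obtain ⟨B₀, hB₀⟩ : ∃ B₀, B₀ = B - explB α β a Q T W₁ W₂ W₃ := ⟨_, rfl⟩
  have hB := h.pd_sub_explB hc
  rw [← hB₀] at hB ⊢
  have lie_xx : ⁅Q, dx K 2 Q⁆ = (-4 * α) • dx K 1 Q := h.lie_xx.trans (C_smul _ _)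
  have hz := h.zcr
  rw [show B = explB α β a Q T W₁ W₂ W₃ + B₀ by rw [hB₀]; abel, map_add,
    nab_explB h.pd_u h.eqA h.lie_x h.lie_xx hc, nab_of_pd_u h.eqA hB] at hz
  have hx : ∀ {S : Ser L}, (∀ k, pd K (Coord.u k) S = 0) →
      ∀ k, pd K (Coord.u k) (pd K Coord.x S) = 0 := fun hS k => by rw [pd_comm, hS, map_zero]
  have hl : ∀ {S : Ser L}, (∀ k, pd K (Coord.u k) S = 0) →
      ∀ k, pd K (Coord.u k) ⁅Q, S⁆ = 0 := fun hS k => by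
    rw [pd_lie, hS, h.pd_u, zero_lie, lie_zero, add_zero]
  have h4 := eq_zero_of_cubic (Y₀ := pd K Coord.x B₀)
    (Y₁ := pd K Coord.x W₁ + ⁅Q, B₀⁆ - pd K Coord.t Q)
    (Y₂ := pd K Coord.x W₂ + ⁅Q, W₁⁆) (Y₃ := pd K Coord.x W₃ + ⁅Q, W₂⁆) (hx hB)
    (fun k => by
      rw [map_sub, map_add, hx hc.pd_W₁, hl hB, pd_comm, h.pd_u, map_zero, add_zero, sub_zero])
    (fun k => by rw [map_add, hx hc.pd_W₂, hl hc.pd_W₁, add_zero])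
    (fun k => by rw [map_add, hx hc.pd_W₃, hl hc.pd_W₂, add_zero])
    (by linear_combination (norm := module) hz)
  obtain ⟨y₀, y₁, y₂, y₃⟩ := h4
  have e2 := hc.two_smul_eq lie_xx
  have e3 := hc.six_smul_eq h.lie_x lie_xx
  rw [y₂, smul_zero] at e2
  rw [y₃, smul_zero] at e3
  refine ⟨h.pd_u, hB, y₀, h.lie_x, lie_xx, ?_, ?_, ?_⟩
  · exact (smul_eq_zero.1 e3.symm).resolve_left (by norm_num)
  · linear_combination (norm := module) e2
  · rw [hc.pd_x_W₁] at y₁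
    linear_combination (norm := module) -y₁

theorem IsEvol.isZCR {B₀ T W₁ W₂ W₃ : Ser L} (h : IsEvol α β (a (Coord.u 0)) Q B₀)
    (hc : IsCoeffs α β (a (Coord.u 0)) Q T W₁ W₂ W₃) :
    nab a (w0 K • Q) (explB α β a Q T W₁ W₂ W₃ + B₀) =
      w0 K • pd K Coord.t Q + fordyF α β a • Q := by
  have e2 := hc.two_smul_eq h.lie_xx
  have e3 := hc.six_smul_eq h.lie_x h.lie_xx
  rw [h.lie_four] at e2
  rw [h.lie_lie, smul_zero, smul_eq_zero] at e3
  have e2' : pd K Coord.x W₂ + ⁅Q, W₁⁆ = 0 :=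
    (smul_eq_zero.1 (e2.trans (by abel))).resolve_left (by norm_num)
  rw [map_add, nab_explB h.pd_u rfl h.lie_x (h.lie_xx.trans (C_smul _ _).symm) hc,
    nab_of_pd_u rfl h.pd_u_B, h.pd_t, hc.pd_x_W₁, e2', e3.resolve_left (by norm_num), h.pd_x_B]
  module

end Equivalence

end EvolutionZCR

/-! ### Rigidity of the commutator identities -/

namespace EvolutionZCR

section Rigidity

/-- The derivatives of `q 0` span together with a central element a Lie algebra of dimension at most
four, unless `l` is one of the exceptional weights `c / 2`, `c`, `2 c`. -/
theorem rigidity {K : Type*} [Field K] [CharZero K] {M : Type*} [LieRing M] [LieAlgebra K M]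
    {c l a₀ : K} (D : M →ₗ[K] M) (hD : ∀ S T, D ⁅S, T⁆ = ⁅D S, T⁆ + ⁅S, D T⁆) {q : ℕ → M}
    (Dq : ∀ n, D (q n) = q (n + 1)) (h1 : ⁅q 0, ⁅q 0, q 1⁆⁆ = 0) (h2 : ⁅q 0, q 2⁆ = -c • q 1)
    (h3 : ⁅q 0, ⁅q 0, q 3⁆⁆ = 0)
    (h4 : (2 * c - 5 * l) • q 3 =
      ⁅q 1, q 3⁆ + (3 : K) • ⁅q 0, q 4⁆ - (10 * c * (c - l) * a₀) • q 1)
    {m z : M}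
    (hm : m = q 5 + (5 * l * a₀) • q 3 - (5 * c * (c - 5 / 2 * l) * a₀ * a₀) • q 1)
    (h5 : ⁅m, q 1⁆ + ⁅q 0, D m⁆ = z - c • m) (hz : ⁅q 0, z⁆ = 0) (hl : l ≠ c) (hl' : l ≠ 2 * c)
    (hl'' : c ≠ 2 * l) : q 3 = (-2 * c * a₀) • q 1 ∧ z = 0 := by
  obtain ⟨Z, hZ⟩ : ∃ Z, Z = ⁅q 0, q 1⁆ + c • q 0 := ⟨_, rfl⟩
  have DZ : D Z = 0 := by
    rw [hZ, map_add, hD, map_smul, Dq, Dq, lie_self, h2]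
    module
  -- Z is D-constant and commutes with q 0, so applying D repeatedly gives the rest.
  have Zq : ∀ n, ⁅Z, q n⁆ = 0 := by
    intro n
    induction n with
    | zero => rw [hZ, ← lie_skew, lie_add, h1, lie_smul, lie_self, smul_zero, add_zero, neg_zero]
    | succ n ih =>
      have := congrArg D ih
      rwa [hD, DZ, zero_lie, zero_add, Dq, map_zero] at this
  have B01 : ⁅q 0, q 1⁆ = Z - c • q 0 := by rw [hZ, add_sub_cancel_right]
  -- The goal is y = 0. The brackets of y, s = [q 0, y] and p = [q 2, y] with the first few q n are
  -- found by differentiating known ones.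
  obtain ⟨y, hy⟩ : ∃ y, y = q 3 + (2 * c * a₀) • q 1 := ⟨_, rfl⟩
  obtain ⟨y1, hy1⟩ : ∃ y1, y1 = D y := ⟨_, rfl⟩
  obtain ⟨y2, hy2⟩ : ∃ y2, y2 = D y1 := ⟨_, rfl⟩
  obtain ⟨y3, hy3⟩ : ∃ y3, y3 = D y2 := ⟨_, rfl⟩
  have q3 : q 3 = y - (2 * c * a₀) • q 1 := by rw [hy, add_sub_cancel_right]
  have q4 : q 4 = y1 - (2 * c * a₀) • q 2 := by
    rw [hy1, ← Dq 3, q3, map_sub, map_smul, Dq]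
  have q5 : q 5 = y2 - (2 * c * a₀) • q 3 := by
    rw [hy2, ← Dq 4, q4, map_sub, map_smul, Dq]
  have Zy : ⁅Z, y⁆ = 0 := by rw [hy, lie_add, lie_smul, Zq, Zq, smul_zero, add_zero]
  have Zy1 : ⁅Z, y1⁆ = 0 := by
    have := congrArg D Zy
    rwa [hD, DZ, zero_lie, zero_add, ← hy1, map_zero] at this
  have Zy2 : ⁅Z, y2⁆ = 0 := by
    have := congrArg D Zy1
    rwa [hD, DZ, zero_lie, zero_add, ← hy2, map_zero] at this
  obtain ⟨s, hs⟩ : ∃ s, s = ⁅q 0, y⁆ := ⟨_, rfl⟩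
  have B03 : ⁅q 0, q 3⁆ = s - (2 * c * a₀) • (Z - c • q 0) := by
    rw [q3, lie_sub, lie_smul, B01, hs]
  have qZ : ⁅q 0, Z⁆ = 0 := by rw [← lie_skew, Zq, neg_zero]
  have S0 : ⁅q 0, s⁆ = 0 := by
    rw [B03, lie_sub, lie_smul, lie_sub, lie_smul, lie_self, qZ] at h3
    simpa using h3
  have B12 : ⁅q 1, q 2⁆ = -c • q 2 - (s - (2 * c * a₀) • (Z - c • q 0)) := by
    have := congrArg D h2
    rw [hD, Dq, Dq, map_smul, Dq, zero_add, B03] at this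
    linear_combination (norm := module) this
  have Ds : D s = ⁅q 1, y⁆ + ⁅q 0, y1⁆ := by rw [hs, hD, Dq, ← hy1]
  have B13 : ⁅q 1, q 3⁆ = ⁅q 1, y⁆ := by rw [q3, lie_sub, lie_smul, lie_self, smul_zero, sub_zero]
  have T1 : ⁅q 1, y⁆ = -c • y - D s := by
    have := congrArg D B12
    rw [hD, Dq, Dq, lie_self, zero_add, map_sub, map_sub, map_smul, map_smul, map_sub, map_smul, DZ,
      Dq, Dq, B13, q3] at this
    linear_combination (norm := module) this
  have B04 : ⁅q 0, q 4⁆ = ⁅q 0, y1⁆ + (2 * c * c * a₀) • q 1 := by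
    rw [q4, lie_sub, lie_smul, h2]
    module
  -- Here `h4` enters. It makes y and s eigenvectors of ad (q 1), with eigenvalues l - c and l
  -- (`T2`, `T3`).
  have Ds' : D s = -l • y := by
    rw [B13, B04, q3] at h4
    refine (smul_right_inj (show (5 : K) ≠ 0 by norm_num)).1 ?_
    linear_combination (norm := module) -h4 + (3 : K) • Ds + (2 : K) • T1
  have T2 : ⁅q 1, y⁆ = (l - c) • y := by
    rw [T1, Ds']
    module
  have T2' : ⁅q 0, y1⁆ = (c - 2 * l) • y := by
    linear_combination (norm := module) -Ds + Ds' - T2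
  have T3 : ⁅q 1, s⁆ = l • s := by
    have := congrArg D S0
    rw [hD, Dq, Ds', lie_smul, ← hs, map_zero] at this
    linear_combination (norm := module) this
  have T4 : ⁅q 2, s⁆ = (-l * c) • y := by
    have := congrArg D T3
    rw [hD, Dq, map_smul, Ds', lie_smul, T2] at this
    linear_combination (norm := module) this
  obtain ⟨p, hp⟩ : ∃ p, p = ⁅q 2, y⁆ := ⟨_, rfl⟩
  have T5 : ⁅q 1, y1⁆ = (l - c) • y1 - p := by
    have := congrArg D T2
    rw [hD, Dq, map_smul, ← hy1, ← hp] at this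
    linear_combination (norm := module) this
  have T6 : ⁅y, s⁆ = (2 * c * a₀ * l) • s + l • p - (l * c) • y1 := by
    have := congrArg D T4
    rw [hD, Dq, map_smul, Ds', lie_smul, ← hy1, ← hp, q3, sub_lie, smul_lie, T3] at this
    linear_combination (norm := module) this
  have T7 : ⁅q 0, y2⁆ = (2 * c - 3 * l) • y1 + p := by
    have := congrArg D T2'
    rw [hD, Dq, map_smul, ← hy1, ← hy2, zero_add, T5] at this
    linear_combination (norm := module) this
  have T8 : (2 : K) • ⁅q 2, y1⁆ = (l - c) • y2 - ⁅q 1, y2⁆ + (2 * c * a₀ * (l - c)) • y := by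
    have := congrArg D T5
    rw [hD, Dq, map_sub, map_smul, hp, hD, ← hy1, ← hy2, Dq, q3, sub_lie, lie_self, smul_lie,
      T2] at this
    linear_combination (norm := module) this
  have T9 : ⁅q 0, y3⁆ = (c - 2 * l) • y2 - ⁅q 2, y1⁆ - (2 : K) • ⁅q 1, y2⁆ := by
    have h := congrArg D T2'
    rw [hD, Dq, map_smul, ← hy1, ← hy2, zero_add] at h
    have := congrArg D h
    rw [map_add, hD, hD, Dq, Dq, map_smul, ← hy2, ← hy3] at this
    linear_combination (norm := module) this
  have hm' : m = y2 + ((5 * l - 2 * c) * a₀) • y + (c * (5 / 2 * l - c) * a₀ * a₀) • q 1 := by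
    rw [hm, q5, q3]
    module
  have Dm : D m = y3 + ((5 * l - 2 * c) * a₀) • y1 + (c * (5 / 2 * l - c) * a₀ * a₀) • q 2 := by
    rw [hm', map_add, map_add, map_smul, map_smul, ← hy1, ← hy3, Dq]
  -- The compatibility condition `h5` with the flow m supplies what the commutator identities alone
  -- have not determined.
  have T10 : ⁅q 1, y2⁆ = (c - l) • (y2 + ((6 * l - 2 * c) * a₀) • y) - (2 / 5 : K) • z := by
    rw [Dm, ← lie_skew, hm'] at h5
    simp only [lie_add, lie_smul, T2, T2', h2, T9, lie_self] at h5
    linear_combination (norm := module) (-2 / 5 : K) • h5 - (1 / 5 : K) • T8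
  have T11 : ⁅q 1, p⁆ = (2 * l - 2 * c) • p - (l * c) • y1 + (2 * c * a₀ * (l - c)) • s := by
    rw [hp, leibniz_lie, B12, T2, sub_lie, sub_lie, smul_lie, smul_lie, sub_lie, smul_lie, Zy,
      lie_smul, ← hp, ← hs, ← lie_skew, T6]
    module
  -- Applying ad (q 0) to `T10` removes z and leaves this relation times 6(l - c).
  have T12 : p = (l - c) • y1 - (l * a₀) • s := by
    have := congrArg (fun x => ⁅q 0, x⁆) T10
    simp only [lie_sub, lie_smul, lie_add, hz] at this
    rw [leibniz_lie, B01, sub_lie, smul_lie, Zy2, T7, lie_add, lie_smul, T5, T11, ← hs] at this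
    refine (smul_right_inj (show 6 * (l - c) ≠ 0 from
      mul_ne_zero (by norm_num) (sub_ne_zero.2 hl))).1 ?_
    linear_combination (norm := module) this
  -- Substituting `T12` into `T11` gives the claim times (2l - c)(l - 2c).
  have T13 : y1 = a₀ • s := by
    have h := T11
    rw [T12, lie_sub, lie_smul, lie_smul, T5, T3, T12] at h
    have : ((2 * l - c) * (l - 2 * c)) • (y1 - a₀ • s) = 0 := by
      linear_combination (norm := module) -h
    rw [smul_eq_zero, mul_eq_zero, sub_eq_zero, sub_eq_zero, sub_eq_zero] at this
    rcases this with (h | h) | h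
    · exact absurd h.symm hl''
    · exact absurd h hl'
    · exact h
  -- Now [q 0, y1] = a₀[q 0, s] = 0, whereas `T2'` says that it is (c - 2l)y.
  have hy0 : y = 0 := by
    rw [T13, lie_smul, S0, smul_zero, eq_comm, smul_eq_zero, sub_eq_zero] at T2'
    exact T2'.resolve_left hl''
  have hq3 : q 3 = (-2 * c * a₀) • q 1 := by
    rw [q3, hy0]
    module
  refine ⟨hq3, ?_⟩
  rw [hy0, map_zero] at hy1
  rw [hy1, map_zero] at hy2
  rw [hy2, map_zero] at hy3
  rw [Dm, hm', hy0, hy1, hy2, hy3] at h5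
  simp only [zero_add, smul_zero, smul_lie, lie_self, lie_smul, h2] at h5
  linear_combination (norm := module) -h5

end Rigidity

end EvolutionZCR

/-! ### Consequences for Q and generation by its jet at the point -/

namespace EvolutionZCR

open Ser

section Structure

variable {K : Type*} [Field K] {L : Type*} [LieRing L] [LieAlgebra K L] {α β : K}
  {a₀ : K}

theorem dx_lie_of_pd_x {S T : Ser L} (hT : pd K Coord.x T = 0) (n : ℕ) :
    dx K n ⁅S, T⁆ = ⁅dx K n S, T⁆ := by
  induction n with
  | zero => rfl
  | succ n ih => rw [dx_succ, ih, pd_lie, hT, lie_zero, add_zero, pd_x_dx]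

theorem dx_add (n : ℕ) (S T : Ser L) : dx K n (S + T) = dx K n S + dx K n T :=
  iterate_map_add (pd K Coord.x) n S T

theorem dx_smul (n : ℕ) (r : K) (S : Ser L) : dx K n (r • S) = r • dx K n S := by
  induction n with
  | zero => rfl
  | succ n ih => rw [dx_succ, ih, map_smul, pd_x_dx]

theorem dx_dx (m n : ℕ) (S : Ser L) : dx K m (dx K n S) = dx K (m + n) S :=
  (Function.iterate_add_apply _ m n S).symm

theorem pd_t_dx (n : ℕ) (S : Ser L) : pd K Coord.t (dx K n S) = dx K n (pd K Coord.t S) := by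
  induction n with
  | zero => rfl
  | succ n ih => rw [dx_succ, pd_comm, ih, pd_x_dx]

theorem IsEvol.pd_x_constant {Q B₀ Z : Ser L} (h : IsEvol α β a₀ Q B₀)
    (hZ : Z = ⁅Q, dx K 1 Q⁆ + (4 * α) • Q) : pd K Coord.x Z = 0 := by
  rw [hZ, map_add, pd_lie, pd_x_dx, map_smul, h.lie_xx]
  change ⁅dx K 1 Q, dx K 1 Q⁆ + _ + _ • dx K 1 Q = 0
  rw [lie_self]
  module

variable [CharZero K] in
-- `rigidity` is applied with c = 4α and l = 2(4α - β)/5. The exceptional cases l = c, l = 2c, c =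
-- 2l are 6α + β = 0, 16α + β = 0, α + β = 0. Its hypothesis `h5` is the t-derivative of the
-- definition of Z, with z = Z_t - [Z, B₀].
theorem IsEvol.rigid {Q B₀ : Ser L} (h : IsEvol α β a₀ Q B₀) (h1 : α + β ≠ 0)
    (h2 : 6 * α + β ≠ 0) (h3 : 16 * α + β ≠ 0) :
    dx K 3 Q = (-8 * α * a₀) • dx K 1 Q ∧
      pd K Coord.t (⁅Q, dx K 1 Q⁆ + (4 * α) • Q) = ⁅⁅Q, dx K 1 Q⁆ + (4 * α) • Q, B₀⁆ := by
  obtain ⟨m, hm⟩ : ∃ m, m = dx K 5 Q + (5 * (2 / 5 * (4 * α - β)) * a₀) • dx K 3 Q -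
    (5 * (4 * α) * (4 * α - 5 / 2 * (2 / 5 * (4 * α - β))) * a₀ * a₀) • dx K 1 Q := ⟨_, rfl⟩
  obtain ⟨Z, hZ⟩ : ∃ Z, Z = ⁅Q, dx K 1 Q⁆ + (4 * α) • Q := ⟨_, rfl⟩
  have ht : pd K Coord.t Q = m + ⁅Q, B₀⁆ := by
    rw [h.pd_t, hm]
    module
  have ht1 : pd K Coord.t (dx K 1 Q) = pd K Coord.x m + ⁅dx K 1 Q, B₀⁆ := by
    rw [pd_t_dx, ht, dx_add, dx_lie_of_pd_x h.pd_x_B]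
    rfl
  have hZx : pd K Coord.x Z = 0 := h.pd_x_constant hZ
  have hQZ : ⁅Q, Z⁆ = 0 := by
    rw [hZ, lie_add, h.lie_x, lie_smul, lie_self, smul_zero, add_zero]
  have hqZ : ∀ n, ⁅dx K n Q, Z⁆ = 0 := fun n => by
    rw [← dx_lie_of_pd_x hZx, hQZ]
    exact iterate_map_zero (pd K Coord.x) n
  have hmZ : ⁅m, Z⁆ = 0 := by
    rw [hm, sub_lie, add_lie, smul_lie, smul_lie, hqZ, hqZ, hqZ]
    simp
  have hz : ⁅Q, pd K Coord.t Z - ⁅Z, B₀⁆⁆ = 0 := by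
    have := congrArg (pd K Coord.t) hQZ
    rw [pd_lie, ht, add_lie, hmZ, map_zero, zero_add] at this
    rw [lie_sub, leibniz_lie Q Z, hQZ, zero_lie, zero_add, ← lie_skew Z, sub_neg_eq_add, add_comm]
    exact this
  have h5 : ⁅m, dx K 1 Q⁆ + ⁅dx K 0 Q, pd K Coord.x m⁆ =
      (pd K Coord.t Z - ⁅Z, B₀⁆) - (4 * α) • m := by
    have := congrArg (pd K Coord.t) hZ
    rw [map_add, map_smul, pd_lie, ht, ht1, add_lie, lie_add, smul_add] at this
    have j := leibniz_lie Q (dx K 1 Q) B₀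
    have e : ⁅Z, B₀⁆ = ⁅⁅Q, dx K 1 Q⁆, B₀⁆ + (4 * α) • ⁅Q, B₀⁆ := by rw [hZ, add_lie, smul_lie]
    rw [← lie_skew (dx K 1 Q) ⁅Q, B₀⁆] at j
    rw [this, e, dx_zero]
    linear_combination (norm := module) -j
  have key := rigidity (c := 4 * α) (l := 2 / 5 * (4 * α - β)) (a₀ := a₀) (pd K Coord.x)
    (pd_lie _) (q := fun n => dx K n Q) (fun n => pd_x_dx n Q) h.lie_x
    (by
      refine h.lie_xx.trans ?_
      congr 1
      ring) h.lie_lie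
    (by
      have := h.lie_four
      simp only [dx_zero]
      linear_combination (norm := module) this)
    hm h5 hz
    (fun e => h2 (by linear_combination (-5 / 2 : K) * e))
    (fun e => h3 (by linear_combination (-5 / 2 : K) * e))
    (fun e => h1 (by linear_combination (5 / 4 : K) * e))
  rw [← hZ]
  refine ⟨key.1.trans ?_, sub_eq_zero.1 key.2⟩
  congr 1
  ring

/-- The series with coefficients in a Lie subalgebra. -/
def Valued (V : LieSubalgebra K L) (S : Ser L) : Prop := ∀ m, S m ∈ V

variable {V : LieSubalgebra K L} {S T : Ser L}

theorem Valued.add (hS : Valued V S) (hT : Valued V T) : Valued V (S + T) :=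
  fun m => V.add_mem (hS m) (hT m)

theorem Valued.sub (hS : Valued V S) (hT : Valued V T) : Valued V (S - T) :=
  fun m => V.sub_mem (hS m) (hT m)

theorem Valued.smul (hS : Valued V S) (r : K) : Valued V (r • S) :=
  fun m => V.smul_mem r (hS m)

theorem Valued.poly_smul (hS : Valued V S) (f : MvPolynomial Coord K) : Valued V (f • S) := by
  intro m
  rw [polySMul_apply]
  exact V.toSubmodule.sum_mem fun q _ => V.smul_mem _ (hS q.2)

theorem Valued.lie (hS : Valued V S) (hT : Valued V T) : Valued V ⁅S, T⁆ := by
  intro m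
  rw [lie_apply]
  exact V.toSubmodule.sum_mem fun q _ => V.lie_mem (hS q.1) (hT q.2)

variable [CharZero K] in
theorem valued_coeffs {Q T W₁ W₂ W₃ : Ser L} (hc : IsCoeffs α β a₀ Q T W₁ W₂ W₃)
    (hQ : ∀ k, Valued V (dx K k Q)) : Valued V T ∧ Valued V W₁ ∧ Valued V W₂ ∧ Valued V W₃ := by
  have hQ0 : Valued V Q := hQ 0
  refine ⟨?_, ?_, ?_, ?_⟩
  · rw [show T = (1 / 2 : K) • (T + T) by module, hc.T_eq]
    exact ((hQ0.poly_smul _).sub (hQ0.lie (hQ 1))).smul _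
  · rw [hc.W₁_eq]
    exact ((hQ0.poly_smul _).add (hQ 4)).add ((hQ 2).poly_smul _)
  · rw [show W₂ = (1 / 2 : K) • (W₂ + W₂) by module, hc.W₂_eq]
    exact ((((hQ0.poly_smul _).sub ((hQ 2).poly_smul _)).add (hQ0.lie (hQ 3))).add
      ((hQ0.lie (hQ 1)).poly_smul _)).smul _
  · rw [show W₃ = (1 / 3 : K) • (W₃ + W₃ + W₃) by module, hc.W₃_eq]
    exact ((hQ0.poly_smul _).sub ((hQ0.lie (hQ 1)).poly_smul _)).smul _

variable [CharZero K] in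
theorem valued_explB {a : Coord → K} {Q T W₁ W₂ W₃ : Ser L}
    (hc : IsCoeffs α β a₀ Q T W₁ W₂ W₃)
    (hQ : ∀ k, Valued V (dx K k Q)) : Valued V (explB α β a Q T W₁ W₂ W₃) := by
  have hQ0 : Valued V Q := hQ 0
  obtain ⟨hT, h1, h2, h3⟩ := valued_coeffs hc hQ
  refine Valued.add (Valued.add (Valued.add (Valued.add (Valued.add (Valued.add (Valued.sub ?_ ?_)
    ?_) ?_) ?_) ?_) ?_) ?_
  · exact hQ0.poly_smul _
  · exact (hQ 1).poly_smul _
  · exact (((hQ 2).add ((hQ0.lie (hQ 1)).poly_smul _)).add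
      ((hQ0.poly_smul _).poly_smul _)).poly_smul _
  · exact (((((hQ 1).poly_smul _).poly_smul _).sub (hQ 3)).sub
      (((hQ 1).poly_smul _).poly_smul _)).poly_smul _
  · exact (hT.poly_smul _).poly_smul _
  · exact h1.poly_smul _
  · exact (h2.poly_smul _).poly_smul _
  · exact ((h3.poly_smul _).poly_smul _).poly_smul _

theorem explB_apply_of_noU {a : Coord → K} {Q T W₁ W₂ W₃ : Ser L} {m : Mon} (hm : NoU m) :
    explB α β a Q T W₁ W₂ W₃ m = a (Coord.u 4) • Q m - a (Coord.u 3) • dx K 1 Q m +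
      a (Coord.u 2) • (dx K 2 Q m + ((8 * α - 2 * β) * a (Coord.u 0)) • Q m) -
      a (Coord.u 1) • (dx K 3 Q m + ((8 * α - 2 * β) * a (Coord.u 0)) • dx K 1 Q m) +
      (a (Coord.u 1) * a (Coord.u 1)) • T m := by
  have hw : ∀ S : Ser L, (w0 K • S) m = 0 := fun S =>
    X_smul_apply_of_eq_zero (hm 0 (Nat.zero_le _)) S
  simp only [explB, Ser.add_apply, Ser.sub_apply, uc_smul_apply_of_noU a _ hm, hw, C_smul,
    Ser.smul_apply]
  module

variable [CharZero K] in
/-- If `B` vanishes where it is normalized to, then the coefficients of `Q` and `B₀` lie in any Lie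
subalgebra that contains the derivatives of `Q` at the point. -/
theorem IsEvol.valued {a : Coord → K} {Q B₀ T W₁ W₂ W₃ : Ser L}
    (h : IsEvol α β (a (Coord.u 0)) Q B₀) (hc : IsCoeffs α β (a (Coord.u 0)) Q T W₁ W₂ W₃)
    (hB : ∀ m, NoU m → m Coord.x = 0 → (explB α β a Q T W₁ W₂ W₃ + B₀) m = 0)
    (h0 : ∀ k, dx K k Q 0 ∈ V) : (∀ k, Valued V (dx K k Q)) ∧ Valued V B₀ := by
  -- B₀ depends on t alone, and at x = x_a, u = a the normalization of `B` equates it with minus the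
  -- explicit part. That involves coefficients of Q only up to the same monomial.
  have hB₀ : ∀ m, (∀ q, q ≤ m → ∀ k, dx K k Q q ∈ V) → B₀ m ∈ V := by
    intro m hq
    have hQ : ∀ k, dx K k Q m ∈ V := hq m le_rfl
    by_cases hm : NoU m
    · by_cases hx : m Coord.x = 0
      · have hT : T m ∈ V := by
          have e : T m = (1 / 2 : K) • (T + T) m := by
            rw [Ser.add_apply]
            module
          rw [e, hc.T_eq, Ser.sub_apply, C_smul, Ser.smul_apply, lie_apply]
          refine V.smul_mem _ (V.sub_mem (V.smul_mem _ (hQ 0)) ?_)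
          refine V.toSubmodule.sum_mem fun r hr => ?_
          rw [Finset.HasAntidiagonal.mem_antidiagonal] at hr
          exact V.lie_mem (hq _ (hr ▸ le_self_add) 0) (hq _ (hr ▸ le_add_self) 1)
        have := hB m hm hx
        rw [Ser.add_apply, add_comm, add_eq_zero_iff_eq_neg, explB_apply_of_noU hm] at this
        rw [this]
        refine V.neg_mem (V.add_mem (V.sub_mem (V.add_mem (V.sub_mem ?_ ?_) ?_) ?_) ?_)
        · exact V.smul_mem _ (hQ 0)
        · exact V.smul_mem _ (hQ 1)
        · exact V.smul_mem _ (V.add_mem (hQ 2) (V.smul_mem _ (hQ 0)))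
        · exact V.smul_mem _ (V.add_mem (hQ 3) (V.smul_mem _ (hQ 1)))
        · exact V.smul_mem _ hT
      · rw [coeff_eq_zero_of_pd h.pd_x_B hx]
        exact V.zero_mem
    · have : ∃ k, m (Coord.u k) ≠ 0 := by
        by_contra! hcon
        exact hm fun k _ => hcon k
      obtain ⟨k, hk⟩ := this
      rw [coeff_eq_zero_of_pd (h.pd_u_B k) hk]
      exact V.zero_mem
  have hQ : ∀ m, ∀ k, dx K k Q m ∈ V := by
    intro m
    induction m using WellFoundedLT.induction with
    | ind m ih =>
      intro k
      by_cases hm : m = 0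
      · rw [hm]
        exact h0 k
      · obtain ⟨c, hc0⟩ := Finsupp.ne_iff.1 hm
        have ha : m - Finsupp.single c 1 + Finsupp.single c 1 = m := by
          refine tsub_add_cancel_of_le ?_
          rw [Finsupp.single_le_iff]
          exact Nat.one_le_iff_ne_zero.2 hc0
        obtain ⟨m', hm'⟩ : ∃ m', m' = m - Finsupp.single c 1 := ⟨_, rfl⟩
        rw [← hm'] at ha
        have hlt : m' < m := by
          rw [← ha]
          exact lt_add_of_pos_right _ (pos_iff_ne_zero.2 (by simp))
        have key : pd K c (dx K k Q) m' ∈ V → dx K k Q m ∈ V := fun hp => by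
          rw [pd_apply, ha, ← Nat.cast_smul_eq_nsmul K] at hp
          exact (V.toSubmodule.smul_mem_iff (Nat.cast_ne_zero.2 (Nat.succ_ne_zero _))).1 hp
        apply key
        -- A derivative by x raises k. A derivative by t is replaced through the evolution equation
        -- by x-derivatives and a bracket with B₀, all at smaller monomials.
        rcases c with _ | _ | j
        · rw [pd_x_dx]
          exact ih m' hlt _
        · rw [pd_t_dx, h.pd_t, dx_add, dx_add, dx_add, dx_smul, dx_smul, dx_dx, dx_dx, dx_dx,
            dx_lie_of_pd_x h.pd_x_B]
          refine V.add_mem (V.add_mem (V.add_mem ?_ ?_) ?_) ?_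
          · exact V.smul_mem _ (ih m' hlt _)
          · exact ih m' hlt _
          · exact V.smul_mem _ (ih m' hlt _)
          · rw [lie_apply]
            refine V.toSubmodule.sum_mem fun r hr => ?_
            rw [Finset.HasAntidiagonal.mem_antidiagonal] at hr
            have hr1 : r.1 ≤ m' := hr ▸ le_self_add
            have hr2 : r.2 ≤ m' := hr ▸ le_add_self
            exact V.lie_mem (ih _ (hr1.trans_lt hlt) _)
              (hB₀ _ fun q hq => ih q ((hq.trans hr2).trans_lt hlt))
        · rw [pd_dx (h.pd_u j)]
          exact V.zero_mem
  exact ⟨fun k m => hQ m k, fun m => hB₀ m fun q _ k => hQ q k⟩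

end Structure

end EvolutionZCR

/-! ### Four spanning elements and their brackets -/

namespace EvolutionZCR

open Ser

section Relations

variable {K : Type*} [CommRing K] {L : Type*} [LieRing L] [LieAlgebra K L]

/-- The bracket relations between generators `e₀`, `e₁`, `e₂` and a central element `z`. -/
structure Relations (c d : K) (e₀ e₁ e₂ z : L) : Prop where
  central : ∀ v : L, ⁅z, v⁆ = 0
  lie₀₁ : ⁅e₀, e₁⁆ = z - c • e₀
  lie₀₂ : ⁅e₀, e₂⁆ = -(c • e₁)
  lie₁₂ : ⁅e₁, e₂⁆ = d • z - c • e₂ - (c * d) • e₀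

variable {c d : K} {e₀ e₁ e₂ z : L}

theorem Relations.lie_eq (h : Relations c d e₀ e₁ e₂ z) (x₀ x₁ x₂ x₃ y₀ y₁ y₂ y₃ : K) :
    ⁅x₀ • e₀ + x₁ • e₁ + x₂ • e₂ + x₃ • z, y₀ • e₀ + y₁ • e₁ + y₂ • e₂ + y₃ • z⁆ =
      (-c * (x₀ * y₁ - x₁ * y₀) - c * d * (x₁ * y₂ - x₂ * y₁)) • e₀ +
      (-c * (x₀ * y₂ - x₂ * y₀)) • e₁ + (-c * (x₁ * y₂ - x₂ * y₁)) • e₂ +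
      ((x₀ * y₁ - x₁ * y₀) + d * (x₁ * y₂ - x₂ * y₁)) • z := by
  have hc : ∀ v, ⁅v, z⁆ = 0 := fun v => by rw [← lie_skew, h.central, neg_zero]
  have h10 : ⁅e₁, e₀⁆ = -(z - c • e₀) := by rw [← lie_skew, h.lie₀₁]
  have h20 : ⁅e₂, e₀⁆ = -(-(c • e₁)) := by rw [← lie_skew, h.lie₀₂]
  have h21 : ⁅e₂, e₁⁆ = -(d • z - c • e₂ - (c * d) • e₀) := by rw [← lie_skew, h.lie₁₂]
  simp only [add_lie, lie_add, smul_lie, lie_smul, lie_self, h.lie₀₁, h.lie₀₂, h.lie₁₂, h10, h20,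
    h21, h.central, hc]
  module

/-- The Lie subalgebra spanned by `e₀`, `e₁`, `e₂`, `z`. -/
def Relations.subalgebra (h : Relations c d e₀ e₁ e₂ z) : LieSubalgebra K L where
  carrier := {v | ∃ x₀ x₁ x₂ x₃ : K, v = x₀ • e₀ + x₁ • e₁ + x₂ • e₂ + x₃ • z}
  add_mem' := by
    rintro _ _ ⟨x₀, x₁, x₂, x₃, rfl⟩ ⟨y₀, y₁, y₂, y₃, rfl⟩
    refine ⟨x₀ + y₀, x₁ + y₁, x₂ + y₂, x₃ + y₃, ?_⟩
    module
  zero_mem' := ⟨0, 0, 0, 0, by module⟩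
  smul_mem' := by
    rintro r _ ⟨x₀, x₁, x₂, x₃, rfl⟩
    refine ⟨r * x₀, r * x₁, r * x₂, r * x₃, ?_⟩
    module
  lie_mem' := by
    rintro _ _ ⟨x₀, x₁, x₂, x₃, rfl⟩ ⟨y₀, y₁, y₂, y₃, rfl⟩
    exact ⟨_, _, _, _, h.lie_eq x₀ x₁ x₂ x₃ y₀ y₁ y₂ y₃⟩

theorem rank_le_four [StrongRankCondition K]
    (hs : ∀ v : L, ∃ x₀ x₁ x₂ x₃ : K, v = x₀ • e₀ + x₁ • e₁ + x₂ • e₂ + x₃ • z) :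
    Module.rank K L ≤ 4 := by
  classical
  have hf : Submodule.span K (({e₀, e₁, e₂, z} : Finset L) : Set L) = ⊤ := by
    refine Submodule.eq_top_iff'.2 fun v => ?_
    obtain ⟨x₀, x₁, x₂, x₃, rfl⟩ := hs v
    have hx : ∀ e ∈ ({e₀, e₁, e₂, z} : Finset L), ∀ x : K,
        x • e ∈ Submodule.span K (({e₀, e₁, e₂, z} : Finset L) : Set L) := fun e he x =>
      Submodule.smul_mem _ _ (Submodule.subset_span he)
    exact add_mem (add_mem (add_mem (hx _ (by simp) _) (hx _ (by simp) _)) (hx _ (by simp) _))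
      (hx _ (by simp) _)
  rw [← rank_top, ← hf]
  refine (rank_span_finset_le _).trans ?_
  exact_mod_cast Finset.card_le_four

/-- For c = 0 all brackets are multiples of the central element, so the algebra is nilpotent of
class at most two. -/
theorem Relations.isNilpotent (h : Relations 0 d e₀ e₁ e₂ z)
    (hs : ∀ v : L, ∃ x₀ x₁ x₂ x₃ : K, v = x₀ • e₀ + x₁ • e₁ + x₂ • e₂ + x₃ • z) :
    LieRing.IsNilpotent L := by
  have h2 : ∀ u v w : L, ⁅u, ⁅v, w⁆⁆ = 0 := by
    intro u v w
    obtain ⟨x₀, x₁, x₂, x₃, rfl⟩ := hs v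
    obtain ⟨y₀, y₁, y₂, y₃, rfl⟩ := hs w
    rw [h.lie_eq, lie_add, lie_smul, ← lie_skew u z, h.central]
    simp
  refine (LieModule.isNilpotent_iff K L L).2 ⟨2, ?_⟩
  rw [LieModule.lowerCentralSeries_succ, LieModule.lowerCentralSeries_succ,
    LieModule.lowerCentralSeries_zero, LieSubmodule.lie_eq_bot_iff]
  intro u _ v hv
  have hle : ⁅(⊤ : LieIdeal K L), (⊤ : LieSubmodule K L L)⁆ ≤ LieModule.maxTrivSubmodule K L L :=
    LieSubmodule.lieSpan_le.2 (by
      rintro _ ⟨v, w, rfl⟩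
      exact (LieModule.mem_maxTrivSubmodule K _ _ _).2 fun u => h2 u v w)
  exact (LieModule.mem_maxTrivSubmodule K _ _ _).1 (hle hv) u

end Relations

section Fordy

variable {K : Type*} [Field K] [CharZero K] (α β : K) (a : (fordy α β).Prolongation)

/-- The `x`-derivatives of `∂A/∂u_0` at the point `a`, as elements of `𝔽^0`. -/
noncomputable def jet (n : ℕ) : Fd (fordy α β) a 0 :=
  dx K n (pd K (Coord.u 0) (genA (Fd.of (fordy α β) a 0) : Ser _)) 0

theorem Ser.lie_apply_zero {L : Type*} [LieRing L] (S T : Ser L) : ⁅S, T⁆ 0 = ⁅S 0, T 0⁆ := by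
  rw [lie_apply]
  simp

variable {α β}

/-- The identities for Q, evaluated at the point, are the bracket relations, with z the value of Z
there. Rigidity reduces all higher x-derivatives to Q_x and Q_xx, and generation by the jet gives
spanning. -/
theorem exists_relations (h1 : α + β ≠ 0) (h2 : 6 * α + β ≠ 0) (h3 : 16 * α + β ≠ 0) :
    ∃ z, Relations (4 * α) (8 * α * a (Coord.u 0)) (jet α β a 0) (jet α β a 1) (jet α β a 2) z ∧
      ∀ v : Fd (fordy α β) a 0, ∃ x₀ x₁ x₂ x₃ : K,
        v = x₀ • jet α β a 0 + x₁ • jet α β a 1 + x₂ • jet α β a 2 + x₃ • z := by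
  have h := isZCR_zero α β a
  obtain ⟨A, hA⟩ : ∃ A : Ser (Fd (fordy α β) a 0), A = genA (Fd.of (fordy α β) a 0) := ⟨_, rfl⟩
  obtain ⟨B, hB⟩ : ∃ B : Ser (Fd (fordy α β) a 0), B = genB (Fd.of (fordy α β) a 0) := ⟨_, rfl⟩
  rw [← hA, ← hB] at h
  have hgA : ∀ m hm, Fd.of (fordy α β) a 0 (Gen.A m hm) = A m := fun m hm => by
    rw [hA]
    exact (genA_of _ hm).symm
  have hgB : ∀ m hm, Fd.of (fordy α β) a 0 (Gen.B m hm) = B m := fun m hm => by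
    rw [hB]
    exact (genB_of _ hm).symm
  have hAu : ∀ k, 1 ≤ k → pd K (Coord.u k) A = 0 := fun k hk =>
    Ser.pd_eq_zero (n := 1) hk fun m hm => by rw [hA]; exact genA_of_not _ hm
  have hred := h.isReduced hAu h2
  obtain ⟨Q, hQ⟩ : ∃ Q, Q = pd K (Coord.u 0) A := ⟨_, rfl⟩
  have hj : ∀ n, jet α β a n = dx K n Q 0 := fun n => by rw [hQ, hA]; rfl
  rw [← hQ] at hred
  obtain ⟨T, W₁, W₂, W₃, hc⟩ := exists_isCoeffs α β (a (Coord.u 0)) hred.pd_u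
  have hev := hred.isEvol hc
  have hrig := (hev.rigid h1 h2 h3).1
  obtain ⟨B₀, hB₀⟩ : ∃ B₀, B₀ = B - explB α β a Q T W₁ W₂ W₃ := ⟨_, rfl⟩
  rw [← hB₀] at hev
  have hBe : explB α β a Q T W₁ W₂ W₃ + B₀ = B := by rw [hB₀]; abel
  obtain ⟨Z, hZ⟩ : ∃ Z, Z = ⁅Q, dx K 1 Q⁆ + (4 * α) • Q := ⟨_, rfl⟩
  have hZx : pd K Coord.x Z = 0 := hev.pd_x_constant hZ
  have hQZ : ⁅Q, Z⁆ = 0 := by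
    rw [hZ, lie_add, hev.lie_x, lie_smul, lie_self, smul_zero, add_zero]
  -- Z is of the same kind as A_{u_1u_1} before, so the same argument makes its coefficients
  -- central.
  have hZc : IsConstant K A Z := by
    refine ⟨fun k => ?_, hZx, ?_⟩
    · rw [hZ, map_add, map_smul, pd_lie, pd_dx (hev.pd_u k), hev.pd_u k]
      simp
    · rw [hred.eqA, smul_lie, hQZ, smul_zero]
  have hcen : ∀ v : Fd (fordy α β) a 0, ⁅Z 0, v⁆ = 0 := by
    refine Fd.lie_eq_zero_of_gen ?_
    rintro (⟨m', hm'⟩ | ⟨m', hm'⟩)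
    · rw [hgA, ← lie_skew, neg_eq_zero]
      exact (h.coeff_lie_eq_zero h.pd_one hZc m' 0).1
    · rw [hgB, ← lie_skew, neg_eq_zero]
      exact (h.coeff_lie_eq_zero h.pd_one hZc m' 0).2
  have hrel : Relations (4 * α) (8 * α * a (Coord.u 0)) (jet α β a 0) (jet α β a 1) (jet α β a 2)
      (Z 0) := by
    have r1 := congrFun hev.lie_xx 0
    have r2 := congrFun (congrArg (pd K Coord.x) hev.lie_xx) 0
    rw [lie_apply_zero] at r1
    rw [pd_lie, map_smul, pd_x_dx, pd_x_dx, hrig] at r2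
    rw [lie_smul, Ser.add_apply, Ser.smul_apply, Ser.smul_apply, lie_apply_zero, lie_apply_zero] at r2
    have r0 : Z 0 = ⁅Q 0, dx K 1 Q 0⁆ + (4 * α) • Q 0 := by
      rw [hZ, Ser.add_apply, lie_apply_zero]
      rfl
    refine ⟨hcen, ?_, ?_, ?_⟩
    · rw [hj, hj, r0]
      change ⁅Q 0, _⁆ = _ - _ • Q 0
      module
    · rw [hj, hj, hj]
      refine r1.trans ?_
      rw [Ser.smul_apply]
      module
    · rw [hj, hj, hj, r0]
      change _ = _ - _ - _ • Q 0
      change ⁅dx K 1 Q 0, dx K 2 Q 0⁆ + _ = _ at r2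
      linear_combination (norm := module) r2
  refine ⟨Z 0, hrel, ?_⟩
  have hd : ∀ n, dx K n Q 0 ∈ hrel.subalgebra := by
    have aux : ∀ n, dx K n Q 0 ∈ hrel.subalgebra ∧ dx K (n + 1) Q 0 ∈ hrel.subalgebra ∧
        dx K (n + 2) Q 0 ∈ hrel.subalgebra := by
      intro n
      induction n with
      | zero =>
        rw [← hj, ← hj, ← hj]
        exact ⟨⟨1, 0, 0, 0, by module⟩, ⟨0, 1, 0, 0, by module⟩, ⟨0, 0, 1, 0, by module⟩⟩
      | succ n ih =>
        refine ⟨ih.2.1, ih.2.2, ?_⟩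
        have : dx K (n + 1 + 2) Q = (-8 * α * a (Coord.u 0)) • dx K (n + 1) Q := by
          rw [← dx_dx n 1 Q, ← dx_smul, ← hrig, dx_dx]
        rw [this]
        exact hrel.subalgebra.smul_mem _ ih.2.1
    exact fun n => (aux n).1
  obtain ⟨hQv, hBv⟩ := hev.valued hc (fun m hm hx => by rw [hBe]; exact h.normB m hm hx) hd
  intro v
  refine Fd.mem_of_gen hrel.subalgebra ?_ v
  rintro (⟨m, hm⟩ | ⟨m, hm⟩)
  · rw [hgA, hred.eqA]
    exact Valued.poly_smul (hQv 0) _ m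
  · rw [hgB, ← hBe]
    exact (valued_explB hc hQv).add hBv m

end Fordy

end EvolutionZCR

/-! ### Exponential series exp(t ad e) exp(x ad g) v -/

namespace EvolutionZCR

open Ser

section ExpSeries

variable {K : Type*} [Field K] {M : Type*} [LieRing M] [LieAlgebra K M]

open Classical in
/-- The coefficients of `exp (t ad e) exp (x ad g)`. -/
noncomputable def expCoeff (g e : M) (m : Mon) : M →ₗ[K] M :=
  if NoU m then ((m Coord.t).factorial * (m Coord.x).factorial : K)⁻¹ •
    (LieAlgebra.ad K M e ^ m Coord.t * LieAlgebra.ad K M g ^ m Coord.x) else 0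

/-- The series `exp (t ad e) exp (x ad g) v`. -/
noncomputable def expSeries (g e : M) : M →ₗ[K] Ser M where
  toFun v m := expCoeff g e m v
  map_add' v w := Ser.ext fun m => map_add (expCoeff g e m) v w
  map_smul' r v := Ser.ext fun m => map_smul (expCoeff g e m) r v

theorem expSeries_of_noU (g e v : M) {m : Mon} (hm : NoU m) : expSeries (K := K) g e v m =
    ((m Coord.t).factorial * (m Coord.x).factorial : K)⁻¹ •
      (LieAlgebra.ad K M e ^ m Coord.t) ((LieAlgebra.ad K M g ^ m Coord.x) v) := by
  change expCoeff g e m v = _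
  rw [expCoeff, if_pos hm]
  rfl

theorem expSeries_of_not (g e v : M) {m : Mon} (hm : ¬ NoU m) :
    expSeries (K := K) g e v m = 0 := by
  change expCoeff g e m v = _
  rw [expCoeff, if_neg hm]
  rfl

theorem expSeries_apply_zero (g e v : M) : expSeries (K := K) g e v 0 = v := by
  rw [expSeries_of_noU _ _ _ fun _ _ => rfl]
  simp

theorem expSeries_congr (g g' e v : M) {m : Mon} (hm : m Coord.x = 0) :
    expSeries (K := K) g e v m = expSeries (K := K) g' e v m := by
  by_cases h : NoU m
  · rw [expSeries_of_noU _ _ _ h, expSeries_of_noU _ _ _ h, hm, pow_zero, pow_zero]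
  · rw [expSeries_of_not _ _ _ h, expSeries_of_not _ _ _ h]

theorem noU_add_single {m : Mon} {c : Coord} (hc : ∀ k, c ≠ Coord.u k) :
    NoU (m + Finsupp.single c 1) ↔ NoU m := by
  refine forall_congr' fun k => forall_congr' fun _ => ?_
  rw [Finsupp.add_apply, Finsupp.single_eq_of_ne (hc k).symm, add_zero]

theorem pd_u_expSeries (g e v : M) (k : ℕ) : pd K (Coord.u k) (expSeries (K := K) g e v) = 0 := by
  ext m
  rw [pd_apply, expSeries_of_not, smul_zero, Ser.zero_apply]
  intro h
  have := h k (Nat.zero_le k)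
  simp at this

variable [CharZero K]

theorem pd_x_expSeries (g e v : M) : pd K Coord.x (expSeries (K := K) g e v) =
    expSeries (K := K) g e ⁅g, v⁆ := by
  ext m
  rw [pd_apply]
  have hs := noU_add_single (m := m) (c := Coord.x) fun k => by simp
  by_cases h : NoU m
  · rw [expSeries_of_noU _ _ _ (hs.2 h), expSeries_of_noU _ _ _ h]
    have ht : (m + Finsupp.single Coord.x 1 : Mon) Coord.t = m Coord.t := by simp
    have hx : (m + Finsupp.single Coord.x 1 : Mon) Coord.x = m Coord.x + 1 := by simp
    rw [ht, hx, pow_succ, Module.End.mul_apply, LieAlgebra.ad_apply, ← Nat.cast_smul_eq_nsmul K,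
      smul_smul]
    congr 1
    rw [Nat.factorial_succ]
    have h1 : ((m Coord.x + 1 : ℕ) : K) ≠ 0 := Nat.cast_ne_zero.2 (Nat.succ_ne_zero _)
    have h2 : ((m Coord.x).factorial : K) ≠ 0 := Nat.cast_ne_zero.2 (Nat.factorial_ne_zero _)
    have h3 : ((m Coord.t).factorial : K) ≠ 0 := Nat.cast_ne_zero.2 (Nat.factorial_ne_zero _)
    push_cast at h1 ⊢
    field_simp
  · rw [expSeries_of_not _ _ _ (mt hs.1 h), expSeries_of_not _ _ _ h, smul_zero]

theorem pd_t_expSeries (g e v : M) (m : Mon) : pd K Coord.t (expSeries (K := K) g e v) m =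
    ⁅e, expSeries (K := K) g e v m⁆ := by
  rw [pd_apply]
  have hs := noU_add_single (m := m) (c := Coord.t) fun k => by simp
  by_cases h : NoU m
  · rw [expSeries_of_noU _ _ _ (hs.2 h), expSeries_of_noU _ _ _ h]
    have ht : (m + Finsupp.single Coord.t 1 : Mon) Coord.t = m Coord.t + 1 := by simp
    have hx : (m + Finsupp.single Coord.t 1 : Mon) Coord.x = m Coord.x := by simp
    rw [ht, hx, pow_succ', Module.End.mul_apply, LieAlgebra.ad_apply, ← Nat.cast_smul_eq_nsmul K,
      smul_smul, lie_smul]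
    congr 1
    rw [Nat.factorial_succ]
    have h1 : ((m Coord.t + 1 : ℕ) : K) ≠ 0 := Nat.cast_ne_zero.2 (Nat.succ_ne_zero _)
    have h2 : ((m Coord.x).factorial : K) ≠ 0 := Nat.cast_ne_zero.2 (Nat.factorial_ne_zero _)
    have h3 : ((m Coord.t).factorial : K) ≠ 0 := Nat.cast_ne_zero.2 (Nat.factorial_ne_zero _)
    push_cast at h1 ⊢
    field_simp
  · rw [expSeries_of_not _ _ _ (mt hs.1 h), expSeries_of_not _ _ _ h, smul_zero, lie_zero]

/-- Uniqueness for a family of series whose derivatives are determined by the family. -/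
theorem Ser.family_eq_zero {ι : Type*} {d : ι → Ser M} (h0 : ∀ i, d i 0 = 0)
    (hd : ∀ i c m, (∀ j, d j m = 0) → pd K c (d i) m = 0) (i : ι) : d i = 0 := by
  ext m
  rw [Ser.zero_apply]
  induction m using WellFoundedLT.induction generalizing i with
  | ind m ih =>
    by_cases hm : m = 0
    · rw [hm, h0]
    · obtain ⟨c, hc0⟩ := Finsupp.ne_iff.1 hm
      have ha : m - Finsupp.single c 1 + Finsupp.single c 1 = m := by
        refine tsub_add_cancel_of_le ?_
        rw [Finsupp.single_le_iff]
        exact Nat.one_le_iff_ne_zero.2 hc0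
      have hlt : m - Finsupp.single c 1 < m := by
        conv_rhs => rw [← ha]
        exact lt_add_of_pos_right _ (pos_iff_ne_zero.2 (by simp))
      have := hd i c _ fun j => ih _ hlt j
      rw [pd_apply, ha] at this
      exact nsmul_eq_zero_imp K this

/-- Exponentials of derivations are automorphisms. The proof uses uniqueness for the whole family of
pairs (v, w), because the x-derivative of one defect is a sum of other members of the family. -/
theorem lie_expSeries (g e v w : M) :
    ⁅expSeries (K := K) g e v, expSeries (K := K) g e w⁆ = expSeries (K := K) g e ⁅v, w⁆ := by
  have key := Ser.family_eq_zero (K := K) (ι := M × M)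
    (d := fun i => ⁅expSeries (K := K) g e i.1, expSeries (K := K) g e i.2⁆ -
      expSeries (K := K) g e ⁅i.1, i.2⁆) ?_ ?_ (v, w)
  · exact sub_eq_zero.1 key
  · intro i
    rw [Ser.sub_apply, lie_apply_zero, expSeries_apply_zero, expSeries_apply_zero,
      expSeries_apply_zero, sub_self]
  · rintro ⟨v, w⟩ (_ | _ | k) m hm
    · have h1 := hm (⁅g, v⁆, w)
      have h2 := hm (v, ⁅g, w⁆)
      rw [Ser.sub_apply, sub_eq_zero] at h1 h2
      rw [map_sub, pd_lie, pd_x_expSeries, pd_x_expSeries, pd_x_expSeries, Ser.sub_apply,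
        Ser.add_apply, leibniz_lie, map_add, Ser.add_apply, h1, h2, sub_self]
    · have h1 := hm (v, w)
      rw [Ser.sub_apply, sub_eq_zero] at h1
      rw [map_sub, pd_lie, Ser.sub_apply, Ser.add_apply, pd_t_expSeries, ← h1, lie_apply, lie_apply,
        lie_apply, lie_sum, ← Finset.sum_add_distrib, sub_eq_zero]
      refine Finset.sum_congr rfl fun q _ => ?_
      rw [pd_t_expSeries, pd_t_expSeries, leibniz_lie e]
    · rw [map_sub, pd_lie, pd_u_expSeries, pd_u_expSeries, pd_u_expSeries, zero_lie, lie_zero,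
        add_zero, sub_zero, Ser.zero_apply]

/-- Formally, exp(t ad e) fixes e, so ad e may be moved inside, where it splits as r ad g - ad b.
The series with first argument 0 is exp(t ad e) b. -/
theorem pd_t_expSeries_eq {g e b : M} {r : K} (h : e = r • g - b) (v : M) :
    pd K Coord.t (expSeries (K := K) g e v) =
      r • expSeries (K := K) g e ⁅g, v⁆ + ⁅expSeries (K := K) g e v, expSeries (K := K) 0 e b⁆ := by
  have hb : pd K Coord.x (expSeries (K := K) 0 e b) = 0 := by
    rw [pd_x_expSeries, zero_lie, map_zero]
  have key := Ser.family_eq_zero (K := K) (ι := M)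
    (d := fun v => pd K Coord.t (expSeries (K := K) g e v) - (r • expSeries (K := K) g e ⁅g, v⁆ +
      ⁅expSeries (K := K) g e v, expSeries (K := K) 0 e b⁆)) ?_ ?_ v
  · exact sub_eq_zero.1 key
  · intro v
    rw [Ser.sub_apply, Ser.add_apply, Ser.smul_apply, lie_apply_zero, pd_t_expSeries,
      expSeries_apply_zero, expSeries_apply_zero, expSeries_apply_zero, h, sub_lie, smul_lie,
      ← lie_skew v b]
    abel
  · rintro v (_ | _ | k) m hm
    · rw [map_sub, pd_comm, pd_x_expSeries, map_add, map_smul, pd_x_expSeries, pd_lie,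
        pd_x_expSeries, hb, lie_zero, add_zero]
      exact hm ⁅g, v⁆
    · have h1 := hm v
      rw [Ser.sub_apply, sub_eq_zero, pd_t_expSeries] at h1
      have e1 : pd K Coord.t (pd K Coord.t (expSeries (K := K) g e v)) m =
          ⁅e, ⁅e, expSeries (K := K) g e v m⁆⁆ := by
        rw [pd_apply, pd_t_expSeries, ← lie_nsmul, ← pd_apply (K := K), pd_t_expSeries]
      rw [map_sub, map_add, map_smul, Ser.sub_apply, e1, h1, pd_lie, Ser.add_apply, Ser.add_apply,
        Ser.add_apply, Ser.smul_apply, Ser.smul_apply, pd_t_expSeries, lie_add, lie_smul, sub_eq_zero,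
        lie_apply, lie_apply, lie_apply, lie_sum, ← Finset.sum_add_distrib]
      congr 1
      refine Finset.sum_congr rfl fun q _ => ?_
      rw [pd_t_expSeries, pd_t_expSeries, leibniz_lie e]
    · rw [map_sub, pd_comm, pd_u_expSeries, map_add, map_smul, pd_lie, pd_u_expSeries,
        pd_u_expSeries, pd_u_expSeries, map_zero]
      simp

end ExpSeries

end EvolutionZCR

/-! ### Homomorphisms from 𝔽⁰ built from exponential solutions -/

namespace EvolutionZCR

open Ser

section Homomorphism

variable {K : Type*} [Field K] {M : Type*} [LieRing M] [LieAlgebra K M] {α β : K}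

variable [CharZero K] in
theorem dx_expSeries (g e v : M) (n : ℕ) :
    dx K n (expSeries (K := K) g e v) = expSeries (K := K) g e ((LieAlgebra.ad K M g ^ n) v) := by
  induction n with
  | zero => rfl
  | succ n ih => rw [dx_succ, ih, pd_x_expSeries, pow_succ', Module.End.mul_apply,
      LieAlgebra.ad_apply]

variable {a₀ : K} {g f₀ f₁ f₂ : M}

variable [CharZero K] in
-- Since ad g plays the role of ∂_x on the jet, the identities transfer from f₀, f₁, f₂. With Q_xxx
-- = -8αa₀Q_x, the coefficients of Q_x in the flow add up to (-20αβ + 64α² - 8α(8α - 2β))a₀² =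
-- -4αβa₀², the factor of g in e.
theorem isEvol_expSeries {e b : M} (he : e = (-4 * α * β * a₀ * a₀) • g - b)
    (g₀ : ⁅g, f₀⁆ = f₁) (g₁ : ⁅g, f₁⁆ = f₂) (g₂ : ⁅g, f₂⁆ = (-8 * α * a₀) • f₁)
    (h₀₁ : ⁅f₀, f₁⁆ = -((4 * α) • f₀)) (h₀₂ : ⁅f₀, f₂⁆ = -((4 * α) • f₁)) :
    IsEvol α β a₀ (expSeries (K := K) g e f₀) (expSeries (K := K) 0 e b) := by
  have d1 : dx K 1 (expSeries (K := K) g e f₀) = expSeries (K := K) g e f₁ := by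
    rw [dx_expSeries, pow_one, LieAlgebra.ad_apply, g₀]
  have d2 : dx K 2 (expSeries (K := K) g e f₀) = expSeries (K := K) g e f₂ := by
    rw [dx_succ, d1, pd_x_expSeries, g₁]
  have d3 : dx K 3 (expSeries (K := K) g e f₀) = (-8 * α * a₀) • expSeries (K := K) g e f₁ := by
    rw [dx_succ, d2, pd_x_expSeries, g₂, map_smul]
  have d4 : dx K 4 (expSeries (K := K) g e f₀) = (-8 * α * a₀) • expSeries (K := K) g e f₂ := by
    rw [dx_succ, d3, map_smul, pd_x_expSeries, g₁]
  have d5 : dx K 5 (expSeries (K := K) g e f₀) =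
      (-8 * α * a₀) • (-8 * α * a₀) • expSeries (K := K) g e f₁ := by
    rw [dx_succ, d4, map_smul, pd_x_expSeries, g₂, map_smul]
  have l1 : ⁅f₀, ⁅f₀, f₁⁆⁆ = 0 := by
    rw [h₀₁, lie_neg, lie_smul, lie_self, smul_zero, neg_zero]
  constructor
  · exact pd_u_expSeries g e f₀
  · exact pd_u_expSeries 0 e b
  · rw [pd_x_expSeries, zero_lie, map_zero]
  · rw [d1, lie_expSeries, lie_expSeries, l1, map_zero]
  · rw [d1, d2, lie_expSeries, h₀₂, map_neg, map_smul]
    module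
  · rw [d3, lie_smul, lie_smul, lie_expSeries, lie_expSeries, l1, map_zero, smul_zero]
  · rw [d1, d3, d4, lie_smul, lie_smul, lie_self, lie_expSeries, h₀₂, map_neg, map_smul]
    module
  · rw [pd_t_expSeries_eq he, g₀, d1, d3, d5]
    module

theorem pd_explB_of_le {a : Coord → K} {Q T W₁ W₂ W₃ : Ser M} (hQ : ∀ k, pd K (Coord.u k) Q = 0)
    (hc : IsCoeffs α β a₀ Q T W₁ W₂ W₃) {k : ℕ} (hk : 5 ≤ k) :
    pd K (Coord.u k) (explB α β a Q T W₁ W₂ W₃) = 0 := by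
  have hd : ∀ n, pd K (Coord.u k) (dx K n Q) = 0 := fun n => pd_dx (hQ k) n
  have h0 : k ≠ 0 := by omega
  have h1 : k ≠ 1 := by omega
  have h2 : k ≠ 2 := by omega
  have h3 : k ≠ 3 := by omega
  have h4 : k ≠ 4 := by omega
  simp [explB, pd_smul, pderiv_uc, pd_lie, hQ k, hd, hc.pd_T, hc.pd_W₁, hc.pd_W₂,
    hc.pd_W₃, h0, h1, h2, h3, h4]

theorem Ser.map_dx {L : Type*} [LieRing L] [LieAlgebra K L] (f : L →ₗ[K] M) {S : Ser L} {S' : Ser M}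
    (h : ∀ m, f (S m) = S' m) (n : ℕ) (m : Mon) : f (dx K n S m) = dx K n S' m := by
  induction n generalizing m with
  | zero => exact h m
  | succ n ih => rw [dx_succ, dx_succ, pd_apply, pd_apply, map_nsmul, ih]

variable [CharZero K]

theorem monBelow_of_pd {n : ℕ} {S : Ser M} (h : ∀ k, n ≤ k → pd K (Coord.u k) S = 0) {m : Mon}
    (hm : ¬ MonBelow n m) : S m = 0 := by
  obtain ⟨k, hk, h0⟩ : ∃ k, n ≤ k ∧ m (Coord.u k) ≠ 0 := by
    by_contra! hcon
    exact hm hcon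
  exact coeff_eq_zero_of_pd (h k hk) h0

/-- The homomorphism from `𝔽^0` given by three elements that satisfy the same relations as the jet
of `∂A/∂u_0`. -/
theorem exists_hom_of_relations (a : (fordy α β).Prolongation)
    (g₀ : ⁅g, f₀⁆ = f₁) (g₁ : ⁅g, f₁⁆ = f₂) (g₂ : ⁅g, f₂⁆ = (-8 * α * a (Coord.u 0)) • f₁)
    (h₀₁ : ⁅f₀, f₁⁆ = -((4 * α) • f₀)) (h₀₂ : ⁅f₀, f₂⁆ = -((4 * α) • f₁)) :
    ∃ ρ : Fd (fordy α β) a 0 →ₗ⁅K⁆ M,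
      ρ (jet α β a 0) = f₀ ∧ ρ (jet α β a 1) = f₁ ∧ ρ (jet α β a 2) = f₂ := by
  -- b is minus the explicit part of `B` at the point, with T = -2βQ and third jet -8αa_0 f₁; this
  -- choice achieves the normalization of `B`.
  obtain ⟨b, hb⟩ : ∃ b, b = -(a (Coord.u 4) • f₀ - a (Coord.u 3) • f₁ +
      a (Coord.u 2) • (f₂ + ((8 * α - 2 * β) * a (Coord.u 0)) • f₀) -
      a (Coord.u 1) • ((-8 * α * a (Coord.u 0)) • f₁ + ((8 * α - 2 * β) * a (Coord.u 0)) • f₁) +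
      (a (Coord.u 1) * a (Coord.u 1)) • (-2 * β) • f₀) := ⟨_, rfl⟩
  obtain ⟨e, he⟩ : ∃ e, e = (-4 * α * β * a (Coord.u 0) * a (Coord.u 0)) • g - b := ⟨_, rfl⟩
  have hev := isEvol_expSeries he g₀ g₁ g₂ h₀₁ h₀₂
  obtain ⟨Q, hQ⟩ : ∃ Q, Q = expSeries (K := K) g e f₀ := ⟨_, rfl⟩
  obtain ⟨B₀, hB₀⟩ : ∃ B₀, B₀ = expSeries (K := K) 0 e b := ⟨_, rfl⟩
  rw [← hQ, ← hB₀] at hev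
  have d1 : dx K 1 Q = expSeries (K := K) g e f₁ := by
    rw [hQ, dx_expSeries, pow_one, LieAlgebra.ad_apply, g₀]
  have d2 : dx K 2 Q = expSeries (K := K) g e f₂ := by
    rw [dx_succ, d1, pd_x_expSeries, g₁]
  have d3 : dx K 3 Q = (-8 * α * a (Coord.u 0)) • expSeries (K := K) g e f₁ := by
    rw [dx_succ, d2, pd_x_expSeries, g₂, map_smul]
  obtain ⟨T, W₁, W₂, W₃, hc⟩ := exists_isCoeffs α β (a (Coord.u 0)) hev.pd_u
  have hT : T = (-2 * β) • Q := by
    have := hc.T_eq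
    rw [C_smul, d1, hQ, lie_expSeries, h₀₁, map_neg, map_smul, ← hQ] at this
    rw [show T = (1 / 2 : K) • (T + T) by module, this]
    module
  have hz := hev.isZCR hc
  obtain ⟨A, hA⟩ : ∃ A, A = w0 K • Q := ⟨_, rfl⟩
  obtain ⟨B, hB⟩ : ∃ B, B = explB α β a Q T W₁ W₂ W₃ + B₀ := ⟨_, rfl⟩
  have hA0 : pd K (Coord.u 0) A = Q := by
    rw [hA, pd_smul, pderiv_w0, hev.pd_u, if_pos rfl, one_smul, smul_zero, add_zero]
  have hAk : ∀ k, 1 ≤ k → pd K (Coord.u k) A = 0 := fun k hk => by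
    rw [hA, pd_smul, pderiv_w0, hev.pd_u, if_neg (by omega), zero_smul, smul_zero, add_zero]
  have hAt : pd K Coord.t A = w0 K • pd K Coord.t Q := by
    rw [hA, pd_smul, MvPolynomial.pderiv_X_of_ne (by simp), zero_smul, zero_add]
  have hBk : ∀ k, 5 ≤ k → pd K (Coord.u k) B = 0 := fun k hk => by
    rw [hB, map_add, pd_explB_of_le hev.pd_u hc hk, hev.pd_u_B, add_zero]
  have hA' : ∀ m, ¬ MonBelow 1 m → A m = 0 := fun m hm => monBelow_of_pd hAk hm
  have hB' : ∀ m, ¬ MonBelow 5 m → B m = 0 := fun m hm => monBelow_of_pd hBk hm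
  have hzcr : (zcrExpr (fordy α β) a 0 A B : Ser M) = 0 := by
    rw [← zcrExpr_succ (fordy α β) a 0 hA' hB', zcrExpr_one_eq, hA0, hAk 1 le_rfl, smul_zero, add_zero, hAt,
      ← hz, ← hA, ← hB, nab_apply]
    abel
  -- At x = x_a, u = a both the explicit part and B₀ are exp(t ad e) applied to fixed vectors, so
  -- the choice of b at the point makes them cancel for all t.
  have hN : ∀ m, NoU m → m Coord.x = 0 → B m = 0 := by
    intro m hm hx
    have e2 : B₀ m = expSeries (K := K) g e b m := by rw [hB₀, expSeries_congr _ _ _ _ hx]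
    rw [hB, Ser.add_apply, explB_apply_of_noU hm, hT, d1, d2, d3, e2, hb, hQ]
    simp only [map_neg, map_add, map_sub, map_smul, Ser.add_apply, Ser.sub_apply, Ser.neg_apply,
      Ser.smul_apply]
    abel
  let G : Gen (fordy α β) 0 → M := fun s => match s with
    | Gen.A m _ => A m
    | Gen.B m _ => B m
  have hGA : genA G = A := by
    funext m
    by_cases h : MonBelow 1 m
    · exact genA_of _ h
    · rw [genA_of_not _ h]
      exact (hA' m h).symm
  have hGB : genB G = B := by
    funext m
    by_cases h : MonBelow 5 m
    · exact genB_of _ h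
    · rw [genB_of_not _ h]
      exact (hB' m h).symm
  obtain ⟨ρ, hρ⟩ := Fd.exists_lift (a := a) G
    (fun m => by
      rw [hGA, hGB]
      exact congrFun hzcr m)
    (fun m hm h => by
      change A m = 0
      rw [hA]
      exact X_smul_apply_of_eq_zero (h 0 le_rfl) Q)
    (fun m hm h hx => hN m h hx)
    (fun m hm h => by
      obtain ⟨r, h1, h2, -⟩ := h
      omega)
  have hρA : ∀ m, ρ (genA (Fd.of (fordy α β) a 0) m) = A m := by
    intro m
    have := congrFun (map_genA (ρ : Fd (fordy α β) a 0 →ₗ[K] M).toAddMonoidHom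
      (Fd.of (fordy α β) a 0)) m
    refine this.trans ?_
    rw [← hGA]
    congr 1
    exact funext hρ
  have hρj : ∀ n, ρ (jet α β a n) = (LieAlgebra.ad K M g ^ n) f₀ := by
    intro n
    refine (Ser.map_dx (ρ : Fd (fordy α β) a 0 →ₗ[K] M) (S' := Q) ?_ n 0).trans ?_
    · intro m
      rw [← hA0, pd_apply, ← hρA]
      exact map_nsmul ρ _ _
    · rw [hQ, dx_expSeries, expSeries_apply_zero]
  refine ⟨ρ, hρj 0, ?_, ?_⟩
  · rw [hρj, pow_one, LieAlgebra.ad_apply, g₀]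
  · rw [hρj, pow_two, Module.End.mul_apply, LieAlgebra.ad_apply, LieAlgebra.ad_apply, g₀, g₁]

end Homomorphism

/-! ### Splitting off the central kernel -/

section Splitting

variable {K : Type*} [Field K] {L M : Type*} [LieRing L] [LieAlgebra K L] [LieRing M]
  [LieAlgebra K M]

/-- A surjective homomorphism with central kernel that has a section splits. -/
theorem nonempty_equiv_prod_ker (ρ : L →ₗ⁅K⁆ M) (σ : M →ₗ⁅K⁆ L) (h : ∀ x, ρ (σ x) = x)
    (hc : ρ.ker ≤ LieAlgebra.center K L) : Nonempty (L ≃ₗ⁅K⁆ M × ρ.ker) := by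
  have hk : ∀ v, v - σ (ρ v) ∈ ρ.ker := fun v => by
    rw [LieHom.mem_ker, map_sub, h, sub_self]
  have hz : ∀ z ∈ ρ.ker, ∀ v, ⁅v, z⁆ = 0 := fun z hz v =>
    (LieModule.mem_maxTrivSubmodule K _ _ _).1 (hc hz) v
  refine ⟨{
    toFun := fun v => (ρ v, ⟨v - σ (ρ v), hk v⟩)
    invFun := fun p => σ p.1 + p.2
    map_add' := ?_
    map_smul' := ?_
    map_lie' := ?_
    left_inv := ?_
    right_inv := ?_ }⟩
  · intro v w
    refine Prod.ext (map_add ρ v w) (Subtype.ext ?_)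
    change v + w - σ (ρ (v + w)) = v - σ (ρ v) + (w - σ (ρ w))
    rw [map_add, map_add]
    abel
  · intro r v
    refine Prod.ext (map_smul ρ r v) (Subtype.ext ?_)
    change r • v - σ (ρ (r • v)) = r • (v - σ (ρ v))
    rw [map_smul, map_smul, smul_sub]
  · intro v w
    refine Prod.ext (LieHom.map_lie ρ v w) (Subtype.ext ?_)
    change ⁅v, w⁆ - σ (ρ ⁅v, w⁆) = ⁅v - σ (ρ v), w - σ (ρ w)⁆
    rw [hz _ (hk w), LieHom.map_lie, LieHom.map_lie]
    have e1 := hz _ (hk w) v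
    have e2 := hz _ (hk v) (σ (ρ w))
    rw [lie_sub, sub_eq_zero] at e1 e2
    rw [e1, ← lie_skew v, e2, lie_skew, sub_self]
  · intro v
    exact add_sub_cancel (σ (ρ v)) v
  · rintro ⟨x, z, hz⟩
    have hz' : ρ z = 0 := hz
    refine Prod.ext ?_ (Subtype.ext ?_)
    · change ρ (σ x + z) = x
      rw [map_add, h, hz', add_zero]
    · change σ x + z - σ (ρ (σ x + z)) = z
      rw [map_add, h, hz', add_zero, add_sub_cancel_left]

/-- Since ρ e₀, ρ e₁, ρ e₂ are independent and ρ z = 0, the kernel is spanned by the central element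
z, which may be zero. -/
theorem Relations.exists_equiv {c d : K} {e₀ e₁ e₂ z : L} (h : Relations c d e₀ e₁ e₂ z)
    (hs : ∀ v : L, ∃ x₀ x₁ x₂ x₃ : K, v = x₀ • e₀ + x₁ • e₁ + x₂ • e₂ + x₃ • z)
    (hc : c ≠ 0) (b : Module.Basis (Fin 3) K M) (h₀₁ : ⁅b 0, b 1⁆ = -(c • b 0))
    (h₀₂ : ⁅b 0, b 2⁆ = -(c • b 1)) (h₁₂ : ⁅b 1, b 2⁆ = -(c • b 2) - (c * d) • b 0)
    (ρ : L →ₗ⁅K⁆ M) (h₀ : ρ e₀ = b 0) (h₁ : ρ e₁ = b 1) (h₂ : ρ e₂ = b 2) :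
    IsLieAbelian ρ.ker ∧ Module.rank K ρ.ker ≤ 1 ∧ Nonempty (L ≃ₗ⁅K⁆ M × ρ.ker) := by
  have hzc : ∀ v, ⁅v, z⁆ = 0 := fun v => by rw [← lie_skew, h.central, neg_zero]
  have hρz : ρ z = 0 := by
    rw [show z = ⁅e₀, e₁⁆ + c • e₀ by rw [h.lie₀₁]; abel, map_add, LieHom.map_lie, map_smul, h₀, h₁,
      h₀₁]
    abel
  -- Replacing e₀ by e₀ - c⁻¹z absorbs z in both relations where it occurs; this is where c ≠ 0 is
  -- needed.
  obtain ⟨s, hs0, hs1, hs2⟩ : ∃ s : M →ₗ[K] L, s (b 0) = e₀ - c⁻¹ • z ∧ s (b 1) = e₁ ∧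
      s (b 2) = e₂ := by
    refine ⟨b.constr K ![e₀ - c⁻¹ • z, e₁, e₂], ?_, ?_, ?_⟩ <;> rw [Module.Basis.constr_basis] <;> rfl
  have hsum : ∀ x : M, ∃ y₀ y₁ y₂ : K, x = y₀ • b 0 + y₁ • b 1 + y₂ • b 2 := fun x =>
    ⟨b.repr x 0, b.repr x 1, b.repr x 2, by
      conv_lhs => rw [← b.sum_repr x, Fin.sum_univ_three]⟩
  have k10 : ⁅b 1, b 0⁆ = c • b 0 := by rw [← lie_skew, h₀₁, neg_neg]
  have k20 : ⁅b 2, b 0⁆ = c • b 1 := by rw [← lie_skew, h₀₂, neg_neg]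
  have k21 : ⁅b 2, b 1⁆ = -(-(c • b 2) - (c * d) • b 0) := by rw [← lie_skew, h₁₂]
  let σ : M →ₗ⁅K⁆ L := { s with
    map_lie' := by
      intro x y
      change s ⁅x, y⁆ = ⁅s x, s y⁆
      obtain ⟨x₀, x₁, x₂, rfl⟩ := hsum x
      obtain ⟨y₀, y₁, y₂, rfl⟩ := hsum y
      have e1 : ∀ w₀ w₁ w₂ : K, s (w₀ • b 0 + w₁ • b 1 + w₂ • b 2) =
          w₀ • e₀ + w₁ • e₁ + w₂ • e₂ + (-(w₀ * c⁻¹)) • z := fun w₀ w₁ w₂ => by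
        rw [map_add, map_add, map_smul, map_smul, map_smul, hs0, hs1, hs2]
        module
      have e2 : ⁅x₀ • b 0 + x₁ • b 1 + x₂ • b 2, y₀ • b 0 + y₁ • b 1 + y₂ • b 2⁆ =
          (-c * (x₀ * y₁ - x₁ * y₀) - c * d * (x₁ * y₂ - x₂ * y₁)) • b 0 +
          (-c * (x₀ * y₂ - x₂ * y₀)) • b 1 + (-c * (x₁ * y₂ - x₂ * y₁)) • b 2 := by
        simp only [add_lie, lie_add, smul_lie, lie_smul, lie_self, h₀₁, h₀₂, h₁₂, k10, k20, k21]
        module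
      rw [e1, e1, h.lie_eq, e2, e1]
      congr 2
      field_simp
      ring }
  have hσ : ∀ x, ρ (σ x) = x := by
    intro x
    obtain ⟨x₀, x₁, x₂, rfl⟩ := hsum x
    change ρ (s _) = _
    simp only [map_add, map_smul, map_sub, hs0, hs1, hs2, h₀, h₁, h₂, hρz, smul_zero, sub_zero]
  have hker : ∀ v ∈ ρ.ker, ∃ r : K, r • z = v := by
    intro v hv
    obtain ⟨x₀, x₁, x₂, x₃, rfl⟩ := hs v
    have e1 : ρ _ = 0 := hv
    rw [map_add, map_add, map_add, map_smul, map_smul, map_smul, map_smul, h₀, h₁, h₂, hρz,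
      smul_zero, add_zero] at e1
    have e2 : s 0 = _ := congrArg s e1.symm
    rw [map_zero, map_add, map_add, map_smul, map_smul, map_smul, hs0, hs1, hs2] at e2
    refine ⟨x₀ * c⁻¹ + x₃, ?_⟩
    linear_combination (norm := module) e2
  have hcen : ρ.ker ≤ LieAlgebra.center K L := by
    intro v hv
    obtain ⟨r, rfl⟩ := hker v hv
    exact (LieModule.mem_maxTrivSubmodule K _ _ _).2 fun w => by rw [lie_smul, hzc, smul_zero]
  refine ⟨⟨fun v w => Subtype.ext ?_⟩, ?_, nonempty_equiv_prod_ker ρ σ hσ hcen⟩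
  · exact (LieModule.mem_maxTrivSubmodule K _ _ _).1 (hcen w.2) v
  · refine rank_le_one_iff.2 ⟨⟨z, hρz⟩, fun v => ?_⟩
    obtain ⟨r, hr⟩ := hker v v.2
    exact ⟨r, Subtype.ext hr⟩

end Splitting

/-! ### A basis of sl₂ adapted to the relations -/

section SpecialLinear

open LieAlgebra.SpecialLinear

variable {K : Type*} [Field K]

/-- The element of `𝔰𝔩₂` with upper row `(q, p)` and lower row `(s, -q)`. -/
def slMk (p q s : K) : sl (Fin 2) K :=
  ⟨!![q, p; s, -q], by
    change Matrix.trace !![q, p; s, -q] = 0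
    rw [Matrix.trace_fin_two_of, add_neg_cancel]⟩

theorem slMk_eq (x : sl (Fin 2) K) : slMk (x.1 0 1) (x.1 0 0) (x.1 1 0) = x := by
  have h : x.1 0 0 + x.1 1 1 = 0 := by
    have ht : Matrix.trace (x.1 : Matrix (Fin 2) (Fin 2) K) = 0 := x.2
    rwa [Matrix.trace_fin_two] at ht
  refine Subtype.ext ?_
  change !![_, _; _, _] = _
  rw [← eq_neg_of_add_eq_zero_right h]
  exact (Matrix.eta_fin_two x.1).symm

theorem slMk_lie (p q s p' q' s' : K) : ⁅slMk p q s, slMk p' q' s'⁆ =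
    slMk (2 * (q * p' - p * q')) (p * s' - s * p') (2 * (s * q' - q * s')) := by
  refine Subtype.ext ?_
  rw [sl_bracket]
  simp only [slMk]
  ext i j
  fin_cases i <;> fin_cases j <;> simp <;> ring

theorem slMk_add (p q s p' q' s' : K) :
    slMk p q s + slMk p' q' s' = slMk (p + p') (q + q') (s + s') := by
  refine Subtype.ext ?_
  change !![_, _; _, _] + !![_, _; _, _] = !![_, _; _, _]
  ext i j
  fin_cases i <;> fin_cases j <;> simp [add_comm]

theorem slMk_smul (r p q s : K) : r • slMk p q s = slMk (r * p) (r * q) (r * s) := by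
  refine Subtype.ext ?_
  change r • !![_, _; _, _] = !![_, _; _, _]
  ext i j
  fin_cases i <;> fin_cases j <;> simp

theorem slMk_neg (p q s : K) : -slMk p q s = slMk (-p) (-q) (-s) := by
  rw [← neg_one_smul K, slMk_smul]
  simp

variable [CharZero K]

/-- A basis of `𝔰𝔩₂`. -/
theorem exists_sl_basis {c : K} (hc : c ≠ 0) (a₀ : K) :
    ∃ b : Module.Basis (Fin 3) K (sl (Fin 2) K), b 0 = slMk 1 0 0 ∧ b 1 = slMk 0 (c / 2) 0 ∧
      b 2 = slMk (-c * a₀) 0 (-(c * c / 2)) := by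
  have key : ∀ y₀ y₁ y₂ : K, y₀ • slMk 1 0 0 + y₁ • slMk 0 (c / 2) 0 +
      y₂ • slMk (-c * a₀) 0 (-(c * c / 2)) =
        slMk (y₀ - y₂ * c * a₀) (y₁ * c / 2) (-(y₂ * c * c / 2)) := fun y₀ y₁ y₂ => by
    rw [slMk_smul, slMk_smul, slMk_smul, slMk_add, slMk_add]
    congr 1 <;> ring
  obtain ⟨v, hv⟩ : ∃ v, v = ![slMk 1 0 0, slMk 0 (c / 2) 0, slMk (-c * a₀) 0 (-(c * c / 2))] :=
    ⟨_, rfl⟩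
  have hli : LinearIndependent K v := by
    rw [Fintype.linearIndependent_iff, hv]
    intro y hy
    rw [Fin.sum_univ_three] at hy
    have hy' := congrArg Subtype.val ((key (y 0) (y 1) (y 2)).symm.trans hy)
    have h0 : y 0 - y 2 * c * a₀ = 0 := congrFun (congrFun hy' 0) 1
    have h1 : y 1 * c / 2 = 0 := congrFun (congrFun hy' 0) 0
    have h2 : -(y 2 * c * c / 2) = 0 := congrFun (congrFun hy' 1) 0
    have g1 : y 1 = 0 := by simpa [hc] using h1
    have g2 : y 2 = 0 := by simpa [hc] using h2
    rw [g2, zero_mul, zero_mul, sub_zero] at h0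
    intro i
    fin_cases i
    · exact h0
    · exact g1
    · exact g2
  have hsp : ⊤ ≤ Submodule.span K (Set.range v) := by
    intro x _
    have hx : x = (x.1 0 1 - 2 * a₀ / c * x.1 1 0) • v 0 + (2 / c * x.1 0 0) • v 1 +
        (-(2 / (c * c) * x.1 1 0)) • v 2 := by
      rw [hv]
      refine (slMk_eq x).symm.trans (Eq.trans ?_ (key _ _ _).symm)
      congr 1
      · field_simp
        ring
      · field_simp
      · field_simp
    rw [hx]
    have hm : ∀ i, v i ∈ Submodule.span K (Set.range v) := fun i =>
      Submodule.subset_span ⟨i, rfl⟩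
    exact add_mem (add_mem (Submodule.smul_mem _ _ (hm 0)) (Submodule.smul_mem _ _ (hm 1)))
      (Submodule.smul_mem _ _ (hm 2))
  refine ⟨Module.Basis.mk hli hsp, ?_, ?_, ?_⟩ <;> rw [Module.Basis.mk_apply, hv] <;> rfl

end SpecialLinear

end EvolutionZCR

/-! ### Conclusions for Fordy's equation -/

namespace EvolutionZCR

section Fordy

variable {K : Type*} [Field K] [CharZero K] {α β : K} (a : (fordy α β).Prolongation)

theorem fordy_isSl2PlusAbelian (h1 : α + β ≠ 0) (h2 : 6 * α + β ≠ 0) (h3 : 16 * α + β ≠ 0)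
    (hα : α ≠ 0) : IsSl2PlusAbelian K (Fd (fordy α β) a 0) 3 := by
  obtain ⟨z, hz, hs⟩ := exists_relations a h1 h2 h3
  have hc : 4 * α ≠ 0 := mul_ne_zero (by norm_num) hα
  obtain ⟨b, b0, b1, b2⟩ := exists_sl_basis hc (a (Coord.u 0))
  have h₀₁ : ⁅b 0, b 1⁆ = -((4 * α) • b 0) := by
    rw [b0, b1, slMk_lie, slMk_smul, slMk_neg]
    congr 1 <;> ring
  have h₀₂ : ⁅b 0, b 2⁆ = -((4 * α) • b 1) := by
    rw [b0, b1, b2, slMk_lie, slMk_smul, slMk_neg]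
    congr 1 <;> ring
  have h₁₂ : ⁅b 1, b 2⁆ = -((4 * α) • b 2) - (4 * α * (8 * α * a (Coord.u 0))) • b 0 := by
    rw [sub_eq_add_neg, b0, b1, b2, slMk_lie, slMk_smul, slMk_smul, slMk_neg, slMk_neg, slMk_add]
    congr 1 <;> ring
  -- Every derivation of sl₂ is inner. This element induces the one that sends b 0 to b 1, b 1 to b
  -- 2 and b 2 to -8αa_0 b 1.
  obtain ⟨g, hg⟩ : ∃ g, g = slMk (a (Coord.u 0)) 0 (-(4 * α) / 2) := ⟨_, rfl⟩
  obtain ⟨ρ, r0, r1, r2⟩ := exists_hom_of_relations (g := g) (f₀ := b 0) (f₁ := b 1) (f₂ := b 2) a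
    (by
      rw [hg, b0, b1, slMk_lie]
      congr 1 <;> ring)
    (by
      rw [hg, b1, b2, slMk_lie]
      congr 1 <;> ring)
    (by
      rw [hg, b1, b2, slMk_lie, slMk_smul]
      congr 1 <;> ring) h₀₁ h₀₂
  obtain ⟨k1, k2, k3⟩ := hz.exists_equiv hs hc b h₀₁ h₀₂ h₁₂ ρ r0 r1 r2
  exact ⟨ρ.ker, inferInstance, inferInstance, k1, k2.trans (by norm_num), k3⟩

theorem fordy_isNilpotent (h1 : α + β ≠ 0) (h2 : 6 * α + β ≠ 0) (h3 : 16 * α + β ≠ 0)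
    (hα : α = 0) :
    LieRing.IsNilpotent (Fd (fordy α β) a 0) ∧ Module.rank K (Fd (fordy α β) a 0) ≤ 6 := by
  obtain ⟨z, hz, hs⟩ := exists_relations a h1 h2 h3
  refine ⟨Relations.isNilpotent (d := 8 * α * a (Coord.u 0)) ?_ hs,
    (rank_le_four hs).trans (by norm_num)⟩
  rwa [show (4 * α : K) = 0 by rw [hα, mul_zero]] at hz

end Fordy

end EvolutionZCR

theorem mainTheorem9 {K : Type*} [RCLike K] (α β : K) (hαβ : α ≠ 0 ∨ β ≠ 0)
    (a : (EvolutionZCR.fordy α β).Prolongation) :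
    (Function.Surjective (EvolutionZCR.fdHom (EvolutionZCR.fordy α β) a 0) ∧
      (∀ v₁ v₂ : EvolutionZCR.Fd (EvolutionZCR.fordy α β) a 1,
        v₁ ∈ (EvolutionZCR.fdHom (EvolutionZCR.fordy α β) a 0).ker → ⁅v₁, v₂⁆ = 0) ∧
      EvolutionZCR.IsCentralExtensionOf K
        (EvolutionZCR.Fd (EvolutionZCR.fordy α β) a 1)
        (EvolutionZCR.Fd (EvolutionZCR.fordy α β) a 0)) ∧
    (α + β ≠ 0 → 6 * α + β ≠ 0 → 16 * α + β ≠ 0 → α ≠ 0 →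
      EvolutionZCR.IsSl2PlusAbelian K (EvolutionZCR.Fd (EvolutionZCR.fordy α β) a 0) 3) ∧
    (α = 0 → β ≠ 0 →
      LieRing.IsNilpotent (EvolutionZCR.Fd (EvolutionZCR.fordy α β) a 0) ∧
      Module.rank K (EvolutionZCR.Fd (EvolutionZCR.fordy α β) a 0) ≤ 6) := by
  have hs := EvolutionZCR.fdHom_surjective (E := EvolutionZCR.fordy α β) (a := a) (p := 0)
  have hc := EvolutionZCR.fordy_ker_le_center α β a
  refine ⟨⟨hs, fun v₁ v₂ hv => ?_, EvolutionZCR.isCentralExtensionOf_of_surjective _ hs hc⟩,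
    fun h1 h2 h3 hα => EvolutionZCR.fordy_isSl2PlusAbelian a h1 h2 h3 hα, fun hα hβ => ?_⟩
  · rw [← lie_skew, (LieModule.mem_maxTrivSubmodule K _ _ _).1 (hc hv) v₂, neg_zero]
  -- For α = 0 all three nondegeneracy conditions become β ≠ 0.
  · refine EvolutionZCR.fordy_isNilpotent a ?_ ?_ ?_ hα <;> simpa [hα] using hβ
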